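/- Let $d,r,k$ be integers with $r\ge 1$ and $1\le k\le d$. Let $\mathbb P^{(d+1)(r+1)-1}$ be the complex projective space of nonzero $(r+1)$-tuples $(f_0,\dots,f_r)$, modulo homothety, of complex binary forms $f_i(x,y)=\sum_{j=0}^{d}s_{ij}x^{d-j}y^{j}$ of degree $d$. For $0\le m\le d$ let $R_m\subset\mathbb P^{(d+1)(r+1)-1}$ be the set of tuples such that $f_0,\dots,f_r$ have at least $d-m+1$ common roots in $\mathbb P^1$, counted with multiplicity (so $R_0=\emptyset$). Let $A$ be the $(r+1)k\times(d+k)$ matrix made of $k$ blocks of $r+1$ rows, where row $i$ ($0\le i\le r$) of block $b$ ($0\le b\le k-1$) is $$(\underbrace{0,\dots,0}_{b},\,s_{i0},s_{i1},\dots,s_{id},\,\underbrace{0,\dots,0}_{k-1-b}).$$ Then the following hold. 1. The singular locus of $R_k$ (with its reduced structure) is exactly $R_{k-1}$. 2. $R_k$ is the common zero locus of the $2k\times 2k$ minors of $A$. 3. $R_k\setminus R_{k-1}$ is smooth. Moreover, consider the multiplication map $$\Phi_k:\mathbb P^{(r+1)k-1}\times\mathbb P^{d-k+1}\to\mathbb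 P^{(d+1)(r+1)-1},\qquad (g_0,\dots,g_r;p)\mapsto(g_0p,\dots,g_rp),$$ where the $g_i$ are binary forms of degree $k-1$, not all zero, and $p$ is a nonzero binary form of degree $d-k+1$, each of the two factors being taken modulo homothety. The preimage $U=\Phi_k^{-1}(R_k\setminus R_{k-1})$ is Zariski open in $\mathbb P^{(r+1)k-1}\times\mathbb P^{d-k+1}$, and $\Phi_k$ restricts to an isomorphism of varieties from $U$ onto $R_k\setminus R_{k-1}$. -/

import Mathlib

open scoped LinearAlgebra.Projectivization

noncomputable section

namespace CommonRootStrata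

/-! ### Projective varieties over `ℂ`

The projective space with homogeneous coordinates indexed by a finite type `ι` is
`ℙ ℂ (ι → ℂ)`. -/

/-- The projective space with homogeneous coordinates indexed by `ι`. -/
abbrev PSpace (ι : Type) : Type := ℙ ℂ (ι → ℂ)

section ProjectiveVarieties

variable {ι κ τ : Type}

/-- `F` vanishes at the point `x`. (Used for homogeneous `F` only, so that the choice of
homogeneous coordinates of `x` is irrelevant.) -/
def VanishesAt (F : MvPolynomial ι ℂ) (x : PSpace ι) : Prop :=
  MvPolynomial.eval x.rep F = 0

/-- Zariski closed subsets: common zero loci of homogeneous polynomials. -/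
def IsZariskiClosed (X : Set (PSpace ι)) : Prop :=
  ∃ S : Set (MvPolynomial ι ℂ), (∀ F ∈ S, ∃ n, F.IsHomogeneous n) ∧
    X = {x | ∀ F ∈ S, VanishesAt F x}

/-- Zariski open subsets of projective space. -/
def IsZariskiOpen (U : Set (PSpace ι)) : Prop := IsZariskiClosed Uᶜ

/-- The homogeneous ideal `I(X)`, generated by all homogeneous polynomials that vanish at every
point of `X`. -/
def vanishingIdeal (X : Set (PSpace ι)) : Ideal (MvPolynomial ι ℂ) :=
  Ideal.span {F | (∃ n, F.IsHomogeneous n) ∧ ∀ x ∈ X, VanishesAt F x}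

/-- The Krull dimension of the homogeneous coordinate ring of (the Zariski closure of) `X`. It is
the dimension of the affine cone over `X`, that is, `dim X + 1`. -/
def coneDim (X : Set (PSpace ι)) : WithBot ℕ∞ :=
  ringKrullDim (MvPolynomial ι ℂ ⧸ vanishingIdeal X)

/-- The local dimension of `X` at `x`, plus one: the largest value of `dim Z + 1` over the
irreducible subsets `Z` of `X` through `x` (`Z` is irreducible if and only if `I(Z)` is prime). -/
def localConeDim (X : Set (PSpace ι)) (x : PSpace ι) : WithBot ℕ∞ :=
  ⨆ Z ∈ {Z : Set (PSpace ι) | Z ⊆ X ∧ x ∈ Z ∧ (vanishingIdeal Z).IsPrime}, coneDim Z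

/-- The tangent space, at the vector `x.rep`, of the affine cone over `X`: the vectors on which
the differentials of all elements of `I(X)` vanish. It contains `x.rep` for `x ∈ X`, and its
quotient by that line is the Zariski tangent space of `X` at `x`. -/
def coneTangentSpace [Fintype ι] (X : Set (PSpace ι)) (x : PSpace ι) : Submodule ℂ (ι → ℂ) where
  carrier := {w | ∀ F ∈ vanishingIdeal X,
    ∑ j, MvPolynomial.eval x.rep (MvPolynomial.pderiv j F) * w j = 0}
  add_mem' := by
    intro a b ha hb F hF
    simp only [Pi.add_apply, mul_add, Finset.sum_add_distrib, ha F hF, hb F hF, add_zero]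
  zero_mem' := by
    intro F _
    simp
  smul_mem' := by
    intro c w hw F hF
    have h : ∑ j, MvPolynomial.eval x.rep (MvPolynomial.pderiv j F) * (c • w) j
        = c * ∑ j, MvPolynomial.eval x.rep (MvPolynomial.pderiv j F) * w j := by
      rw [Finset.mul_sum]
      refine Finset.sum_congr rfl fun j _ => ?_
      simp only [Pi.smul_apply, smul_eq_mul]
      ring
    rw [h, hw F hF, mul_zero]

/-- A point `x` of a locally closed `X` is smooth when the tangent space of `X` at `x` has the
dimension of `X` at `x`; equivalently, the rank of the Jacobian matrix of the equations of `X` at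
`x` is the codimension of `X` at `x`. (One is added to both dimensions by passing to cones.) -/
def IsSmoothPoint [Fintype ι] (X : Set (PSpace ι)) (x : PSpace ι) : Prop :=
  ((Module.finrank ℂ (coneTangentSpace X x) : ℕ) : WithBot ℕ∞) = localConeDim X x

/-- The set of points of `X` that are not smooth. -/
def singularLocus [Fintype ι] (X : Set (PSpace ι)) : Set (PSpace ι) :=
  {x ∈ X | ¬ IsSmoothPoint X x}

/-- `φ` restricts to a regular map on `X ⊆ ℙ^n`: near each point of `X` it is given by
homogeneous polynomials of one degree without common zero. -/
def IsRegularOn (X : Set (PSpace ι)) (φ : PSpace ι → PSpace κ) : Prop :=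
  ∀ x ∈ X, ∃ U : Set (PSpace ι), IsZariskiOpen U ∧ x ∈ U ∧
    ∃ (n : ℕ) (F : κ → MvPolynomial ι ℂ), (∀ j, (F j).IsHomogeneous n) ∧
      ∀ y ∈ X ∩ U, ∃ h : (fun j => MvPolynomial.eval y.rep (F j)) ≠ 0,
        φ y = Projectivization.mk ℂ (fun j => MvPolynomial.eval y.rep (F j)) h

/-! ### Products of two projective spaces -/

/-- Bihomogeneous polynomials of bidegree `(m, n)` in two groups of variables. -/
def IsBihomogeneous (F : MvPolynomial (ι ⊕ κ) ℂ) (m n : ℕ) : Prop :=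
  MvPolynomial.IsWeightedHomogeneous
    (Sum.elim (fun _ => ((1, 0) : ℕ × ℕ)) (fun _ => ((0, 1) : ℕ × ℕ))) F (m, n)

/-- The value of `F` at the chosen homogeneous coordinates of a point of the product. -/
def evalProd (z : PSpace ι × PSpace κ) (F : MvPolynomial (ι ⊕ κ) ℂ) : ℂ :=
  MvPolynomial.eval (Sum.elim z.1.rep z.2.rep) F

/-- Zariski closed subsets of a product: common zero loci of bihomogeneous polynomials. -/
def IsZariskiClosedProd (X : Set (PSpace ι × PSpace κ)) : Prop :=
  ∃ S : Set (MvPolynomial (ι ⊕ κ) ℂ), (∀ F ∈ S, ∃ m n, IsBihomogeneous F m n) ∧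
    X = {z | ∀ F ∈ S, evalProd z F = 0}

/-- Zariski open subsets of a product of two projective spaces. -/
def IsZariskiOpenProd (U : Set (PSpace ι × PSpace κ)) : Prop := IsZariskiClosedProd Uᶜ

/-- `φ` restricts to a regular map on `X ⊆ ℙ^m × ℙ^n`: near each point of `X` it is given by
bihomogeneous polynomials of one bidegree without common zero. -/
def IsRegularOnProd (X : Set (PSpace ι × PSpace κ)) (φ : PSpace ι × PSpace κ → PSpace τ) : Prop :=
  ∀ x ∈ X, ∃ U : Set (PSpace ι × PSpace κ), IsZariskiOpenProd U ∧ x ∈ U ∧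
    ∃ (m n : ℕ) (F : τ → MvPolynomial (ι ⊕ κ) ℂ), (∀ j, IsBihomogeneous (F j) m n) ∧
      ∀ y ∈ X ∩ U, ∃ h : (fun j => evalProd y (F j)) ≠ 0,
        φ y = Projectivization.mk ℂ (fun j => evalProd y (F j)) h

/-- `φ` restricts to an isomorphism of varieties from `U ⊆ ℙ^m × ℙ^n` onto `V ⊆ ℙ^N`. -/
def IsIsomorphismOn (φ : PSpace ι × PSpace κ → PSpace τ) (U : Set (PSpace ι × PSpace κ))
    (V : Set (PSpace τ)) : Prop :=
  Set.BijOn φ U V ∧ IsRegularOnProd U φ ∧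
    ∃ ψ : PSpace τ → PSpace ι × PSpace κ, Set.InvOn ψ φ U V ∧
      IsRegularOn V (fun y => (ψ y).1) ∧ IsRegularOn V (fun y => (ψ y).2)

end ProjectiveVarieties

/-! ### Tuples of binary forms and their common roots -/

/-- The binary form `∑ j, c j * x ^ (e - j) * y ^ j` of degree `e`, where `x = X 0`, `y = X 1`. -/
def binaryForm {e : ℕ} (c : Fin (e + 1) → ℂ) : MvPolynomial (Fin 2) ℂ :=
  ∑ j : Fin (e + 1), MvPolynomial.C (c j) *
    (MvPolynomial.X 0 ^ (e - (j : ℕ)) * MvPolynomial.X 1 ^ (j : ℕ))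

/-- The multiplicity of the point `P = [a : b]` of `ℙ¹` as a root of `f`: the exponent to which the
linear form `b * x - a * y` divides `f` (it is infinite for `f = 0`). -/
def rootMultiplicity (P : PSpace (Fin 2)) (f : MvPolynomial (Fin 2) ℂ) : ℕ∞ :=
  emultiplicity (MvPolynomial.C (P.rep 1) * MvPolynomial.X 0 -
    MvPolynomial.C (P.rep 0) * MvPolynomial.X 1) f

/-- The polynomials `f i` have at least `m` common roots in `ℙ¹`, counted with multiplicity: there
are `m` points, repetitions allowed, such that each point is a root of every `f i` with at least
the multiplicity with which it is listed. -/
def HasCommonRoots {I : Type} (m : ℕ) (f : I → MvPolynomial (Fin 2) ℂ) : Prop :=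
  ∃ Z : Multiset (PSpace (Fin 2)), Multiset.card Z = m ∧
    ∀ P ∈ Z, ∀ i, ((letI := Classical.decEq (PSpace (Fin 2)); Z.count P : ℕ) : ℕ∞) ≤
      rootMultiplicity P (f i)

/-- The space `M_d(ℙ^r)` of `(r + 1)`-tuples of binary forms of degree `d` modulo homothety; the
coordinate with index `(i, j)` is the coefficient `s i j` of `x ^ (d - j) * y ^ j` in `f i`. -/
abbrev TupleSpace (d r : ℕ) : Type := PSpace (Fin (r + 1) × Fin (d + 1))

/-- The stratum `R_k`: the tuples with at least `d - k + 1` common roots. -/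
def stratum (d r k : ℕ) : Set (TupleSpace d r) :=
  {s | HasCommonRoots (d + 1 - k) fun i => binaryForm fun j => s.rep (i, j)}

/-- The `(r + 1) k × (d + k)` matrix `A`. Its rows come in `k` blocks of `r + 1` rows; row `i` of
block `b` consists of `b` zeros, the coefficients `s i 0, …, s i d`, and again zeros. -/
def sylvesterMatrix {d r : ℕ} (k : ℕ) (s : Fin (r + 1) × Fin (d + 1) → ℂ) :
    Matrix (Fin k × Fin (r + 1)) (Fin (d + k)) ℂ :=
  Matrix.of fun bi c =>
    ∑ j : Fin (d + 1), if (bi.1 : ℕ) + (j : ℕ) = (c : ℕ) then s (bi.2, j) else 0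

/-! ### The multiplication map -/

/-- The coefficients of `(g_0 p, …, g_r p)`, where the `g_i` are binary forms of degree `k - 1`
and `p` is a binary form of degree `d - k + 1`. -/
def mulCoeff {d r k : ℕ} (μ : Fin (r + 1) × Fin k → ℂ) (ν : Fin (d + 2 - k) → ℂ) :
    Fin (r + 1) × Fin (d + 1) → ℂ :=
  fun ij => ∑ a : Fin k, ∑ b : Fin (d + 2 - k),
    if (a : ℕ) + (b : ℕ) = (ij.2 : ℕ) then μ (ij.1, a) * ν b else 0

theorem mulCoeff_ne_zero {d r k : ℕ} {μ : Fin (r + 1) × Fin k → ℂ} {ν : Fin (d + 2 - k) → ℂ}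
    (hμ : μ ≠ 0) (hν : ν ≠ 0) : mulCoeff μ ν ≠ (0 : Fin (r + 1) × Fin (d + 1) → ℂ) := by
  classical
  obtain ⟨⟨i, a₀⟩, ha₀⟩ := Function.ne_iff.1 hμ
  obtain ⟨b₀, hb₀⟩ := Function.ne_iff.1 hν
  have hA : (Finset.univ.filter fun a : Fin k => μ (i, a) ≠ 0).Nonempty :=
    ⟨a₀, by simpa using ha₀⟩
  have hB : (Finset.univ.filter fun b : Fin (d + 2 - k) => ν b ≠ 0).Nonempty :=
    ⟨b₀, by simpa using hb₀⟩
  obtain ⟨a, ha, hamin⟩ := Finset.exists_min_image _ id hA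
  obtain ⟨b, hb, hbmin⟩ := Finset.exists_min_image _ id hB
  simp only [Finset.mem_filter, Finset.mem_univ, true_and, id] at ha hb hamin hbmin
  have hlt : (a : ℕ) + (b : ℕ) < d + 1 := by
    have h1 := a.2
    have h2 := b.2
    omega
  intro h
  have h0 := congrFun h (i, ⟨(a : ℕ) + (b : ℕ), hlt⟩)
  simp only [mulCoeff, Pi.zero_apply] at h0
  rw [Finset.sum_eq_single a, Finset.sum_eq_single b] at h0
  · simp only [if_true] at h0
    exact (mul_ne_zero ha hb) h0
  · intro b' _ hb'
    rw [if_neg]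
    intro he
    exact hb' (Fin.ext (by omega))
  · simp
  · intro a' _ ha'
    refine Finset.sum_eq_zero fun b' _ => ?_
    split_ifs with he
    · by_cases h1 : μ (i, a') = 0
      · rw [h1, zero_mul]
      · by_cases h2 : ν b' = 0
        · rw [h2, mul_zero]
        · have h3 := hamin a' h1
          have h4 := hbmin b' h2
          rw [Fin.le_def] at h3 h4
          exact absurd (Fin.ext (by omega)) ha'
    · rfl
  · simp

/-- The multiplication map `ℙ^((r+1)k-1) × ℙ^(d-k+1) → ℙ^((d+1)(r+1)-1)`,
`(g_0, …, g_r; p) ↦ (g_0 p, …, g_r p)`. -/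
def mulMap (d r k : ℕ) (z : PSpace (Fin (r + 1) × Fin k) × PSpace (Fin (d + 2 - k))) :
    TupleSpace d r :=
  Projectivization.mk ℂ (mulCoeff z.1.rep z.2.rep)
    (mulCoeff_ne_zero z.1.rep_nonzero z.2.rep_nonzero)

end CommonRootStrata

end

/-!
Binary forms are handled through their dehomogenizations at `x = 1`, that is, through univariate
polynomials with a bound on the degree. A tuple of forms is *primitive* (`IsPrimitive`) when the
forms have no common root in `ℙ¹`. A tuple `f` of degree `d` has `d - k + 1` common roots if and
only if `f = g * p` with `g` of degree `k - 1` and `p` of degree `d - k + 1` (`mem_stratum_iff`), and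
such an `f ≠ 0` lies outside `R_{k-1}` if and only if `g` is primitive. Everything rests on one
algebraic fact: a tuple proportional to a primitive tuple `g` is a multiple `s * g`
(`IsPrimitive.exists_eq_mul`).

*Minors.* The rows of `A` are the products of the `f_i` with the monomials of degree `k - 1`. If
`f = g * p`, the row space consists of multiples of `p` and has dimension at most `2 * k - 1`. If
`f ∉ R_k`, then `f = g * p` with `g` primitive of degree at least `k`; two combinations of the
`g_i` are coprime, and their products with monomials give `2 * k` independent vectors
(`stratum_eq_minors`). In particular the `R_k` are closed.

*Isomorphism.* The factors `g` and `p` of `f ∈ R_k \ R_{k-1}` are determined up to scalars: `g`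
spans the tuples of degree `k - 1` proportional to `f`, and `p` spans the forms `q` with `g * q`
proportional to `f`. Both are kernels of matrices with entries polynomial in `f`, so minors of these
matrices give `g` and `p` as regular functions of `f` (`exists_isLocalFormula`).

*Smoothness.* Differentiating the multiplication map and these local formulas shows that the
tangent space at `f = g * p ∉ R_{k-1}` of the cone over `R_k` is `{g' * p + g * p'}`, whose dimension
is `(r + 1) * k + (d + 2 - k) - 1` (`finrank_tangentSpaceAt`). This is also the Krull dimension of
the coordinate ring of `R_k` (`coneDim_stratum`): the ideal of `R_k` is the kernel of the pullback
along the multiplication map, hence prime, and by the local formulas the coordinates of `g` and `p`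
are rational functions on `R_k` once one coefficient of `p` is set to `1`.

*Singularity.* Let `f = h * l₁ * l₂ * q` with `h` primitive of degree `k - 2` and `l₁`, `l₂`
independent linear forms. The two factorizations `(h * l₁) * (l₂ * q)` and `(h * l₂) * (l₁ * q)` both
contribute tangent vectors of `R_k` at `f`, and together they fill `{G * q + h * P}`, whose dimension
exceeds that of the cone by `r`. Each point of `R_{k-1}` is a limit of such `f` along a polynomial
curve, and the dimension of the tangent space is upper semicontinuous, so no point of `R_{k-1}` is
smooth on `R_k` (`le_finrank_tangentSpaceAt`, `not_isSmoothPoint_stratum`).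
-/

noncomputable section

namespace CommonRootStrata

/-! ### Tuples of forms as tuples of univariate polynomials -/

open Polynomial in
/-- The `i`-th form of a tuple of binary forms, dehomogenized at `x = 1`: the coefficient of
`x ^ (n - 1 - j) * y ^ j` becomes the coefficient of `X ^ j`. The form is determined by this
polynomial together with `n`; it is divisible by `x` if and only if the polynomial has degree less
than `n - 1`. -/
def tuplePoly {r n : ℕ} (v : Fin (r + 1) × Fin n → ℂ) (i : Fin (r + 1)) : Polynomial ℂ :=
  ofFn n fun j => v (i, j)

section Univariate

open Polynomial

variable {d r k n : ℕ}

theorem coeff_ofFn (c : Fin n → ℂ) (m : ℕ) :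
    (ofFn n c).coeff m = if h : m < n then c ⟨m, h⟩ else 0 := by
  split_ifs with h
  · exact ofFn_coeff_eq_val_of_lt c h
  · exact ofFn_coeff_eq_zero_of_ge c (not_lt.1 h)

theorem exists_ofFn_eq {p : ℂ[X]} (hp : p.degree < n) : ∃ c : Fin n → ℂ, ofFn n c = p := by
  refine ⟨toFn n p, ?_⟩
  ext m
  rw [coeff_ofFn]
  split_ifs with h
  · simp [toFn]
  · exact (coeff_eq_zero_of_degree_lt (lt_of_lt_of_le hp (by exact_mod_cast not_lt.1 h))).symm

theorem ofFn_eq_zero_iff {c : Fin n → ℂ} : ofFn n c = 0 ↔ c = 0 := by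
  rw [← map_zero (ofFn n), (injective_ofFn n).eq_iff]

theorem tuplePoly_degree_lt (v : Fin (r + 1) × Fin n → ℂ) (i : Fin (r + 1)) :
    (tuplePoly v i).degree < n :=
  ofFn_degree_lt _

theorem tuplePoly_injective {v w : Fin (r + 1) × Fin n → ℂ}
    (h : ∀ i, tuplePoly v i = tuplePoly w i) : v = w := by
  funext ⟨i, j⟩
  exact congrFun (injective_ofFn n (h i)) j

theorem tuplePoly_add (v w : Fin (r + 1) × Fin n → ℂ) (i : Fin (r + 1)) :
    tuplePoly (v + w) i = tuplePoly v i + tuplePoly w i :=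
  map_add (ofFn n) (fun j => v (i, j)) (fun j => w (i, j))

theorem tuplePoly_smul (a : ℂ) (v : Fin (r + 1) × Fin n → ℂ) (i : Fin (r + 1)) :
    tuplePoly (a • v) i = C a * tuplePoly v i := by
  rw [← smul_eq_C_mul]
  exact map_smul (ofFn n) a (fun j => v (i, j))

theorem exists_tuplePoly_ne_zero {v : Fin (r + 1) × Fin n → ℂ} (hv : v ≠ 0) :
    ∃ i, tuplePoly v i ≠ 0 := by
  by_contra! h
  exact hv (tuplePoly_injective fun i => by rw [h i]; exact (map_zero (ofFn n)).symm)

theorem exists_tuplePoly_eq {G : Fin (r + 1) → ℂ[X]} (hG : ∀ i, (G i).degree < n) :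
    ∃ v : Fin (r + 1) × Fin n → ℂ, ∀ i, tuplePoly v i = G i := by
  choose c hc using fun i => exists_ofFn_eq (hG i)
  exact ⟨fun ij => c ij.1 ij.2, hc⟩

theorem tuplePoly_mulCoeff (hk : k ≤ d + 2) (μ : Fin (r + 1) × Fin k → ℂ)
    (ν : Fin (d + 2 - k) → ℂ) (i : Fin (r + 1)) :
    tuplePoly (mulCoeff (d := d) μ ν) i = tuplePoly μ i * ofFn _ ν := by
  simp only [tuplePoly, ofFn_eq_sum_monomial, mulCoeff, map_sum, Finset.sum_mul_sum,
    monomial_mul_monomial]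
  rw [Finset.sum_comm]
  refine Finset.sum_congr rfl fun a _ => ?_
  rw [Finset.sum_comm]
  refine Finset.sum_congr rfl fun b _ => ?_
  rw [Finset.sum_eq_single ⟨(a : ℕ) + b, by omega⟩]
  · simp
  · intro j _ hj
    rw [if_neg, map_zero]
    intro h
    exact hj (Fin.ext h.symm)
  · simp

/-- The affine cone over `R_k`, parametrized: the tuples `(g_0 p, …, g_r p)` with `g_i` of degree
`k - 1` and `p` of degree `d - k + 1`. -/
def productCone (d r k : ℕ) : Set (Fin (r + 1) × Fin (d + 1) → ℂ) :=
  {v | ∃ (μ : Fin (r + 1) × Fin k → ℂ) (ν : Fin (d + 2 - k) → ℂ), v = mulCoeff μ ν}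

theorem mem_productCone_iff (hk : k ≤ d + 2) {v : Fin (r + 1) × Fin (d + 1) → ℂ} :
    v ∈ productCone d r k ↔ ∃ (G : Fin (r + 1) → ℂ[X]) (p : ℂ[X]),
      (∀ i, (G i).degree < k) ∧ p.degree < (d + 2 - k : ℕ) ∧ ∀ i, tuplePoly v i = G i * p := by
  constructor
  · rintro ⟨μ, ν, rfl⟩
    exact ⟨tuplePoly μ, ofFn _ ν, tuplePoly_degree_lt μ, ofFn_degree_lt ν,
      tuplePoly_mulCoeff hk μ ν⟩
  · rintro ⟨G, p, hG, hp, h⟩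
    obtain ⟨μ, hμ⟩ := exists_tuplePoly_eq hG
    obtain ⟨ν, hν⟩ := exists_ofFn_eq hp
    refine ⟨μ, ν, tuplePoly_injective fun i => ?_⟩
    rw [h, tuplePoly_mulCoeff hk, hμ, hν]

theorem mulCoeff_smul_left (a : ℂ) (μ : Fin (r + 1) × Fin k → ℂ) (ν : Fin (d + 2 - k) → ℂ) :
    mulCoeff (d := d) (a • μ) ν = a • mulCoeff μ ν := by
  funext ij
  simp only [mulCoeff, Pi.smul_apply, smul_eq_mul, Finset.mul_sum]
  refine Finset.sum_congr rfl fun _ _ => Finset.sum_congr rfl fun _ _ => ?_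
  split_ifs <;> ring

theorem mulCoeff_smul_right (a : ℂ) (μ : Fin (r + 1) × Fin k → ℂ) (ν : Fin (d + 2 - k) → ℂ) :
    mulCoeff (d := d) μ (a • ν) = a • mulCoeff μ ν := by
  funext ij
  simp only [mulCoeff, Pi.smul_apply, smul_eq_mul, Finset.mul_sum]
  refine Finset.sum_congr rfl fun _ _ => Finset.sum_congr rfl fun _ _ => ?_
  split_ifs <;> ring

theorem mulCoeff_add_left (μ μ' : Fin (r + 1) × Fin k → ℂ) (ν : Fin (d + 2 - k) → ℂ) :
    mulCoeff (d := d) (μ + μ') ν = mulCoeff μ ν + mulCoeff μ' ν := by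
  funext ij
  simp only [mulCoeff, Pi.add_apply, ← Finset.sum_add_distrib]
  refine Finset.sum_congr rfl fun _ _ => Finset.sum_congr rfl fun _ _ => ?_
  split_ifs <;> ring

theorem mulCoeff_add_right (μ : Fin (r + 1) × Fin k → ℂ) (ν ν' : Fin (d + 2 - k) → ℂ) :
    mulCoeff (d := d) μ (ν + ν') = mulCoeff μ ν + mulCoeff μ ν' := by
  funext ij
  simp only [mulCoeff, Pi.add_apply, ← Finset.sum_add_distrib]
  refine Finset.sum_congr rfl fun _ _ => Finset.sum_congr rfl fun _ _ => ?_
  split_ifs <;> ring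

theorem productCone_smul {v : Fin (r + 1) × Fin (d + 1) → ℂ} (hv : v ∈ productCone d r k) (a : ℂ) :
    a • v ∈ productCone d r k := by
  obtain ⟨μ, ν, rfl⟩ := hv
  exact ⟨a • μ, ν, (mulCoeff_smul_left a μ ν).symm⟩

/-- The forms of the tuple have no common root in `ℙ¹`: no common root in the chart `x ≠ 0`, and
`x` is not a common factor. -/
structure IsPrimitive (μ : Fin (r + 1) × Fin n → ℂ) : Prop where
  isUnit_of_dvd : ∀ q : ℂ[X], (∀ i, q ∣ tuplePoly μ i) → IsUnit q
  exists_coeff_ne_zero : ∃ i, (tuplePoly μ i).coeff (n - 1) ≠ 0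

theorem IsPrimitive.ne_zero {μ : Fin (r + 1) × Fin n → ℂ} (h : IsPrimitive μ) : μ ≠ 0 := by
  rintro rfl
  obtain ⟨i, hi⟩ := h.exists_coeff_ne_zero
  refine hi ?_
  have : tuplePoly (0 : Fin (r + 1) × Fin n → ℂ) i = 0 := map_zero (ofFn n)
  rw [this, coeff_zero]

theorem IsPrimitive.pos {μ : Fin (r + 1) × Fin n → ℂ} (h : IsPrimitive μ) : 0 < n := by
  rcases Nat.eq_zero_or_pos n with rfl | hn
  · exact absurd (Subsingleton.elim μ 0) h.ne_zero
  · exact hn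

/-- Since `ℂ[X]` is a principal ideal domain, the `h i` generate the unit ideal, and a Bézout
relation for the `h i` gives the factor `s`. -/
theorem exists_eq_mul_of_cross_mul {I : Type*} [Fintype I] {h G : I → ℂ[X]}
    (hu : ∀ q, (∀ i, q ∣ h i) → IsUnit q) (hw : ∀ i j, G i * h j = G j * h i) :
    ∃ s, ∀ i, G i = s * h i := by
  obtain ⟨q, hq⟩ := (IsPrincipalIdealRing.principal (Ideal.span (Set.range h))).principal
  have hq1 : IsUnit q := hu q fun i => by
    rw [← Ideal.mem_span_singleton]
    have : h i ∈ Ideal.span (Set.range h) := Ideal.subset_span ⟨i, rfl⟩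
    rwa [hq] at this
  have h1 : (1 : ℂ[X]) ∈ Ideal.span (Set.range h) := by
    rw [hq]
    exact Ideal.mem_span_singleton.2 hq1.dvd
  obtain ⟨a, ha⟩ := Ideal.mem_span_range_iff_exists_fun.1 h1
  refine ⟨∑ i, a i * G i, fun j => ?_⟩
  calc G j = G j * ∑ i, a i * h i := by rw [ha, mul_one]
    _ = ∑ i, a i * G i * h j := by
      rw [Finset.mul_sum]
      refine Finset.sum_congr rfl fun i _ => ?_
      rw [mul_assoc, hw i j]
      ring
    _ = _ := by rw [Finset.sum_mul]

theorem IsPrimitive.exists_degree_eq {μ : Fin (r + 1) × Fin n → ℂ} (h : IsPrimitive μ) :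
    ∃ i, (tuplePoly μ i).degree = (n - 1 : ℕ) := by
  obtain ⟨i, hi⟩ := h.exists_coeff_ne_zero
  refine ⟨i, le_antisymm ?_ (le_degree_of_ne_zero hi)⟩
  have h1 := tuplePoly_degree_lt μ i
  have h2 := h.pos
  have h0 : tuplePoly μ i ≠ 0 := by
    intro h0
    simp [h0] at hi
  rw [degree_eq_natDegree h0] at h1 ⊢
  norm_cast at h1 ⊢
  omega

/-- A tuple proportional to a primitive tuple of forms is a multiple of it by a form of the
complementary degree. -/
theorem IsPrimitive.exists_eq_mul {μ : Fin (r + 1) × Fin n → ℂ} (h : IsPrimitive μ) {m : ℕ}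
    {G : Fin (r + 1) → ℂ[X]} (hG : ∀ i, (G i).degree < (n + m : ℕ))
    (hw : ∀ i j, G i * tuplePoly μ j = G j * tuplePoly μ i) :
    ∃ s : ℂ[X], s.degree < (m + 1 : ℕ) ∧ ∀ i, G i = s * tuplePoly μ i := by
  obtain ⟨s, hs⟩ := exists_eq_mul_of_cross_mul h.isUnit_of_dvd hw
  refine ⟨s, ?_, hs⟩
  obtain ⟨i, hi⟩ := h.exists_degree_eq
  have h1 := hG i
  have h2 := h.pos
  rw [hs i, degree_mul, hi] at h1
  rcases eq_or_ne s 0 with rfl | hs0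
  · rw [degree_zero]
    exact WithBot.bot_lt_coe _
  · rw [degree_eq_natDegree hs0] at h1 ⊢
    norm_cast at h1 ⊢
    omega

theorem IsPrimitive.exists_smul {μ : Fin (r + 1) × Fin n → ℂ} (h : IsPrimitive μ)
    {w : Fin (r + 1) × Fin n → ℂ}
    (hw : ∀ i j, tuplePoly w i * tuplePoly μ j = tuplePoly w j * tuplePoly μ i) :
    ∃ a : ℂ, w = a • μ := by
  obtain ⟨s, hs, hws⟩ := h.exists_eq_mul (m := 0) (tuplePoly_degree_lt w) hw
  have hs0 : s.degree ≤ 0 := by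
    rcases eq_or_ne s 0 with rfl | hs0
    · simp
    · rw [degree_eq_natDegree hs0] at hs ⊢
      norm_cast at hs ⊢
      omega
  refine ⟨s.coeff 0, tuplePoly_injective fun i => ?_⟩
  rw [tuplePoly_smul, hws, ← eq_C_of_degree_le_zero hs0]

/-- A tuple that is not primitive has a common root, either in the chart `x ≠ 0` or at `[0 : 1]`. In
the latter case all degrees drop. -/
theorem exists_linear_factor {μ : Fin (r + 1) × Fin n → ℂ} (hn : 1 ≤ n) (h : ¬ IsPrimitive μ) :
    (∃ τ : ℂ, ∀ i, (X - C τ) ∣ tuplePoly μ i) ∨ ∀ i, (tuplePoly μ i).degree < (n - 1 : ℕ) := by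
  by_cases h1 : ∃ i, (tuplePoly μ i).coeff (n - 1) ≠ 0
  · left
    have h2 : ¬ ∀ q : ℂ[X], (∀ i, q ∣ tuplePoly μ i) → IsUnit q := fun h2 => h ⟨h2, h1⟩
    push Not at h2
    obtain ⟨q, hq, hqu⟩ := h2
    have hq0 : q.degree ≠ 0 := fun h0 => hqu (isUnit_iff_degree_eq_zero.2 h0)
    obtain ⟨τ, hτ⟩ := IsAlgClosed.exists_root q hq0
    exact ⟨τ, fun i => (dvd_iff_isRoot.2 hτ).trans (hq i)⟩
  · right
    push Not at h1
    intro i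
    rw [degree_lt_iff_coeff_zero]
    intro m hm
    rcases hm.eq_or_lt with rfl | hm
    · exact h1 i
    · exact coeff_eq_zero_of_degree_lt ((tuplePoly_degree_lt μ i).trans_le
        (by exact_mod_cast (by omega : n ≤ m)))

/-- A common linear factor of `g` could be moved to the other factor of `g * p`. -/
theorem isPrimitive_of_notMem {μ : Fin (r + 1) × Fin k → ℂ} {ν : Fin (d + 2 - k) → ℂ}
    (hk : 1 ≤ k) (hkd : k ≤ d + 1) (h : mulCoeff μ ν ∉ productCone d r (k - 1)) :
    IsPrimitive μ := by
  by_contra hμ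
  refine h ((mem_productCone_iff (by omega)).2 ?_)
  rcases exists_linear_factor hk hμ with ⟨τ, hτ⟩ | hdeg
  · choose H hH using hτ
    refine ⟨H, (X - C τ) * ofFn _ ν, fun i => ?_, ?_, fun i => ?_⟩
    · have h1 := tuplePoly_degree_lt μ i
      rw [hH, degree_mul, degree_X_sub_C] at h1
      rcases eq_or_ne (H i) 0 with h0 | h0
      · rw [h0, degree_zero]
        exact WithBot.bot_lt_coe _
      · rw [degree_eq_natDegree h0] at h1 ⊢
        norm_cast at h1 ⊢
        omega
    · have h1 := ofFn_degree_lt ν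
      rw [degree_mul, degree_X_sub_C]
      rcases eq_or_ne (ofFn _ ν) 0 with h0 | h0
      · rw [h0, degree_zero, WithBot.add_bot]
        exact WithBot.bot_lt_coe _
      · rw [degree_eq_natDegree h0] at h1 ⊢
        norm_cast at h1 ⊢
        omega
    · rw [tuplePoly_mulCoeff (by omega), hH]
      ring
  · exact ⟨tuplePoly μ, ofFn _ ν, hdeg,
      (ofFn_degree_lt ν).trans_le (by exact_mod_cast (by omega)),
      tuplePoly_mulCoeff (by omega) μ ν⟩

theorem notMem_productCone_of_isPrimitive {μ : Fin (r + 1) × Fin k → ℂ} {ν : Fin (d + 2 - k) → ℂ}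
    (hkd : k ≤ d + 1) (hμ : IsPrimitive μ) (hν : ν ≠ 0) {m : ℕ} (hm : m < k) :
    mulCoeff μ ν ∉ productCone d r m := by
  intro h
  obtain ⟨G, p, hG, -, hp⟩ := (mem_productCone_iff (by omega)).1 h
  have hp' : ∀ i, tuplePoly μ i * ofFn _ ν = G i * p := fun i => by
    rw [← hp, tuplePoly_mulCoeff (by omega)]
  have hν' : ofFn _ ν ≠ 0 := fun h0 => hν (ofFn_eq_zero_iff.1 h0)
  obtain ⟨i₀, hi₀⟩ := exists_tuplePoly_ne_zero hμ.ne_zero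
  have hp0 : p ≠ 0 := by
    rintro rfl
    have := hp' i₀
    rw [mul_zero] at this
    exact (mul_ne_zero hi₀ hν') this
  obtain ⟨s, hs⟩ := exists_eq_mul_of_cross_mul (G := G) hμ.isUnit_of_dvd fun i j => by
    apply mul_right_cancel₀ (mul_ne_zero hp0 hν')
    linear_combination G i * p * hp' j - G j * p * hp' i
  obtain ⟨j, hj⟩ := hμ.exists_degree_eq
  have h1 := hG j
  rw [hs j, degree_mul, hj] at h1
  have hs0 : s ≠ 0 := by
    rintro rfl
    have := hp' i₀
    rw [hs, zero_mul, zero_mul] at this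
    exact (mul_ne_zero hi₀ hν') this
  rw [degree_eq_natDegree hs0] at h1
  norm_cast at h1
  omega

end Univariate

/-! ### Common roots and common factors -/

section CommonRoots

open MvPolynomial

/-- The substitution `x = 1`, `y = X`. -/
def dehomogenize : MvPolynomial (Fin 2) ℂ →ₐ[ℂ] Polynomial ℂ :=
  aeval ![1, Polynomial.X]

/-- The linear form that vanishes at the point `P` of `ℙ¹`. -/
def linearForm (P : PSpace (Fin 2)) : MvPolynomial (Fin 2) ℂ :=
  C (P.rep 1) * X 0 - C (P.rep 0) * X 1

theorem dehomogenize_linearForm (P : PSpace (Fin 2)) :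
    dehomogenize (linearForm P) =
      Polynomial.C (P.rep 1) - Polynomial.C (P.rep 0) * Polynomial.X := by
  simp [dehomogenize, linearForm, Polynomial.C_eq_algebraMap]

theorem linearForm_isHomogeneous (P : PSpace (Fin 2)) : (linearForm P).IsHomogeneous 1 :=
  (isHomogeneous_C_mul_X _ _).sub (isHomogeneous_C_mul_X _ _)

theorem linearForm_ne_zero (P : PSpace (Fin 2)) : linearForm P ≠ 0 := by
  intro h
  have h1 := congrArg dehomogenize h
  rw [dehomogenize_linearForm, map_zero] at h1
  refine P.rep_nonzero (funext fun i => ?_)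
  have h2 := congrArg (fun p => p.coeff 0) h1
  have h3 := congrArg (fun p => p.coeff 1) h1
  fin_cases i
  · simpa [Polynomial.coeff_C] using h3
  · simpa using h2

theorem dehomogenize_binaryForm {e : ℕ} (c : Fin (e + 1) → ℂ) :
    dehomogenize (binaryForm c) = Polynomial.ofFn (e + 1) c := by
  simp only [dehomogenize, binaryForm, Polynomial.ofFn_eq_sum_monomial, map_sum, map_mul, map_pow,
    aeval_X, aeval_C, Matrix.cons_val_zero, Matrix.cons_val_one, one_pow, one_mul]
  refine Finset.sum_congr rfl fun j _ => ?_
  rw [← Polynomial.C_mul_X_pow_eq_monomial]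
  rfl

theorem binaryForm_isHomogeneous {e : ℕ} (c : Fin (e + 1) → ℂ) :
    (binaryForm c).IsHomogeneous e := by
  refine IsHomogeneous.sum _ _ _ fun j _ => IsHomogeneous.C_mul ?_ _
  have := (isHomogeneous_X_pow (R := ℂ) (0 : Fin 2) (e - j)).mul
    (isHomogeneous_X_pow (R := ℂ) (1 : Fin 2) j)
  rwa [Nat.sub_add_cancel (Nat.lt_succ_iff.1 j.2)] at this

theorem dehomogenize_injOn {n : ℕ} {f g : MvPolynomial (Fin 2) ℂ} (hf : f.IsHomogeneous n)
    (hg : g.IsHomogeneous n) (h : dehomogenize f = dehomogenize g) : f = g := by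
  have key : ∀ q : MvPolynomial (Fin 2) ℂ,
      aeval ![Polynomial.X, 1] (rename (Equiv.swap 0 1) q) = dehomogenize q := by
    intro q
    rw [aeval_rename, dehomogenize]
    congr 2
    ext i
    fin_cases i <;> simp
  apply rename_injective _ (Equiv.swap (0 : Fin 2) 1).injective
  rw [← Polynomial.homogenize_eq_of_isHomogeneous hf.rename_isHomogeneous (key f),
    ← Polynomial.homogenize_eq_of_isHomogeneous hg.rename_isHomogeneous (key g), h]

theorem natDegree_dehomogenize_le (f : MvPolynomial (Fin 2) ℂ) :
    (dehomogenize f).natDegree ≤ f.totalDegree := by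
  have := aeval_natDegree_le (n := 1) f le_rfl ![1, Polynomial.X] (fun i => by
    fin_cases i <;> simp)
  simpa [dehomogenize] using this

theorem prod_linearForm_isHomogeneous (Z : Multiset (PSpace (Fin 2))) :
    (Z.map linearForm).prod.IsHomogeneous (Multiset.card Z) := by
  induction Z using Multiset.induction_on with
  | empty => simpa using isHomogeneous_one (Fin 2) ℂ
  | cons P Z ih =>
    rw [Multiset.map_cons, Multiset.prod_cons, Multiset.card_cons, add_comm]
    exact (linearForm_isHomogeneous P).mul ih

theorem prod_linearForm_ne_zero (Z : Multiset (PSpace (Fin 2))) :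
    (Z.map linearForm).prod ≠ 0 := by
  rw [Ne, Multiset.prod_eq_zero_iff, Multiset.mem_map]
  rintro ⟨P, -, hP⟩
  exact linearForm_ne_zero P hP

/-- A common divisor of two different linear forms divides both `x` and `y`. -/
theorem isRelPrime_linearForm {P Q : PSpace (Fin 2)} (h : P ≠ Q) :
    IsRelPrime (linearForm P) (linearForm Q) := by
  set D : ℂ := P.rep 0 * Q.rep 1 - P.rep 1 * Q.rep 0 with hD
  have hD0 : D ≠ 0 := by
    intro h0
    apply h
    rw [← P.mk_rep, ← Q.mk_rep, Projectivization.mk_eq_mk_iff']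
    rcases eq_or_ne (Q.rep 0) 0 with hq | hq
    · have hq1 : Q.rep 1 ≠ 0 := fun hq1 =>
        Q.rep_nonzero (funext fun i => by fin_cases i <;> assumption)
      refine ⟨P.rep 1 / Q.rep 1, funext fun i => ?_⟩
      have hp : P.rep 0 = 0 := by
        rw [hD, hq, mul_zero, sub_zero] at h0
        exact (mul_eq_zero.1 h0).resolve_right hq1
      fin_cases i
      · simp [hq, hp]
      · simp [hq1]
    · refine ⟨P.rep 0 / Q.rep 0, funext fun i => ?_⟩
      fin_cases i
      · simp [hq]
      · simp only [Pi.smul_apply, smul_eq_mul, Fin.mk_one]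
        rw [div_mul_eq_mul_div, div_eq_iff hq]
        linear_combination h0
  have hX : ∀ u : MvPolynomial (Fin 2) ℂ, u ∣ linearForm P → u ∣ linearForm Q →
      u ∣ X 0 ∧ u ∣ X 1 := by
    intro u hP hQ
    have hu : IsUnit (C D : MvPolynomial (Fin 2) ℂ) := hD0.isUnit.map C
    constructor
    · rw [← hu.dvd_mul_left]
      have := (hQ.mul_left (C (P.rep 0))).sub (hP.mul_left (C (Q.rep 0)))
      convert this using 1
      simp only [linearForm, hD, map_sub, map_mul]
      ring
    · rw [← hu.dvd_mul_left]
      have := (hQ.mul_left (C (P.rep 1))).sub (hP.mul_left (C (Q.rep 1)))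
      convert this using 1
      simp only [linearForm, hD, map_sub, map_mul]
      ring
  intro u hP hQ
  obtain ⟨h0, h1⟩ := hX u hP hQ
  have hp : Prime (X 0 : MvPolynomial (Fin 2) ℂ) := X_prime
  have hrel : IsRelPrime (X 0 : MvPolynomial (Fin 2) ℂ) (X 1) := by
    rw [hp.irreducible.isRelPrime_iff_not_dvd, X_dvd_X]
    decide
  exact hrel h0 h1

theorem prod_linearForm_dvd {Z : Multiset (PSpace (Fin 2))} {f : MvPolynomial (Fin 2) ℂ}
    (h : ∀ P ∈ Z, ((letI := Classical.decEq (PSpace (Fin 2)); Z.count P : ℕ) : ℕ∞) ≤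
      rootMultiplicity P f) : (Z.map linearForm).prod ∣ f := by
  let := Classical.decEq (PSpace (Fin 2))
  rw [Finset.prod_multiset_map_count]
  refine Finset.prod_dvd_of_isRelPrime (fun P _ Q _ hPQ => ?_) fun P hP => ?_
  · exact (isRelPrime_linearForm hPQ).pow
  · exact pow_dvd_iff_le_emultiplicity.2 (h P (Multiset.mem_toFinset.1 hP))

theorem count_le_rootMultiplicity {Z : Multiset (PSpace (Fin 2))} {f : MvPolynomial (Fin 2) ℂ}
    (h : (Z.map linearForm).prod ∣ f) (P : PSpace (Fin 2)) :
    ((letI := Classical.decEq (PSpace (Fin 2)); Z.count P : ℕ) : ℕ∞) ≤ rootMultiplicity P f := by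
  let := Classical.decEq (PSpace (Fin 2))
  refine pow_dvd_iff_le_emultiplicity.1 (dvd_trans ?_ h)
  have := Multiset.prod_dvd_prod_of_le
    (Multiset.map_le_map (f := linearForm)
      (Multiset.le_count_iff_replicate_le.1 (le_refl (Z.count P))))
  rwa [Multiset.map_replicate, Multiset.prod_replicate] at this

/-- A nonzero binary form of degree `n` is a product of `n` linear forms. -/
theorem exists_prod_linearForm (n : ℕ) : ∀ p : Polynomial ℂ, p ≠ 0 → p.natDegree ≤ n →
    ∃ (Z : Multiset (PSpace (Fin 2))) (c : ℂ), Multiset.card Z = n ∧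
      Polynomial.C c * dehomogenize (Z.map linearForm).prod = p := by
  induction n with
  | zero =>
    intro p _ hp
    refine ⟨0, p.coeff 0, rfl, ?_⟩
    rw [Multiset.map_zero, Multiset.prod_zero, map_one, mul_one]
    exact (Polynomial.eq_C_of_natDegree_le_zero hp).symm
  | succ n ih =>
    intro p hp0 hp
    rcases Nat.lt_or_ge n p.natDegree with hlt | hle
    · obtain ⟨τ, hτ⟩ := IsAlgClosed.exists_root p (fun h0 => by
        have := Polynomial.natDegree_eq_zero_iff_degree_le_zero.2 h0.le
        omega)
      obtain ⟨q, rfl⟩ := Polynomial.dvd_iff_isRoot.2 hτ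
      have hq0 : q ≠ 0 := right_ne_zero_of_mul hp0
      obtain ⟨Z, c, hZ, hc⟩ := ih q hq0 (by
        rw [Polynomial.natDegree_mul (Polynomial.X_sub_C_ne_zero τ) hq0,
          Polynomial.natDegree_X_sub_C] at hp
        omega)
      have hv : (![1, τ] : Fin 2 → ℂ) ≠ 0 := fun h => one_ne_zero (congrFun h 0)
      obtain ⟨a, ha⟩ := Projectivization.exists_smul_eq_mk_rep ℂ _ hv
      refine ⟨Projectivization.mk ℂ _ hv ::ₘ Z, -c * (a⁻¹ : ℂˣ), by simp [hZ], ?_⟩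
      rw [Multiset.map_cons, Multiset.prod_cons, map_mul, map_mul, dehomogenize_linearForm,
        ← ha, ← hc]
      have h1 : Polynomial.C ((a⁻¹ : ℂˣ) : ℂ) * Polynomial.C ((a : ℂˣ) : ℂ) = 1 := by
        rw [← map_mul, Units.inv_mul, map_one]
      simp only [Units.smul_def, Pi.smul_apply, smul_eq_mul, Matrix.cons_val_zero,
        Matrix.cons_val_one, mul_one, map_mul, map_neg]
      linear_combination (Polynomial.X - Polynomial.C τ) * Polynomial.C c *
        dehomogenize (Z.map linearForm).prod * h1
    · obtain ⟨Z, c, hZ, hc⟩ := ih p hp0 hle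
      have hv : (![0, 1] : Fin 2 → ℂ) ≠ 0 := fun h => one_ne_zero (congrFun h 1)
      obtain ⟨a, ha⟩ := Projectivization.exists_smul_eq_mk_rep ℂ _ hv
      refine ⟨Projectivization.mk ℂ _ hv ::ₘ Z, c * (a⁻¹ : ℂˣ), by simp [hZ], ?_⟩
      rw [Multiset.map_cons, Multiset.prod_cons, map_mul, map_mul, dehomogenize_linearForm,
        ← ha, ← hc]
      have h1 : Polynomial.C ((a⁻¹ : ℂˣ) : ℂ) * Polynomial.C ((a : ℂˣ) : ℂ) = 1 := by
        rw [← map_mul, Units.inv_mul, map_one]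
      simp only [Units.smul_def, Pi.smul_apply, smul_eq_mul, Matrix.cons_val_zero,
        Matrix.cons_val_one, mul_one, mul_zero, map_zero, zero_mul, sub_zero]
      linear_combination Polynomial.C c * dehomogenize (Z.map linearForm).prod * h1

/-- A tuple of binary forms of degree `d` has `d - k + 1` common roots if and only if it is a
common multiple of a form of degree `d - k + 1`. -/
theorem mem_stratum_iff {d r k : ℕ} (hk : k ≤ d + 1) (s : TupleSpace d r) :
    s ∈ stratum d r k ↔ s.rep ∈ productCone d r k := by
  rw [mem_productCone_iff (by omega)]
  constructor
  · rintro ⟨Z, hZ, h⟩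
    have hdvd : ∀ i, (Z.map linearForm).prod ∣ binaryForm fun j => s.rep (i, j) :=
      fun i => prod_linearForm_dvd fun P hP => h P hP i
    set D := (Z.map linearForm).prod with hD
    have hD0 : D ≠ 0 := prod_linearForm_ne_zero Z
    have hDdeg : D.totalDegree = d + 1 - k := by
      rw [(prod_linearForm_isHomogeneous Z).totalDegree hD0, hZ]
    choose Q hQ using hdvd
    have hpoly : ∀ i, tuplePoly s.rep i = dehomogenize (Q i) * dehomogenize D := fun i => by
      rw [mul_comm, ← map_mul, ← hQ, dehomogenize_binaryForm]
      rfl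
    refine ⟨fun i => dehomogenize (Q i), dehomogenize D, fun i => ?_, ?_, hpoly⟩
    · beta_reduce
      rcases eq_or_ne (Q i) 0 with h0 | h0
      · rw [h0, map_zero, Polynomial.degree_zero]
        exact WithBot.bot_lt_coe _
      · have h1 : (D * Q i).totalDegree = d := by
          rw [← hQ i]
          refine (binaryForm_isHomogeneous _).totalDegree ?_
          rw [hQ i]
          exact mul_ne_zero hD0 h0
        rw [totalDegree_mul_of_isDomain hD0 h0, hDdeg] at h1
        have h2 := natDegree_dehomogenize_le (Q i)
        exact Polynomial.degree_le_natDegree.trans_lt (by exact_mod_cast (by omega))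
    · have h2 := natDegree_dehomogenize_le D
      exact Polynomial.degree_le_natDegree.trans_lt (by exact_mod_cast (by omega))
  · rintro ⟨G, p, hG, hp, h⟩
    have hp0 : p ≠ 0 := by
      rintro rfl
      obtain ⟨i, hi⟩ := exists_tuplePoly_ne_zero s.rep_nonzero
      exact hi (by rw [h, mul_zero])
    obtain ⟨Z, c, hZ, hc⟩ := exists_prod_linearForm (d + 1 - k) p hp0 (by
      rw [Polynomial.degree_eq_natDegree hp0] at hp
      norm_cast at hp
      omega)
    refine ⟨Z, hZ, fun P _ i => count_le_rootMultiplicity ?_ P⟩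
    rcases Nat.eq_zero_or_pos k with rfl | hk1
    · have hG0 : G i = 0 := by
        by_contra h0
        have := hG i
        rw [Polynomial.degree_eq_natDegree h0] at this
        norm_cast at this
      have : binaryForm (fun j => s.rep (i, j)) = 0 := by
        refine dehomogenize_injOn (binaryForm_isHomogeneous _) (isHomogeneous_zero _ _ d) ?_
        rw [dehomogenize_binaryForm, map_zero]
        exact (h i).trans (by rw [hG0, zero_mul])
      beta_reduce
      rw [this]
      exact dvd_zero _
    · obtain ⟨e, rfl⟩ := Nat.exists_eq_add_of_le' hk1
      obtain ⟨g, hg⟩ := exists_ofFn_eq (hG i)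
      refine ⟨C c * binaryForm g, ?_⟩
      refine dehomogenize_injOn (n := d) (binaryForm_isHomogeneous _) ?_ ?_
      · have := (prod_linearForm_isHomogeneous Z).mul ((binaryForm_isHomogeneous g).C_mul c)
        rwa [hZ, show d + 1 - (e + 1) + e = d by omega] at this
      · rw [dehomogenize_binaryForm]
        refine (h i).trans ?_
        rw [map_mul, map_mul, dehomogenize_binaryForm, hg, ← hc]
        have : dehomogenize (C c) = Polynomial.C c := by
          simp [dehomogenize, Polynomial.C_eq_algebraMap]
        rw [this]
        ring

end CommonRoots

/-! ### The minors of the matrix `A` -/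

section Minors

open Polynomial

variable {d r k : ℕ}

theorem exists_submatrix_det_ne_zero {m n : Type} [Fintype m] [Fintype n] {N : ℕ}
    (M : Matrix m n ℂ) (hN : N ≤ M.rank) :
    ∃ (e : Fin N ↪ m) (c : Fin N ↪ n), (M.submatrix e c).det ≠ 0 := by
  have rows : ∀ {m n : Type} [Fintype m] [Fintype n] (M : Matrix m n ℂ), N ≤ M.rank →
      ∃ e : Fin N ↪ m, LinearIndependent ℂ (M.submatrix e id).row := by
    intro m n _ _ M hN
    rw [Matrix.rank_eq_finrank_span_row] at hN
    obtain ⟨f, hf, -, hli⟩ := Submodule.exists_fun_fin_finrank_span_eq ℂ (Set.range M.row)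
    choose e he using hf
    have hli' : LinearIndependent ℂ fun i : Fin N => M.row (e (Fin.castLE hN i)) := by
      simp only [he]
      exact hli.comp _ (Fin.castLE_injective hN)
    exact ⟨⟨fun i => e (Fin.castLE hN i), fun i j hij =>
      hli'.injective (congrArg M.row hij)⟩, hli'⟩
  obtain ⟨e, he⟩ := rows M hN
  have h1 := he.rank_matrix
  rw [← Matrix.rank_transpose, Fintype.card_fin] at h1
  obtain ⟨c, hc⟩ := rows _ h1.ge
  refine ⟨e, c, ?_⟩
  have h2 := (Matrix.isUnit_iff_isUnit_det _).1 (Matrix.linearIndependent_rows_iff_isUnit.1 hc)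
  rw [← Matrix.det_transpose]
  exact h2.ne_zero

/-- Row `i` of block `b` of the matrix `A` consists of the coefficients of `x ^ (k - 1 - b) y ^ b`
times the `i`-th form. -/
theorem ofFn_sylvesterMatrix (v : Fin (r + 1) × Fin (d + 1) → ℂ) (bi : Fin k × Fin (r + 1)) :
    ofFn (d + k) (sylvesterMatrix k v bi) = X ^ (bi.1 : ℕ) * tuplePoly v bi.2 := by
  simp only [tuplePoly, ofFn_eq_sum_monomial, sylvesterMatrix, Matrix.of_apply, map_sum,
    Finset.mul_sum, X_pow_mul_monomial]
  rw [Finset.sum_comm]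
  refine Finset.sum_congr rfl fun j _ => ?_
  rw [Finset.sum_eq_single ⟨(bi.1 : ℕ) + j, by omega⟩]
  · simp [add_comm]
  · intro c _ hc
    rw [if_neg, map_zero]
    intro h
    exact hc (Fin.ext h.symm)
  · simp

theorem ofFn_vecMul_sylvesterMatrix (v : Fin (r + 1) × Fin (d + 1) → ℂ)
    (w : Fin k × Fin (r + 1) → ℂ) :
    ofFn (d + k) (Matrix.vecMul w (sylvesterMatrix k v)) =
      ∑ bi, C (w bi) * (X ^ (bi.1 : ℕ) * tuplePoly v bi.2) := by
  rw [Matrix.vecMul_eq_sum, map_sum]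
  refine Finset.sum_congr rfl fun bi _ => ?_
  rw [map_smul, smul_eq_C_mul, ofFn_sylvesterMatrix]

/-- If the forms are multiples of `p`, of degree `d - k + 1`, then the row space of `A` consists of
multiples `p * h` with `h` of degree `2 * k - 2`, so `A` has rank less than `2 * k`. -/
theorem det_submatrix_sylvesterMatrix_eq_zero (hk : 1 ≤ k) (hkd : k ≤ d + 1)
    {v : Fin (r + 1) × Fin (d + 1) → ℂ} (hv : v ∈ productCone d r k)
    (e : Fin (2 * k) ↪ Fin k × Fin (r + 1)) (c : Fin (2 * k) ↪ Fin (d + k)) :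
    ((sylvesterMatrix k v).submatrix e c).det = 0 := by
  obtain ⟨G, p, hG, -, hp⟩ := (mem_productCone_iff (by omega)).1 hv
  set h : Fin (2 * k) → ℂ[X] := fun j => X ^ ((e j).1 : ℕ) * G (e j).2 with hh
  have hdeg : ∀ j, h j ∈ degreeLT ℂ (2 * k - 1) := by
    intro j
    rw [mem_degreeLT, hh]
    rcases eq_or_ne (G (e j).2) 0 with h0 | h0
    · simp only [h0, mul_zero, degree_zero]
      exact WithBot.bot_lt_coe _
    · have h1 := hG (e j).2
      have h2 := (e j).1.2
      rw [degree_mul, degree_X_pow]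
      rw [degree_eq_natDegree h0] at h1 ⊢
      norm_cast at h1 ⊢
      omega
  have hdep : ¬ LinearIndependent ℂ fun j => (⟨h j, hdeg j⟩ : degreeLT ℂ (2 * k - 1)) := by
    have : Module.Finite ℂ (degreeLT ℂ (2 * k - 1)) :=
      Module.Finite.equiv (degreeLTEquiv ℂ (2 * k - 1)).symm
    intro hli
    have h1 := hli.fintype_card_le_finrank
    rw [(degreeLTEquiv ℂ (2 * k - 1)).finrank_eq, Module.finrank_fin_fun, Fintype.card_fin] at h1
    omega
  obtain ⟨w, hw, j₀, hj₀⟩ := Fintype.not_linearIndependent_iff.1 hdep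
  rw [← Matrix.exists_vecMul_eq_zero_iff]
  refine ⟨w, fun h0 => hj₀ (congrFun h0 j₀), ?_⟩
  have hw' : ∑ j, C (w j) * h j = 0 := by
    have := congrArg (Submodule.subtype _) hw
    simpa [smul_eq_C_mul] using this
  have hrow : ∑ j, w j • sylvesterMatrix k v (e j) = 0 := by
    apply injective_ofFn (d + k)
    rw [map_sum, map_zero, ← zero_mul p, ← hw', Finset.sum_mul]
    refine Finset.sum_congr rfl fun j _ => ?_
    rw [map_smul, smul_eq_C_mul, ofFn_sylvesterMatrix, hp, hh]
    ring
  funext t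
  have := congrFun hrow (c t)
  simpa [Matrix.vecMul, dotProduct] using this

/-- Two linear combinations of the forms of a primitive tuple, one of them of full degree, without
common root. -/
theorem IsPrimitive.exists_isCoprime {n : ℕ} {μ : Fin (r + 1) × Fin n → ℂ} (hμ : IsPrimitive μ) :
    ∃ (i₀ : Fin (r + 1)) (t : ℂ), (tuplePoly μ i₀).degree = (n - 1 : ℕ) ∧
      IsCoprime (tuplePoly μ i₀) (∑ i : Fin (r + 1), C (t ^ (i : ℕ)) * tuplePoly μ i) := by
  obtain ⟨i₀, hi₀⟩ := hμ.exists_degree_eq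
  have hu0 : tuplePoly μ i₀ ≠ 0 := by
    intro h0
    rw [h0, degree_zero] at hi₀
    exact WithBot.bot_ne_coe hi₀
  -- for each root `ρ` of the chosen form, the values `t` for which the combination vanishes at `ρ`
  -- are the roots of the nonzero polynomial `S ρ`
  set S : ℂ → ℂ[X] := fun ρ => ∑ i : Fin (r + 1), monomial (i : ℕ) ((tuplePoly μ i).eval ρ) with hS
  have hS0 : ∀ ρ, S ρ ≠ 0 := by
    intro ρ h0
    have : ∀ i, (X - C ρ) ∣ tuplePoly μ i := by
      intro i
      rw [dvd_iff_isRoot, IsRoot]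
      have h1 := congrArg (fun q => q.coeff (i : ℕ)) h0
      simpa [hS, finsetSum_coeff, coeff_monomial, Fin.val_inj] using h1
    exact not_isUnit_X_sub_C ρ (hμ.isUnit_of_dvd _ this)
  obtain ⟨t, ht⟩ := Infinite.exists_notMem_finset
    ((tuplePoly μ i₀).roots.toFinset.biUnion fun ρ => (S ρ).roots.toFinset)
  refine ⟨i₀, t, hi₀, ?_⟩
  rw [isCoprime_iff_aeval_ne_zero_of_isAlgClosed ℂ ℂ]
  intro ρ
  by_contra! hρ
  apply ht
  simp only [Finset.mem_biUnion, Multiset.mem_toFinset]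
  refine ⟨ρ, (mem_roots hu0).2 (by simpa using hρ.1), (mem_roots (hS0 ρ)).2 ?_⟩
  have := hρ.2
  simp only [coe_aeval_eq_eval, eval_finsetSum, eval_mul, eval_C] at this
  rw [IsRoot, hS, eval_finsetSum, ← this]
  refine Finset.sum_congr rfl fun i _ => ?_
  rw [eval_monomial, mul_comm]

/-- If `v = (g_0 p, …, g_r p)` with `g` primitive of degree `m - 1 ≥ k`, then two coprime
combinations `u` and `u'` of the `g i` satisfy no relation `a * u + b * u' = 0` with `a` and `b`
of degree less than `k`, so `A` has rank at least `2 * k`. -/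
theorem two_mul_le_rank_sylvesterMatrix {m : ℕ} (hkm : k < m) (hm : m ≤ d + 1)
    {μ : Fin (r + 1) × Fin m → ℂ} (hμ : IsPrimitive μ) {ν : Fin (d + 2 - m) → ℂ} (hν : ν ≠ 0) :
    2 * k ≤ (sylvesterMatrix k (mulCoeff (d := d) μ ν)).rank := by
  obtain ⟨i₀, t, hi₀, hco⟩ := hμ.exists_isCoprime
  set v := mulCoeff (d := d) μ ν with hv
  set A := sylvesterMatrix k v with hA
  let L : ((Fin k → ℂ) × (Fin k → ℂ)) →ₗ[ℂ] (Fin k × Fin (r + 1) → ℂ) :=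
    { toFun := fun ab bi => (if bi.2 = i₀ then ab.1 bi.1 else 0) + t ^ (bi.2 : ℕ) * ab.2 bi.1
      map_add' := fun x y => by
        funext bi
        simp only [Prod.fst_add, Prod.snd_add, Pi.add_apply]
        split_ifs <;> ring
      map_smul' := fun c x => by
        funext bi
        simp only [Prod.smul_fst, Prod.smul_snd, Pi.smul_apply, smul_eq_mul, RingHom.id_apply]
        split_ifs <;> ring }
  have hpoly : ∀ ab, ofFn (d + k) (Matrix.vecMul (L ab) A) =
      ofFn k ab.1 * tuplePoly v i₀ +
        ofFn k ab.2 * ∑ i : Fin (r + 1), C (t ^ (i : ℕ)) * tuplePoly v i := by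
    intro ab
    rw [hA, ofFn_vecMul_sylvesterMatrix, Fintype.sum_prod_type]
    simp only [L, LinearMap.coe_mk, AddHom.coe_mk, map_add, add_mul, Finset.sum_add_distrib]
    congr 1
    · rw [ofFn_eq_sum_monomial, Finset.sum_mul]
      refine Finset.sum_congr rfl fun b _ => ?_
      rw [Finset.sum_eq_single i₀]
      · rw [if_pos rfl, ← C_mul_X_pow_eq_monomial]
        ring
      · intro i _ hi
        rw [if_neg hi, map_zero, zero_mul]
      · simp
    · rw [ofFn_eq_sum_monomial, Finset.sum_mul_sum]
      refine Finset.sum_congr rfl fun b _ => Finset.sum_congr rfl fun i _ => ?_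
      rw [← C_mul_X_pow_eq_monomial, map_mul]
      ring
  have hp0 : ofFn _ ν ≠ 0 := fun h0 => hν (ofFn_eq_zero_iff.1 h0)
  have hu0 : tuplePoly μ i₀ ≠ 0 := by
    intro h0
    rw [h0, degree_zero] at hi₀
    exact WithBot.bot_ne_coe hi₀
  have hinj : Function.Injective (A.vecMulLinear ∘ₗ L) := by
    rw [← LinearMap.ker_eq_bot, LinearMap.ker_eq_bot']
    intro ab hab
    have h1 := hpoly ab
    have h2 : Matrix.vecMul (L ab) A = 0 := hab
    rw [h2, map_zero] at h1
    simp only [hv, tuplePoly_mulCoeff (show m ≤ d + 2 by omega)] at h1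
    have h3 : ofFn k ab.1 * tuplePoly μ i₀ +
        ofFn k ab.2 * ∑ i : Fin (r + 1), C (t ^ (i : ℕ)) * tuplePoly μ i = 0 := by
      apply mul_right_cancel₀ hp0
      rw [zero_mul, h1, add_mul, mul_assoc, mul_assoc, Finset.sum_mul]
      simp only [mul_assoc]
    have h4 : tuplePoly μ i₀ ∣ ofFn k ab.2 := by
      apply hco.dvd_of_dvd_mul_right
      exact ⟨-ofFn k ab.1, by linear_combination h3⟩
    have h5 : ofFn k ab.2 = 0 := by
      apply eq_zero_of_dvd_of_degree_lt h4
      rw [hi₀]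
      exact (ofFn_degree_lt _).trans_le (by exact_mod_cast (by omega : k ≤ m - 1))
    rw [h5, zero_mul, add_zero] at h3
    have h6 := (mul_eq_zero.1 h3).resolve_right hu0
    exact Prod.ext (ofFn_eq_zero_iff.1 h6) (ofFn_eq_zero_iff.1 h5)
  have h1 := LinearMap.finrank_range_of_inj hinj
  have h2 : LinearMap.range (A.vecMulLinear ∘ₗ L) ≤ LinearMap.range A.vecMulLinear :=
    LinearMap.range_comp_le_range _ _
  have h3 := Submodule.finrank_mono h2
  rw [h1, Module.finrank_prod, Module.finrank_fin_fun] at h3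
  rw [← Matrix.rank_transpose, Matrix.rank]
  have h4 : A.transpose.mulVecLin = A.vecMulLinear := by
    ext
    simp
  rw [h4]
  omega

theorem mem_productCone_self (v : Fin (r + 1) × Fin (d + 1) → ℂ) : v ∈ productCone d r (d + 1) := by
  refine (mem_productCone_iff (by omega)).2 ⟨tuplePoly v, 1, tuplePoly_degree_lt v, ?_, by simp⟩
  rw [degree_one]
  exact_mod_cast (by omega : 0 < d + 2 - (d + 1))

/-- Every nonzero tuple is a primitive tuple times a form. -/
theorem exists_isPrimitive_mulCoeff {v : Fin (r + 1) × Fin (d + 1) → ℂ} (hv : v ≠ 0) :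
    ∃ m, m ≤ d + 1 ∧ ∃ (μ : Fin (r + 1) × Fin m → ℂ) (ν : Fin (d + 2 - m) → ℂ),
      IsPrimitive μ ∧ ν ≠ 0 ∧ v = mulCoeff μ ν := by
  classical
  have hex : ∃ m, v ∈ productCone d r m := ⟨d + 1, mem_productCone_self v⟩
  have hle : Nat.find hex ≤ d + 1 := Nat.find_min' hex (mem_productCone_self v)
  obtain ⟨μ, ν, h⟩ := Nat.find_spec hex
  have hpos : 1 ≤ Nat.find hex := by
    rw [Nat.one_le_iff_ne_zero]
    intro h0
    obtain ⟨G, p, hG, -, hp⟩ := (mem_productCone_iff (by omega)).1 (Nat.find_spec hex)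
    obtain ⟨i, hi⟩ := exists_tuplePoly_ne_zero hv
    refine hi ?_
    have h2 := hG i
    rw [h0, Nat.cast_zero] at h2
    have h3 : G i = 0 := by
      by_contra h3
      rw [degree_eq_natDegree h3] at h2
      norm_cast at h2
    rw [hp, h3, zero_mul]
  refine ⟨Nat.find hex, hle, μ, ν, isPrimitive_of_notMem (ν := ν) hpos hle ?_, ?_, h⟩
  · rw [← h]
    exact Nat.find_min hex (by omega)
  · rintro rfl
    refine hv (h.trans ?_)
    have := mulCoeff_smul_right (d := d) 0 μ 0
    rwa [zero_smul, zero_smul] at this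

/-- A linear factor of `p` is moved to `g`, or, if `p` has a root at `[0 : 1]`, the bound on the
degree of `g` is raised. -/
theorem productCone_subset_succ {m : ℕ} (hm : m ≤ d) :
    productCone d r m ⊆ productCone d r (m + 1) := by
  intro v hv
  obtain ⟨G, p, hG, hp, h⟩ := (mem_productCone_iff (by omega)).1 hv
  rw [mem_productCone_iff (by omega)]
  rcases lt_or_ge p.degree (d + 2 - (m + 1) : ℕ) with hlt | hge
  · exact ⟨G, p, fun i => (hG i).trans (by exact_mod_cast Nat.lt_succ_self m), hlt, h⟩
  · obtain ⟨τ, hτ⟩ := IsAlgClosed.exists_root p (fun h0 => by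
      rw [h0] at hge
      have : d + 2 - (m + 1) ≤ 0 := by exact_mod_cast hge
      omega)
    obtain ⟨q, rfl⟩ := dvd_iff_isRoot.2 hτ
    refine ⟨fun i => G i * (X - C τ), q, fun i => ?_, ?_, fun i => by rw [h]; ring⟩
    · rw [degree_mul, degree_X_sub_C]
      rcases eq_or_ne (G i) 0 with h0 | h0
      · rw [h0, degree_zero, WithBot.bot_add]
        exact WithBot.bot_lt_coe _
      · have h1 := hG i
        rw [degree_eq_natDegree h0] at h1 ⊢
        norm_cast at h1 ⊢
        omega
    · rw [degree_mul, degree_X_sub_C] at hp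
      rcases eq_or_ne q 0 with h0 | h0
      · rw [h0, degree_zero]
        exact WithBot.bot_lt_coe _
      · rw [degree_eq_natDegree h0] at hp ⊢
        norm_cast at hp ⊢
        omega

theorem productCone_mono {m : ℕ} (hmk : m ≤ k) (hk : k ≤ d + 1) :
    productCone d r m ⊆ productCone d r k := by
  induction k, hmk using Nat.le_induction with
  | base => exact subset_rfl
  | succ n _ ih => exact (ih (by omega)).trans (productCone_subset_succ (by omega))

theorem exists_minor_ne_zero (hk : k ≤ d + 1) {v : Fin (r + 1) × Fin (d + 1) → ℂ}
    (hv : v ∉ productCone d r k) :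
    ∃ (e : Fin (2 * k) ↪ Fin k × Fin (r + 1)) (c : Fin (2 * k) ↪ Fin (d + k)),
      ((sylvesterMatrix k v).submatrix e c).det ≠ 0 := by
  have hv0 : v ≠ 0 := by
    rintro rfl
    refine hv ⟨0, 0, ?_⟩
    have := mulCoeff_smul_right (d := d) (k := k) (0 : ℂ) (0 : Fin (r + 1) × Fin k → ℂ) 0
    rw [zero_smul, zero_smul] at this
    exact this.symm
  obtain ⟨m, hm, μ, ν, hμ, hν, rfl⟩ := exists_isPrimitive_mulCoeff hv0
  refine exists_submatrix_det_ne_zero _ (two_mul_le_rank_sylvesterMatrix ?_ hm hμ hν)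
  by_contra hkm
  exact hv (productCone_mono (by omega) hk ⟨μ, ν, rfl⟩)

/-- The matrix `A` of the tuple of indeterminates. -/
def genericSylvesterMatrix (d r k : ℕ) :
    Matrix (Fin k × Fin (r + 1)) (Fin (d + k)) (MvPolynomial (Fin (r + 1) × Fin (d + 1)) ℂ) :=
  Matrix.of fun bi c =>
    ∑ j : Fin (d + 1), if (bi.1 : ℕ) + (j : ℕ) = (c : ℕ) then MvPolynomial.X (bi.2, j) else 0

theorem isHomogeneous_genericSylvesterMatrix (bi : Fin k × Fin (r + 1)) (c : Fin (d + k)) :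
    (genericSylvesterMatrix d r k bi c).IsHomogeneous 1 := by
  rw [genericSylvesterMatrix, Matrix.of_apply]
  refine MvPolynomial.IsHomogeneous.sum _ _ _ fun j _ => ?_
  split_ifs
  · exact MvPolynomial.isHomogeneous_X _ _
  · exact MvPolynomial.isHomogeneous_zero _ _ _

theorem eval_genericSylvesterMatrix (v : Fin (r + 1) × Fin (d + 1) → ℂ) :
    (genericSylvesterMatrix d r k).map (MvPolynomial.eval v) = sylvesterMatrix k v := by
  ext bi c
  simp only [genericSylvesterMatrix, sylvesterMatrix, Matrix.map_apply, Matrix.of_apply, map_sum]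
  refine Finset.sum_congr rfl fun j _ => ?_
  split_ifs
  · exact MvPolynomial.eval_X _
  · exact map_zero _

theorem isHomogeneous_det {ι n : Type*} [Fintype n] [DecidableEq n] {e : ℕ}
    {M : Matrix n n (MvPolynomial ι ℂ)} (hM : ∀ i j, (M i j).IsHomogeneous e) :
    M.det.IsHomogeneous (Fintype.card n * e) := by
  rw [Matrix.det_apply]
  refine MvPolynomial.IsHomogeneous.sum _ _ _ fun σ _ => ?_
  have h := MvPolynomial.IsHomogeneous.prod Finset.univ (fun i => M (σ i) i) (fun _ => e)
    fun i _ => hM _ _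
  rw [Finset.sum_const, smul_eq_mul, Finset.card_univ] at h
  rcases Int.units_eq_one_or (Equiv.Perm.sign σ) with h1 | h1
  · rwa [h1, one_smul]
  · rw [h1, Units.neg_smul, one_smul]
    exact h.neg

/-- The cone over `R_k` is cut out by homogeneous polynomials. -/
theorem exists_isHomogeneous_separating (hk : k ≤ d + 1)
    {v : Fin (r + 1) × Fin (d + 1) → ℂ} (hv : v ∉ productCone d r k) :
    ∃ (n : ℕ) (F : MvPolynomial (Fin (r + 1) × Fin (d + 1)) ℂ), F.IsHomogeneous n ∧
      (∀ w ∈ productCone d r k, MvPolynomial.eval w F = 0) ∧ MvPolynomial.eval v F ≠ 0 := by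
  rcases Nat.eq_zero_or_pos k with rfl | hk1
  · -- the cone over `R_0 = ∅` is the origin
    obtain ⟨ij, hij⟩ : ∃ ij, v ij ≠ 0 := by
      by_contra! h0
      refine hv ⟨0, 0, ?_⟩
      funext ij
      rw [h0, mulCoeff]
      simp
    refine ⟨1, MvPolynomial.X ij, MvPolynomial.isHomogeneous_X _ _, ?_, by simpa using hij⟩
    rintro w ⟨μ, ν, rfl⟩
    rw [MvPolynomial.eval_X, mulCoeff]
    simp
  · obtain ⟨e, c, hec⟩ := exists_minor_ne_zero hk hv
    have heval : ∀ w, MvPolynomial.eval w ((genericSylvesterMatrix d r k).submatrix e c).det =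
        ((sylvesterMatrix k w).submatrix e c).det := by
      intro w
      rw [← eval_genericSylvesterMatrix, RingHom.map_det]
      rfl
    refine ⟨_, ((genericSylvesterMatrix d r k).submatrix e c).det,
      isHomogeneous_det fun i j => isHomogeneous_genericSylvesterMatrix _ _, fun w hw => ?_, ?_⟩
    · rw [heval]
      exact det_submatrix_sylvesterMatrix_eq_zero hk1 hk hw e c
    · rwa [heval]

theorem stratum_eq_minors (hk : 1 ≤ k) (hkd : k ≤ d + 1) :
    stratum d r k =
      {s | ∀ (e : Fin (2 * k) ↪ Fin k × Fin (r + 1)) (c : Fin (2 * k) ↪ Fin (d + k)),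
        ((sylvesterMatrix k s.rep).submatrix e c).det = 0} := by
  ext s
  rw [mem_stratum_iff hkd]
  constructor
  · exact fun hs e c => det_submatrix_sylvesterMatrix_eq_zero hk hkd hs e c
  · intro h
    by_contra hs
    obtain ⟨e, c, hec⟩ := exists_minor_ne_zero hkd hs
    exact hec (h e c)

end Minors

/-! ### Homogeneous ideals -/

section VanishingIdeal

open MvPolynomial

variable {ι κ : Type}

theorem eval_aeval (f : ι → MvPolynomial κ ℂ) (z : κ → ℂ) (F : MvPolynomial ι ℂ) :
    eval z (aeval f F) = eval (fun i => eval z (f i)) F := by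
  induction F using MvPolynomial.induction_on with
  | C a => simp
  | add p q hp hq => simp only [map_add, hp, hq]
  | mul_X p i hp => simp only [map_mul, hp, aeval_X, eval_X]

theorem eval_smul_of_isHomogeneous {F : MvPolynomial ι ℂ} {n : ℕ} (hF : F.IsHomogeneous n) (a : ℂ)
    (v : ι → ℂ) : eval (a • v) F = a ^ n * eval v F := by
  rw [eval_eq, eval_eq, Finset.mul_sum]
  refine Finset.sum_congr rfl fun m hm => ?_
  have h1 : ∏ i ∈ m.support, (a • v) i ^ m i = a ^ n * ∏ i ∈ m.support, v i ^ m i := by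
    simp only [Pi.smul_apply, smul_eq_mul, mul_pow, Finset.prod_mul_distrib]
    rw [Finset.prod_pow_eq_pow_sum, hF.degree_eq_sum_deg_support hm]
  rw [h1]
  ring

theorem exists_rep_eq_smul {v : ι → ℂ} (hv : v ≠ 0) :
    ∃ a : ℂ, a ≠ 0 ∧ (Projectivization.mk ℂ v hv).rep = a • v := by
  obtain ⟨a, ha⟩ := Projectivization.exists_smul_eq_mk_rep ℂ v hv
  exact ⟨a, a.ne_zero, ha.symm⟩

theorem vanishesAt_mk_iff {F : MvPolynomial ι ℂ} {n : ℕ} (hF : F.IsHomogeneous n) {v : ι → ℂ}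
    (hv : v ≠ 0) : VanishesAt F (Projectivization.mk ℂ v hv) ↔ eval v F = 0 := by
  obtain ⟨a, ha, h⟩ := exists_rep_eq_smul hv
  rw [VanishesAt, h, eval_smul_of_isHomogeneous hF, mul_eq_zero, or_iff_right (pow_ne_zero n ha)]

/-- A polynomial vanishing on a punctured line through the origin has all its homogeneous
components vanishing there. -/
theorem eval_homogeneousComponent_eq_zero {F : MvPolynomial ι ℂ} {v : ι → ℂ}
    (h : ∀ a : ℂ, a ≠ 0 → eval (a • v) F = 0) (n : ℕ) :
    eval v (homogeneousComponent n F) = 0 := by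
  set P : Polynomial ℂ := ∑ i ∈ Finset.range (F.totalDegree + 1),
    Polynomial.monomial i (eval v (homogeneousComponent i F)) with hP
  have heval : ∀ a, P.eval a = eval (a • v) F := by
    intro a
    conv_rhs => rw [← sum_homogeneousComponent F, map_sum]
    rw [hP, Polynomial.eval_finsetSum]
    refine Finset.sum_congr rfl fun i _ => ?_
    rw [Polynomial.eval_monomial,
      eval_smul_of_isHomogeneous (homogeneousComponent_isHomogeneous i F), mul_comm]
  have h0 : Polynomial.X * P = 0 := by
    apply Polynomial.funext
    intro a
    rw [Polynomial.eval_mul, Polynomial.eval_X, Polynomial.eval_zero, heval]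
    rcases eq_or_ne a 0 with rfl | ha
    · rw [zero_mul]
    · rw [h a ha, mul_zero]
  have hP0 := (mul_eq_zero.1 h0).resolve_left Polynomial.X_ne_zero
  rcases lt_or_ge F.totalDegree n with hlt | hle
  · rw [homogeneousComponent_eq_zero _ _ hlt, map_zero]
  · have h1 := congrArg (fun p => p.coeff n) hP0
    simpa [hP, Polynomial.finsetSum_coeff, Polynomial.coeff_monomial, Nat.lt_succ_iff, hle] using h1

/-- The homogeneous ideal of `X` consists of all polynomials, homogeneous or not, that vanish on the
punctured cone over `X`. -/
theorem mem_vanishingIdeal_iff {X : Set (PSpace ι)} {F : MvPolynomial ι ℂ} :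
    F ∈ vanishingIdeal X ↔
      ∀ (v : ι → ℂ) (hv : v ≠ 0), Projectivization.mk ℂ v hv ∈ X → eval v F = 0 := by
  constructor
  · intro hF v hv hX
    induction hF using Submodule.span_induction with
    | mem F hF =>
      obtain ⟨⟨n, hn⟩, h⟩ := hF
      exact (vanishesAt_mk_iff hn hv).1 (h _ hX)
    | zero => exact map_zero _
    | add F G _ _ hF hG => rw [map_add, hF, hG, add_zero]
    | smul a F _ hF => rw [smul_eq_mul, map_mul, hF, mul_zero]
  · intro h
    rw [← sum_homogeneousComponent F]
    refine Ideal.sum_mem _ fun n _ => Ideal.subset_span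
      ⟨⟨n, homogeneousComponent_isHomogeneous n F⟩, fun x hx => ?_⟩
    refine eval_homogeneousComponent_eq_zero (fun a ha => ?_) n
    refine h _ (smul_ne_zero ha x.rep_nonzero) ?_
    have : Projectivization.mk ℂ (a • x.rep) (smul_ne_zero ha x.rep_nonzero) = x := by
      conv_rhs => rw [← x.mk_rep]
      rw [Projectivization.mk_eq_mk_iff']
      exact ⟨a, rfl⟩
    rwa [this]

theorem vanishingIdeal_anti {X Y : Set (PSpace ι)} (h : X ⊆ Y) :
    vanishingIdeal Y ≤ vanishingIdeal X :=
  Ideal.span_mono fun _ hF => ⟨hF.1, fun x hx => hF.2 x (h hx)⟩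

variable {d r k : ℕ}

theorem mk_mem_stratum_iff (hk : k ≤ d + 1) {v : Fin (r + 1) × Fin (d + 1) → ℂ} (hv : v ≠ 0) :
    (Projectivization.mk ℂ v hv : TupleSpace d r) ∈ stratum d r k ↔ v ∈ productCone d r k := by
  obtain ⟨a, ha, h⟩ := exists_rep_eq_smul hv
  rw [mem_stratum_iff hk, h]
  refine ⟨fun hav => ?_, fun hv => productCone_smul hv a⟩
  have := productCone_smul hav a⁻¹
  rwa [smul_smul, inv_mul_cancel₀ ha, one_smul] at this

/-- The coefficients of the product of a tuple of forms and a form, as polynomials in the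
coefficients of the factors. -/
def productPoly (d r k : ℕ) (ij : Fin (r + 1) × Fin (d + 1)) :
    MvPolynomial ((Fin (r + 1) × Fin k) ⊕ Fin (d + 2 - k)) ℂ :=
  ∑ a : Fin k, ∑ b : Fin (d + 2 - k),
    if (a : ℕ) + (b : ℕ) = (ij.2 : ℕ) then X (Sum.inl (ij.1, a)) * X (Sum.inr b) else 0

theorem eval_productPoly (μ : Fin (r + 1) × Fin k → ℂ) (ν : Fin (d + 2 - k) → ℂ)
    (ij : Fin (r + 1) × Fin (d + 1)) :
    eval (Sum.elim μ ν) (productPoly d r k ij) = mulCoeff μ ν ij := by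
  simp only [productPoly, mulCoeff, map_sum]
  refine Finset.sum_congr rfl fun a _ => Finset.sum_congr rfl fun b _ => ?_
  split_ifs
  · rw [map_mul, eval_X, eval_X, Sum.elim_inl, Sum.elim_inr]
  · exact map_zero _

/-- Pullback of polynomials along the multiplication of forms. -/
def mulPullback (d r k : ℕ) : MvPolynomial (Fin (r + 1) × Fin (d + 1)) ℂ →ₐ[ℂ]
    MvPolynomial ((Fin (r + 1) × Fin k) ⊕ Fin (d + 2 - k)) ℂ :=
  aeval (productPoly d r k)

theorem eval_mulPullback (F : MvPolynomial (Fin (r + 1) × Fin (d + 1)) ℂ)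
    (μ : Fin (r + 1) × Fin k → ℂ) (ν : Fin (d + 2 - k) → ℂ) :
    eval (Sum.elim μ ν) (mulPullback d r k F) = eval (mulCoeff μ ν) F := by
  rw [mulPullback, eval_aeval]
  simp only [eval_productPoly]

theorem eq_zero_of_eval_ne_zero [Nonempty ι] [Nonempty κ] {P : MvPolynomial (ι ⊕ κ) ℂ}
    (h : ∀ μ ν, μ ≠ 0 → ν ≠ 0 → eval (Sum.elim μ ν) P = 0) : P = 0 := by
  obtain ⟨a⟩ := ‹Nonempty ι›
  obtain ⟨b⟩ := ‹Nonempty κ›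
  have h0 : P * (X (Sum.inl a) * X (Sum.inr b)) = 0 := by
    apply MvPolynomial.funext
    intro z
    obtain ⟨μ, ν, rfl⟩ : ∃ μ ν, z = Sum.elim μ ν :=
      ⟨z ∘ Sum.inl, z ∘ Sum.inr, (Sum.elim_comp_inl_inr z).symm⟩
    rw [map_mul, map_mul, eval_X, eval_X, Sum.elim_inl, Sum.elim_inr, map_zero]
    by_cases hμ : μ = 0
    · simp [hμ]
    by_cases hν : ν = 0
    · simp [hν]
    rw [h μ ν hμ hν, zero_mul]
  exact (mul_eq_zero.1 h0).resolve_right (mul_ne_zero (X_ne_zero _) (X_ne_zero _))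

/-- The homogeneous ideal of `R_k` is the kernel of the pullback along the multiplication map. -/
theorem vanishingIdeal_stratum (hk : 1 ≤ k) (hkd : k ≤ d + 1) :
    vanishingIdeal (stratum d r k) = RingHom.ker (mulPullback d r k) := by
  ext F
  rw [mem_vanishingIdeal_iff, RingHom.mem_ker]
  constructor
  · intro h
    have : Nonempty (Fin (r + 1) × Fin k) := ⟨(0, ⟨0, hk⟩)⟩
    have : Nonempty (Fin (d + 2 - k)) := ⟨⟨0, by omega⟩⟩
    refine eq_zero_of_eval_ne_zero fun μ ν hμ hν => ?_
    rw [eval_mulPullback]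
    exact h _ (mulCoeff_ne_zero hμ hν) ((mk_mem_stratum_iff hkd _).2 ⟨μ, ν, rfl⟩)
  · intro h v hv hX
    obtain ⟨μ, ν, rfl⟩ := (mk_mem_stratum_iff hkd hv).1 hX
    rw [← eval_mulPullback, h, map_zero]

theorem vanishingIdeal_stratum_isPrime (hk : 1 ≤ k) (hkd : k ≤ d + 1) :
    (vanishingIdeal (stratum d r k)).IsPrime := by
  rw [vanishingIdeal_stratum hk hkd]
  exact RingHom.ker_isPrime _

/-- The tuple `(1, X ^ (k - 1), …)` is primitive. -/
theorem exists_isPrimitive (hr : 1 ≤ r) (hk : 1 ≤ k) :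
    ∃ μ : Fin (r + 1) × Fin k → ℂ, IsPrimitive μ := by
  obtain ⟨μ, hμ⟩ := exists_tuplePoly_eq (n := k) (r := r)
    (G := fun i => if i = 0 then 1 else Polynomial.X ^ (k - 1)) (fun i => by
      split_ifs
      · rw [Polynomial.degree_one]
        exact_mod_cast hk
      · rw [Polynomial.degree_X_pow]
        exact_mod_cast (by omega : k - 1 < k))
  refine ⟨μ, fun q hq => ?_, ⟨1, by omega⟩, ?_⟩
  · have := hq 0
    rw [hμ, if_pos rfl] at this
    exact isUnit_of_dvd_one this
  · rw [hμ, if_neg (by simp [Fin.ext_iff]), Polynomial.coeff_X_pow_self]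
    exact one_ne_zero

/-- `R_k` is irreducible and `R_{k-1}` is a proper closed subset, so `R_k \ R_{k-1}` is dense in
`R_k`. -/
theorem vanishingIdeal_stratum_diff (hr : 1 ≤ r) (hk : 1 ≤ k) (hkd : k ≤ d + 1) :
    vanishingIdeal (stratum d r k \ stratum d r (k - 1)) = vanishingIdeal (stratum d r k) := by
  refine le_antisymm (fun F hF => ?_) (vanishingIdeal_anti Set.sdiff_subset)
  obtain ⟨μ, hμ⟩ := exists_isPrimitive hr hk
  have hν : (fun _ : Fin (d + 2 - k) => (1 : ℂ)) ≠ 0 := fun h =>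
    one_ne_zero (congrFun h ⟨0, by omega⟩)
  obtain ⟨n, H, -, hH, hH0⟩ := exists_isHomogeneous_separating (k := k - 1) (by omega)
    (notMem_productCone_of_isPrimitive hkd hμ hν (show k - 1 < k by omega))
  have hFH : F * H ∈ vanishingIdeal (stratum d r k) := by
    rw [mem_vanishingIdeal_iff]
    intro v hv hvk
    rw [map_mul]
    by_cases hvk' : Projectivization.mk ℂ v hv ∈ stratum d r (k - 1)
    · rw [hH v ((mk_mem_stratum_iff (by omega) hv).1 hvk'), mul_zero]
    · rw [mem_vanishingIdeal_iff.1 hF v hv ⟨hvk, hvk'⟩, zero_mul]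
  refine ((vanishingIdeal_stratum_isPrime hk hkd).mem_or_mem hFH).resolve_right fun hH' => hH0 ?_
  exact mem_vanishingIdeal_iff.1 hH' _ (mulCoeff_ne_zero hμ.ne_zero hν)
    ((mk_mem_stratum_iff hkd _).2 ⟨μ, _, rfl⟩)

end VanishingIdeal

/-! ### Regular maps given by kernels of matrices -/

section Regularity

open MvPolynomial

variable {ι κ : Type}

/-- Near `x`, on the basic open set `H ≠ 0`, the map `φ` is given on `X` by the homogeneous
polynomials `F j`. -/
structure IsLocalFormula (X : Set (PSpace ι)) (φ : PSpace ι → PSpace κ) (x : PSpace ι)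
    (H : MvPolynomial ι ℂ) (F : κ → MvPolynomial ι ℂ) : Prop where
  isHomogeneous_denom : ∃ m, H.IsHomogeneous m
  isHomogeneous : ∃ n, ∀ j, (F j).IsHomogeneous n
  denom_ne_zero : eval x.rep H ≠ 0
  eq_smul : ∀ y ∈ X, eval y.rep H ≠ 0 →
    ∃ c : ℂ, c ≠ 0 ∧ (fun j => eval y.rep (F j)) = c • (φ y).rep

theorem isRegularOn_of_isLocalFormula {X : Set (PSpace ι)} {φ : PSpace ι → PSpace κ}
    (h : ∀ x ∈ X, ∃ H F, IsLocalFormula X φ x H F) : IsRegularOn X φ := by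
  intro x hx
  obtain ⟨H, F, h⟩ := h x hx
  obtain ⟨n, hn⟩ := h.isHomogeneous
  refine ⟨{y | eval y.rep H ≠ 0}, ⟨{H}, fun G hG => ?_, ?_⟩, h.denom_ne_zero, n, F, hn, ?_⟩
  · rw [Set.mem_singleton_iff.1 hG]
    exact h.isHomogeneous_denom
  · ext y
    simp [VanishesAt]
  · rintro y ⟨hy, hyH⟩
    obtain ⟨c, hc, hcy⟩ := h.eq_smul y hy hyH
    have hne : (fun j => eval y.rep (F j)) ≠ 0 := by
      rw [hcy]
      exact smul_ne_zero hc (φ y).rep_nonzero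
    refine ⟨hne, ?_⟩
    conv_lhs => rw [← (φ y).mk_rep]
    rw [Projectivization.mk_eq_mk_iff']
    exact ⟨c⁻¹, by rw [hcy, smul_smul, inv_mul_cancel₀ hc, one_smul]⟩

/-- If `φ y` lies in the kernel of a matrix whose entries are homogeneous polynomials in `y`, and if
the kernel at `x` is the line `φ x`, then `φ` is regular near `x`: by Cramer's rule the kernel is
spanned by a vector of maximal minors. -/
theorem exists_isLocalFormula_of_ker [Fintype κ] {τ : Type} [Fintype τ] {X : Set (PSpace ι)}
    {φ : PSpace ι → PSpace κ} {x : PSpace ι} {H : MvPolynomial ι ℂ} {m e : ℕ}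
    (hH : H.IsHomogeneous m) (hHx : eval x.rep H ≠ 0) {M : Matrix τ κ (MvPolynomial ι ℂ)}
    (hM : ∀ t a, (M t a).IsHomogeneous e)
    (hker : ∀ y ∈ X, eval y.rep H ≠ 0 → (M.map (eval y.rep)).mulVec (φ y).rep = 0)
    (hx : ∀ w, (M.map (eval x.rep)).mulVec w = 0 → ∃ c : ℂ, w = c • (φ x).rep) :
    ∃ H' F, (∃ Q, H' = H * Q) ∧ IsLocalFormula X φ x H' F := by
  classical
  have hne : Nonempty κ := by
    by_contra h
    rw [not_nonempty_iff] at h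
    exact (φ x).rep_nonzero (Subsingleton.elim _ _)
  obtain ⟨n, hn⟩ := Nat.exists_eq_add_of_le' (Fintype.card_pos (α := κ))
  have hrank : n ≤ (M.map (eval x.rep)).rank := by
    have h1 := LinearMap.finrank_range_add_finrank_ker (M.map (eval x.rep)).mulVecLin
    have h2 : Module.finrank ℂ (LinearMap.ker (M.map (eval x.rep)).mulVecLin) ≤ 1 := by
      have h3 : LinearMap.ker (M.map (eval x.rep)).mulVecLin ≤ Submodule.span ℂ {(φ x).rep} := by
        intro w hw
        obtain ⟨c, hc⟩ := hx w hw
        exact Submodule.mem_span_singleton.2 ⟨c, hc.symm⟩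
      exact (Submodule.finrank_mono h3).trans (finrank_span_singleton (φ x).rep_nonzero).le
    rw [Module.finrank_fintype_fun_eq_card] at h1
    rw [Matrix.rank]
    omega
  obtain ⟨s, c, hdet⟩ := exists_submatrix_det_ne_zero _ hrank
  obtain ⟨a₀, ha₀⟩ : ∃ a₀, a₀ ∉ Set.range c := by
    by_contra! hall
    have := Fintype.card_le_of_surjective c hall
    rw [Fintype.card_fin] at this
    omega
  have hbij : Function.Bijective fun o : Option (Fin n) => o.elim a₀ c := by
    rw [Fintype.bijective_iff_injective_and_card]
    refine ⟨?_, by rw [Fintype.card_option, Fintype.card_fin, hn]⟩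
    rintro (_ | i) (_ | j) hij
    · rfl
    · exact absurd ⟨j, hij.symm⟩ ha₀
    · exact absurd ⟨i, hij⟩ ha₀
    · exact congrArg some (c.injective hij)
  set E := Equiv.ofBijective _ hbij with hE
  set B : Matrix (Fin n) (Fin n) (MvPolynomial ι ℂ) := M.submatrix s c with hB
  set b : Fin n → MvPolynomial ι ℂ := fun t => M (s t) a₀ with hb
  have hdegB : B.det.IsHomogeneous (n * e) := by
    have := isHomogeneous_det (M := B) (e := e) fun i j => hM _ _
    rwa [Fintype.card_fin] at this
  have hdegC : ∀ j, (B.cramer b j).IsHomogeneous (n * e) := by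
    intro j
    rw [Matrix.cramer_apply]
    have := isHomogeneous_det (M := B.updateCol j b) (e := e) fun i l => by
      rw [Matrix.updateCol_apply]
      split_ifs
      · exact hM _ _
      · exact hM _ _
    rwa [Fintype.card_fin] at this
  have hBmap : ∀ y : ι → ℂ, eval y B.det = ((M.map (eval y)).submatrix s c).det := by
    intro y
    rw [RingHom.map_det]
    rfl
  have hcr : ∀ (y : ι → ℂ) (t : Fin n),
      ∑ j, eval y (M (s t) (c j)) * eval y (B.cramer b j) = eval y B.det * eval y (M (s t) a₀) := by
    intro y t
    have := congrFun (Matrix.mulVec_cramer B b) t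
    have := congrArg (eval y) this
    simpa [Matrix.mulVec, dotProduct, hB, hb] using this
  refine ⟨H * B.det, fun a => (E.symm a).elim B.det fun j => -B.cramer b j, ⟨_, rfl⟩,
    ⟨_, hH.mul hdegB⟩, ⟨n * e, fun a => ?_⟩, ?_, fun y hy hyH => ?_⟩
  · rcases E.symm a with _ | j
    · exact hdegB
    · exact (hdegC j).neg
  · rw [map_mul, hBmap]
    exact mul_ne_zero hHx hdet
  · rw [map_mul] at hyH
    have hD := right_ne_zero_of_mul hyH
    have hk := hker y hy (left_ne_zero_of_mul hyH)
    set w := (φ y).rep with hw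
    set D := eval y.rep B.det with hDdef
    have hsum : ∀ t, eval y.rep (M (s t) a₀) * w a₀ +
        ∑ j, eval y.rep (M (s t) (c j)) * w (c j) = 0 := by
      intro t
      have h1 := congrFun hk (s t)
      simp only [Matrix.mulVec, dotProduct, Matrix.map_apply, Pi.zero_apply] at h1
      rw [← E.sum_comp, Fintype.sum_option] at h1
      exact h1
    -- `D * w (c j) + w a₀ * cramer j` solves the homogeneous system with the invertible matrix `B`
    have hz : ∀ j, D * w (c j) + w a₀ * eval y.rep (B.cramer b j) = 0 := by
      have h1 : ((M.map (eval y.rep)).submatrix s c).mulVec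
          (fun j => D * w (c j) + w a₀ * eval y.rep (B.cramer b j)) = 0 := by
        funext t
        simp only [Matrix.mulVec, dotProduct, Matrix.submatrix_apply, Matrix.map_apply,
          Pi.zero_apply, mul_add, Finset.sum_add_distrib]
        have h2 : ∑ j, eval y.rep (M (s t) (c j)) * (D * w (c j)) =
            D * ∑ j, eval y.rep (M (s t) (c j)) * w (c j) := by
          rw [Finset.mul_sum]
          exact Finset.sum_congr rfl fun _ _ => by ring
        have h3 : ∑ j, eval y.rep (M (s t) (c j)) * (w a₀ * eval y.rep (B.cramer b j)) =
            w a₀ * ∑ j, eval y.rep (M (s t) (c j)) * eval y.rep (B.cramer b j) := by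
          rw [Finset.mul_sum]
          exact Finset.sum_congr rfl fun _ _ => by ring
        rw [h2, h3, hcr]
        linear_combination D * hsum t
      have h2 := Matrix.eq_zero_of_mulVec_eq_zero (by rw [← hBmap]; exact hD) h1
      exact fun j => congrFun h2 j
    have hw0 : w a₀ ≠ 0 := by
      intro h0
      refine (φ y).rep_nonzero (funext fun a => ?_)
      obtain ⟨o, rfl⟩ := E.surjective a
      rcases o with _ | j
      · exact h0
      · have := hz j
        rw [h0, zero_mul, add_zero] at this
        exact (mul_eq_zero.1 this).resolve_left hD
    refine ⟨D / w a₀, div_ne_zero hD hw0, funext fun a => ?_⟩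
    obtain ⟨o, rfl⟩ := E.surjective a
    rw [Equiv.symm_apply_apply, Pi.smul_apply, smul_eq_mul, div_mul_eq_mul_div, eq_div_iff hw0]
    rcases o with _ | j
    · rfl
    · change eval y.rep (-B.cramer b j) * w a₀ = D * w (c j)
      rw [map_neg]
      linear_combination -hz j

end Regularity

/-! ### Bijectivity of the multiplication map -/

section Inverse

open MvPolynomial

variable {d r k : ℕ}

theorem mulCoeff_eq_zero_right {μ : Fin (r + 1) × Fin k → ℂ} {ν : Fin (d + 2 - k) → ℂ}
    (hμ : μ ≠ 0) (h : mulCoeff (d := d) μ ν = 0) : ν = 0 := by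
  by_contra hν
  exact mulCoeff_ne_zero hμ hν h

theorem mulCoeff_right_eq {μ : Fin (r + 1) × Fin k → ℂ} {ν ν' : Fin (d + 2 - k) → ℂ}
    (hμ : μ ≠ 0) (h : mulCoeff (d := d) μ ν = mulCoeff μ ν') : ν = ν' := by
  have h1 : mulCoeff (d := d) μ (ν + (-1 : ℂ) • ν') = 0 := by
    rw [mulCoeff_add_right, mulCoeff_smul_right, h]
    simp
  have := mulCoeff_eq_zero_right hμ h1
  rw [neg_one_smul, ← sub_eq_add_neg] at this
  exact sub_eq_zero.1 this

theorem exists_mulMap_rep_eq (z : PSpace (Fin (r + 1) × Fin k) × PSpace (Fin (d + 2 - k))) :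
    ∃ c : ℂ, c ≠ 0 ∧ (mulMap d r k z).rep = c • mulCoeff z.1.rep z.2.rep :=
  exists_rep_eq_smul _

theorem isPrimitive_smul {n : ℕ} {μ : Fin (r + 1) × Fin n → ℂ} (hμ : IsPrimitive μ) {c : ℂ}
    (hc : c ≠ 0) : IsPrimitive (c • μ) := by
  constructor
  · intro q hq
    refine hμ.isUnit_of_dvd q fun i => ?_
    have := hq i
    rwa [tuplePoly_smul, (hc.isUnit.map Polynomial.C).dvd_mul_left] at this
  · obtain ⟨i, hi⟩ := hμ.exists_coeff_ne_zero
    refine ⟨i, ?_⟩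
    rw [tuplePoly_smul, Polynomial.coeff_C_mul]
    exact mul_ne_zero hc hi

theorem mulMap_mem_diff_iff (hk : 1 ≤ k) (hkd : k ≤ d + 1)
    (z : PSpace (Fin (r + 1) × Fin k) × PSpace (Fin (d + 2 - k))) :
    mulMap d r k z ∈ stratum d r k \ stratum d r (k - 1) ↔ IsPrimitive z.1.rep := by
  rw [Set.mem_sdiff, mulMap, mk_mem_stratum_iff hkd, mk_mem_stratum_iff (by omega)]
  constructor
  · exact fun h => isPrimitive_of_notMem hk hkd h.2
  · exact fun h => ⟨⟨_, _, rfl⟩,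
      notMem_productCone_of_isPrimitive hkd h z.2.rep_nonzero (by omega)⟩

/-- The factorization of a tuple into a primitive tuple and a form is unique up to scalars. -/
theorem IsPrimitive.eq_smul_of_mulCoeff_eq {μ μ' : Fin (r + 1) × Fin k → ℂ}
    {ν ν' : Fin (d + 2 - k) → ℂ} (hkd : k ≤ d + 1) (hμ : IsPrimitive μ) (hν : ν ≠ 0)
    (h : mulCoeff (d := d) μ' ν' = mulCoeff μ ν) (hν' : ν' ≠ 0) : ∃ c : ℂ, μ' = c • μ := by
  have hp : ∀ i, tuplePoly μ' i * Polynomial.ofFn _ ν' = tuplePoly μ i * Polynomial.ofFn _ ν := by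
    intro i
    rw [← tuplePoly_mulCoeff (by omega), ← tuplePoly_mulCoeff (by omega), h]
  have h1 : Polynomial.ofFn _ ν ≠ 0 := fun h0 => hν (ofFn_eq_zero_iff.1 h0)
  have h2 : Polynomial.ofFn _ ν' ≠ 0 := fun h0 => hν' (ofFn_eq_zero_iff.1 h0)
  refine hμ.exists_smul fun i j => ?_
  apply mul_right_cancel₀ (mul_ne_zero h1 h2)
  linear_combination tuplePoly μ j * Polynomial.ofFn _ ν * hp i -
    tuplePoly μ i * Polynomial.ofFn _ ν * hp j

theorem mulMap_bijOn (hk : 1 ≤ k) (hkd : k ≤ d + 1) :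
    Set.BijOn (mulMap d r k)
      (mulMap d r k ⁻¹' (stratum d r k \ stratum d r (k - 1)))
      (stratum d r k \ stratum d r (k - 1)) := by
  refine ⟨fun z hz => hz, fun z hz z' hz' h => ?_, fun s hs => ?_⟩
  · have hμ := (mulMap_mem_diff_iff hk hkd z).1 hz
    rw [mulMap, mulMap, Projectivization.mk_eq_mk_iff'] at h
    obtain ⟨a, ha⟩ := h
    have ha0 : a ≠ 0 := by
      rintro rfl
      rw [zero_smul] at ha
      exact mulCoeff_ne_zero z.1.rep_nonzero z.2.rep_nonzero ha.symm
    rw [← mulCoeff_smul_right] at ha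
    obtain ⟨c, hc⟩ := hμ.eq_smul_of_mulCoeff_eq hkd z.2.rep_nonzero ha
      (smul_ne_zero ha0 z'.2.rep_nonzero)
    rw [hc, mulCoeff_smul_left, ← mulCoeff_smul_right] at ha
    have h2 := mulCoeff_right_eq z.1.rep_nonzero ha
    rw [smul_smul] at h2
    refine (Prod.ext ?_ ?_).symm
    · rw [← z.1.mk_rep, ← z'.1.mk_rep, Projectivization.mk_eq_mk_iff']
      exact ⟨c, hc.symm⟩
    · rw [← z.2.mk_rep, ← z'.2.mk_rep]
      refine Eq.symm ?_
      rw [Projectivization.mk_eq_mk_iff']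
      exact ⟨_, h2⟩
  · obtain ⟨μ, ν, h⟩ := (mem_stratum_iff hkd s).1 hs.1
    have hμ0 : μ ≠ 0 := by
      rintro rfl
      have := mulCoeff_smul_left (d := d) (k := k) (0 : ℂ) (0 : Fin (r + 1) × Fin k → ℂ) ν
      rw [zero_smul, zero_smul] at this
      exact s.rep_nonzero (h.trans this)
    have hν0 : ν ≠ 0 := by
      rintro rfl
      have := mulCoeff_smul_right (d := d) (k := k) (0 : ℂ) μ 0
      rw [zero_smul, zero_smul] at this
      exact s.rep_nonzero (h.trans this)
    obtain ⟨a, ha, hμr⟩ := exists_rep_eq_smul hμ0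
    obtain ⟨b, hb, hνr⟩ := exists_rep_eq_smul hν0
    have himg : mulMap d r k (Projectivization.mk ℂ μ hμ0, Projectivization.mk ℂ ν hν0) = s := by
      rw [mulMap]
      conv_rhs => rw [← s.mk_rep]
      rw [Projectivization.mk_eq_mk_iff']
      refine ⟨a * b, ?_⟩
      rw [hμr, hνr, mulCoeff_smul_left, mulCoeff_smul_right, smul_smul, h]
    refine ⟨_, ?_, himg⟩
    rw [Set.mem_preimage, himg]
    exact hs

/-- Coefficients of the `2 × 2` minors `f_i h_j - f_j h_i`, as linear forms in the coefficients
of `h`, where `f` is the generic tuple of degree `d`. -/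
def crossMatrix (d r k : ℕ) : Matrix (Fin (r + 1) × Fin (r + 1) × Fin (d + k))
    (Fin (r + 1) × Fin k) (MvPolynomial (Fin (r + 1) × Fin (d + 1)) ℂ) :=
  Matrix.of fun t la =>
    (if la.1 = t.2.1 then genericSylvesterMatrix d r k (la.2, t.1) t.2.2 else 0) -
      (if la.1 = t.1 then genericSylvesterMatrix d r k (la.2, t.2.1) t.2.2 else 0)

theorem isHomogeneous_crossMatrix (t : Fin (r + 1) × Fin (r + 1) × Fin (d + k))
    (la : Fin (r + 1) × Fin k) : (crossMatrix d r k t la).IsHomogeneous 1 := by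
  rw [crossMatrix, Matrix.of_apply]
  refine IsHomogeneous.sub ?_ ?_
  · split_ifs
    · exact isHomogeneous_genericSylvesterMatrix _ _
    · exact isHomogeneous_zero _ _ _
  · split_ifs
    · exact isHomogeneous_genericSylvesterMatrix _ _
    · exact isHomogeneous_zero _ _ _

theorem ofFn_crossMatrix_mulVec (v : Fin (r + 1) × Fin (d + 1) → ℂ) (h : Fin (r + 1) × Fin k → ℂ)
    (i j : Fin (r + 1)) :
    Polynomial.ofFn (d + k) (fun t => ((crossMatrix d r k).map (eval v)).mulVec h (i, j, t)) =
      tuplePoly h j * tuplePoly v i - tuplePoly h i * tuplePoly v j := by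
  have hsyl : ∀ l t, ∀ a : Fin k, eval v (genericSylvesterMatrix d r k (a, l) t) =
      sylvesterMatrix k v (a, l) t := by
    intro l t a
    rw [← eval_genericSylvesterMatrix, Matrix.map_apply]
  have hrow : ∀ l m : Fin (r + 1), ∑ a, h (m, a) • sylvesterMatrix k v (a, l) =
      fun t => ∑ a, h (m, a) * sylvesterMatrix k v (a, l) t := by
    intro l m
    funext t
    simp
  have hpoly : ∀ l m : Fin (r + 1), Polynomial.ofFn (d + k)
      (fun t => ∑ a, h (m, a) * sylvesterMatrix k v (a, l) t) =
        tuplePoly h m * tuplePoly v l := by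
    intro l m
    rw [← hrow, map_sum]
    conv_rhs => rw [tuplePoly, Polynomial.ofFn_eq_sum_monomial, Finset.sum_mul]
    refine Finset.sum_congr rfl fun a _ => ?_
    rw [map_smul, ofFn_sylvesterMatrix, Polynomial.smul_eq_C_mul,
      ← Polynomial.C_mul_X_pow_eq_monomial]
    ring
  rw [← hpoly, ← hpoly, ← map_sub]
  congr 1
  funext t
  simp only [Matrix.mulVec, dotProduct, Matrix.map_apply, crossMatrix, Matrix.of_apply, map_sub,
    sub_mul, Finset.sum_sub_distrib, Pi.sub_apply, Fintype.sum_prod_type]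
  congr 1
  · rw [Finset.sum_eq_single j]
    · refine Finset.sum_congr rfl fun a _ => ?_
      rw [if_pos rfl, hsyl, mul_comm]
    · intro l _ hl
      simp [hl]
    · simp
  · rw [Finset.sum_eq_single i]
    · refine Finset.sum_congr rfl fun a _ => ?_
      rw [if_pos rfl, hsyl, mul_comm]
    · intro l _ hl
      simp [hl]
    · simp

theorem crossMatrix_mulVec_eq_zero_iff (v : Fin (r + 1) × Fin (d + 1) → ℂ)
    (h : Fin (r + 1) × Fin k → ℂ) :
    ((crossMatrix d r k).map (eval v)).mulVec h = 0 ↔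
      ∀ i j, tuplePoly h j * tuplePoly v i = tuplePoly h i * tuplePoly v j := by
  constructor
  · intro h0 i j
    rw [← sub_eq_zero, ← ofFn_crossMatrix_mulVec, h0]
    exact map_zero _
  · intro h0
    funext ⟨i, j, t⟩
    have h1 := ofFn_crossMatrix_mulVec v h i j
    rw [sub_eq_zero.2 (h0 i j), ofFn_eq_zero_iff] at h1
    exact congrFun h1 t

end Inverse

/-! ### Regularity of the inverse of the multiplication map -/

section Isomorphism

open MvPolynomial

variable {d r k : ℕ}

theorem IsLocalFormula.of_dvd {ι κ : Type} {X : Set (PSpace ι)} {φ : PSpace ι → PSpace κ}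
    {x : PSpace ι} {H H' : MvPolynomial ι ℂ} {F : κ → MvPolynomial ι ℂ}
    (h : IsLocalFormula X φ x H F) (hH : H ∣ H') (hom : ∃ m, H'.IsHomogeneous m)
    (hx : eval x.rep H' ≠ 0) : IsLocalFormula X φ x H' F := by
  refine ⟨hom, h.isHomogeneous, hx, fun y hy hyH => h.eq_smul y hy fun h0 => hyH ?_⟩
  obtain ⟨Q, rfl⟩ := hH
  rw [map_mul, h0, zero_mul]

/-- The coefficients of `g * q`, as linear forms in the coefficients of `q`. -/
def mulMatrix {R : Type*} [CommRing R] (d r k : ℕ) (g : Fin (r + 1) × Fin k → R) :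
    Matrix (Fin (r + 1) × Fin (d + 1)) (Fin (d + 2 - k)) R :=
  Matrix.of fun ij b => ∑ a : Fin k, if (a : ℕ) + (b : ℕ) = (ij.2 : ℕ) then g (ij.1, a) else 0

theorem mulMatrix_mulVec (g : Fin (r + 1) × Fin k → ℂ) (q : Fin (d + 2 - k) → ℂ) :
    (mulMatrix d r k g).mulVec q = mulCoeff g q := by
  funext ij
  simp only [mulMatrix, Matrix.mulVec, dotProduct, Matrix.of_apply, mulCoeff, Finset.sum_mul,
    ite_mul, zero_mul]
  exact Finset.sum_comm

theorem map_mulMatrix {R S : Type*} [CommRing R] [CommRing S] (f : R →+* S)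
    (g : Fin (r + 1) × Fin k → R) (ij : Fin (r + 1) × Fin (d + 1)) (b : Fin (d + 2 - k)) :
    f (mulMatrix d r k g ij b) = mulMatrix d r k (fun la => f (g la)) ij b := by
  simp only [mulMatrix, Matrix.of_apply, map_sum]
  refine Finset.sum_congr rfl fun a _ => ?_
  split_ifs
  · rfl
  · exact map_zero f

theorem isHomogeneous_mulMatrix {n : ℕ}
    {G : Fin (r + 1) × Fin k → MvPolynomial (Fin (r + 1) × Fin (d + 1)) ℂ}
    (hG : ∀ la, (G la).IsHomogeneous n) (ij : Fin (r + 1) × Fin (d + 1)) (b : Fin (d + 2 - k)) :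
    (mulMatrix d r k G ij b).IsHomogeneous n := by
  rw [mulMatrix, Matrix.of_apply]
  refine IsHomogeneous.sum _ _ _ fun a _ => ?_
  split_ifs
  · exact hG _
  · exact isHomogeneous_zero _ _ _

/-- The `2 × 2` minors of the two tuples `f` and `g * q`, as linear forms in the coefficients
of `q`, where `f` is the generic tuple. -/
def factorMatrix (G : Fin (r + 1) × Fin k → MvPolynomial (Fin (r + 1) × Fin (d + 1)) ℂ) :
    Matrix ((Fin (r + 1) × Fin (d + 1)) × (Fin (r + 1) × Fin (d + 1))) (Fin (d + 2 - k))
      (MvPolynomial (Fin (r + 1) × Fin (d + 1)) ℂ) :=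
  Matrix.of fun t b => X t.1 * mulMatrix d r k G t.2 b - X t.2 * mulMatrix d r k G t.1 b

theorem isHomogeneous_factorMatrix {n : ℕ}
    {G : Fin (r + 1) × Fin k → MvPolynomial (Fin (r + 1) × Fin (d + 1)) ℂ}
    (hG : ∀ la, (G la).IsHomogeneous n) (t) (b) : (factorMatrix G t b).IsHomogeneous (1 + n) := by
  rw [factorMatrix, Matrix.of_apply]
  exact ((isHomogeneous_X _ _).mul (isHomogeneous_mulMatrix hG _ _)).sub
    ((isHomogeneous_X _ _).mul (isHomogeneous_mulMatrix hG _ _))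

theorem factorMatrix_mulVec
    (G : Fin (r + 1) × Fin k → MvPolynomial (Fin (r + 1) × Fin (d + 1)) ℂ)
    (v : Fin (r + 1) × Fin (d + 1) → ℂ) (q : Fin (d + 2 - k) → ℂ) (t) :
    ((factorMatrix G).map (eval v)).mulVec q t =
      v t.1 * mulCoeff (fun la => eval v (G la)) q t.2 -
        v t.2 * mulCoeff (fun la => eval v (G la)) q t.1 := by
  simp only [← mulMatrix_mulVec]
  simp only [Matrix.mulVec, dotProduct, Finset.mul_sum, ← Finset.sum_sub_distrib]
  refine Finset.sum_congr rfl fun b _ => ?_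
  simp only [Matrix.map_apply, factorMatrix, Matrix.of_apply, map_sub, map_mul, eval_X,
    map_mulMatrix]
  ring

variable {ψ : TupleSpace d r → PSpace (Fin (r + 1) × Fin k) × PSpace (Fin (d + 2 - k))}

theorem exists_rep_eq_of_rightInvOn
    (hψ : Set.RightInvOn ψ (mulMap d r k) (stratum d r k \ stratum d r (k - 1)))
    {y : TupleSpace d r} (hy : y ∈ stratum d r k \ stratum d r (k - 1)) :
    ∃ c : ℂ, c ≠ 0 ∧ y.rep = c • mulCoeff (ψ y).1.rep (ψ y).2.rep := by
  have h := exists_mulMap_rep_eq (d := d) (ψ y)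
  rwa [hψ hy] at h

theorem isPrimitive_of_rightInvOn (hk : 1 ≤ k) (hkd : k ≤ d + 1)
    (hψ : Set.RightInvOn ψ (mulMap d r k) (stratum d r k \ stratum d r (k - 1)))
    {y : TupleSpace d r} (hy : y ∈ stratum d r k \ stratum d r (k - 1)) :
    IsPrimitive (ψ y).1.rep := by
  rw [← mulMap_mem_diff_iff hk hkd, hψ hy]
  exact hy

/-- The first factor `g` of `f = g * p` spans the space of tuples of degree `k - 1` proportional
to `f`. -/
theorem exists_isLocalFormula_fst (hk : 1 ≤ k) (hkd : k ≤ d + 1)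
    (hψ : Set.RightInvOn ψ (mulMap d r k) (stratum d r k \ stratum d r (k - 1)))
    {x : TupleSpace d r} (hx : x ∈ stratum d r k \ stratum d r (k - 1)) :
    ∃ H G, IsLocalFormula (stratum d r k \ stratum d r (k - 1)) (fun y => (ψ y).1) x H G := by
  obtain ⟨H, G, -, h⟩ := exists_isLocalFormula_of_ker
    (X := stratum d r k \ stratum d r (k - 1)) (φ := fun y => (ψ y).1) (x := x) (H := 1)
    (isHomogeneous_one _ _) (by simp) (M := crossMatrix d r k) isHomogeneous_crossMatrix
    (fun y hy _ => by
      obtain ⟨c, hc, hyc⟩ := exists_rep_eq_of_rightInvOn hψ hy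
      rw [crossMatrix_mulVec_eq_zero_iff]
      intro i j
      rw [hyc, tuplePoly_smul, tuplePoly_smul, tuplePoly_mulCoeff (by omega),
        tuplePoly_mulCoeff (by omega)]
      ring)
    (fun w hw => by
      obtain ⟨c, hc, hxc⟩ := exists_rep_eq_of_rightInvOn hψ hx
      rw [crossMatrix_mulVec_eq_zero_iff] at hw
      refine (isPrimitive_of_rightInvOn hk hkd hψ hx).exists_smul fun i j => ?_
      have h1 := hw j i
      rw [hxc, tuplePoly_smul, tuplePoly_smul, tuplePoly_mulCoeff (by omega),
        tuplePoly_mulCoeff (by omega)] at h1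
      have hp : Polynomial.ofFn _ (ψ x).2.rep ≠ 0 := fun h0 =>
        (ψ x).2.rep_nonzero (ofFn_eq_zero_iff.1 h0)
      apply mul_right_cancel₀ (mul_ne_zero (Polynomial.C_ne_zero.2 hc) hp)
      linear_combination h1)
  exact ⟨H, G, h⟩

/-- Both factors of `f = g * p` are locally given by polynomials in `f`: once `g` is, the factor `p`
spans the space of forms `q` with `g * q` proportional to `f`. -/
theorem exists_isLocalFormula (hk : 1 ≤ k) (hkd : k ≤ d + 1)
    (hψ : Set.RightInvOn ψ (mulMap d r k) (stratum d r k \ stratum d r (k - 1)))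
    {x : TupleSpace d r} (hx : x ∈ stratum d r k \ stratum d r (k - 1)) :
    ∃ H G P, IsLocalFormula (stratum d r k \ stratum d r (k - 1)) (fun y => (ψ y).1) x H G ∧
      IsLocalFormula (stratum d r k \ stratum d r (k - 1)) (fun y => (ψ y).2) x H P := by
  obtain ⟨H, G, hG⟩ := exists_isLocalFormula_fst hk hkd hψ hx
  obtain ⟨m, hH⟩ := hG.isHomogeneous_denom
  obtain ⟨n, hn⟩ := hG.isHomogeneous
  obtain ⟨H', P, ⟨Q, hQ⟩, hP⟩ := exists_isLocalFormula_of_ker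
    (X := stratum d r k \ stratum d r (k - 1)) (φ := fun y => (ψ y).2) (x := x)
    hH hG.denom_ne_zero (M := factorMatrix G) (isHomogeneous_factorMatrix hn)
    (fun y hy hyH => by
      obtain ⟨c, hc, hyc⟩ := exists_rep_eq_of_rightInvOn hψ hy
      obtain ⟨a, ha, hya⟩ := hG.eq_smul y hy hyH
      funext t
      rw [factorMatrix_mulVec, hya, mulCoeff_smul_left]
      have hy1 := congrFun hyc t.1
      have hy2 := congrFun hyc t.2
      rw [hy1, hy2]
      simp only [Pi.smul_apply, smul_eq_mul, Pi.zero_apply]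
      ring)
    (fun w hw => by
      obtain ⟨c, hc, hxc⟩ := exists_rep_eq_of_rightInvOn hψ hx
      obtain ⟨a, ha, hxa⟩ := hG.eq_smul x hx hG.denom_ne_zero
      obtain ⟨ij, hij⟩ := Function.ne_iff.1 x.rep_nonzero
      set b : ℂ := mulCoeff (ψ x).1.rep w ij / x.rep ij with hb
      refine ⟨b * c, mulCoeff_right_eq (ψ x).1.rep_nonzero ?_⟩
      rw [mul_smul, mulCoeff_smul_right, mulCoeff_smul_right, ← hxc]
      funext t
      have h1 := congrFun hw (ij, t)
      rw [factorMatrix_mulVec, hxa, mulCoeff_smul_left] at h1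
      simp only [Pi.smul_apply, smul_eq_mul, Pi.zero_apply] at h1 hij ⊢
      have h2 : a * (x.rep ij * mulCoeff (ψ x).1.rep w t -
          x.rep t * mulCoeff (ψ x).1.rep w ij) = 0 := by
        linear_combination h1
      have h3 := (mul_eq_zero.1 h2).resolve_left ha
      rw [hb, div_mul_eq_mul_div, eq_div_iff hij]
      linear_combination h3)
  exact ⟨H', G, P, hG.of_dvd ⟨Q, hQ⟩ hP.isHomogeneous_denom hP.denom_ne_zero, hP⟩

theorem isBihomogeneous_productPoly (ij : Fin (r + 1) × Fin (d + 1)) :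
    IsBihomogeneous (productPoly d r k ij) 1 1 := by
  refine IsWeightedHomogeneous.sum _ _ _ fun a _ => IsWeightedHomogeneous.sum _ _ _ fun b _ => ?_
  split_ifs
  · exact (isWeightedHomogeneous_X ℂ _ _).mul (isWeightedHomogeneous_X ℂ _ _)
  · exact isWeightedHomogeneous_zero ℂ _ _

theorem isBihomogeneous_mulPullback {F : MvPolynomial (Fin (r + 1) × Fin (d + 1)) ℂ} {n : ℕ}
    (hF : F.IsHomogeneous n) : IsBihomogeneous (mulPullback d r k F) n n := by
  rw [mulPullback, aeval_def, eval₂_eq]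
  refine IsWeightedHomogeneous.sum _ _ _ fun m hm => ?_
  have h1 := IsWeightedHomogeneous.prod m.support (fun i => productPoly d r k i ^ m i)
    (fun i => m i • ((1, 1) : ℕ × ℕ)) fun i _ => (isBihomogeneous_productPoly i).pow (m i)
  have h2 := (isWeightedHomogeneous_C (R := ℂ) (Sum.elim (fun _ : Fin (r + 1) × Fin k =>
    ((1, 0) : ℕ × ℕ)) (fun _ : Fin (d + 2 - k) => ((0, 1) : ℕ × ℕ))) (coeff m F)).mul h1
  rw [← Finset.sum_smul, ← hF.degree_eq_sum_deg_support hm, zero_add] at h2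
  have h3 : n • ((1, 1) : ℕ × ℕ) = (n, n) := by
    rw [Prod.smul_mk, smul_eq_mul, mul_one]
  rwa [h3] at h2

theorem isZariskiOpenProd_preimage (hk : 1 ≤ k) (hkd : k ≤ d + 1) :
    IsZariskiOpenProd (mulMap d r k ⁻¹' (stratum d r k \ stratum d r (k - 1))) := by
  refine ⟨{P | (∃ m n, IsBihomogeneous P m n) ∧
    ∀ z, mulMap d r k z ∈ stratum d r (k - 1) → evalProd z P = 0}, fun P hP => hP.1, ?_⟩
  ext z
  have hz : mulMap d r k z ∈ stratum d r k := (mk_mem_stratum_iff hkd _).2 ⟨_, _, rfl⟩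
  have hev : ∀ (z) (F : MvPolynomial (Fin (r + 1) × Fin (d + 1)) ℂ),
      evalProd z (mulPullback d r k F) = eval (mulCoeff z.1.rep z.2.rep) F :=
    fun z F => eval_mulPullback F _ _
  constructor
  · intro h P hP
    refine hP.2 z ?_
    by_contra h1
    exact h ⟨hz, h1⟩
  · intro h h1
    have h2 : mulCoeff z.1.rep z.2.rep ∉ productCone d r (k - 1) := fun h3 =>
      h1.2 ((mk_mem_stratum_iff (by omega) _).2 h3)
    obtain ⟨n, F, hF, hF0, hFz⟩ := exists_isHomogeneous_separating (by omega) h2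
    refine hFz ?_
    rw [← hev]
    refine h _ ⟨⟨n, n, isBihomogeneous_mulPullback hF⟩, fun z' hz' => ?_⟩
    rw [hev]
    exact hF0 _ ((mk_mem_stratum_iff (by omega) _).1 hz')

theorem isRegularOnProd_mulMap
    (U : Set (PSpace (Fin (r + 1) × Fin k) × PSpace (Fin (d + 2 - k)))) :
    IsRegularOnProd U (mulMap d r k) := by
  intro x _
  refine ⟨Set.univ, ⟨{1}, fun F hF => ⟨0, 0, ?_⟩, ?_⟩, trivial, 1, 1, productPoly d r k,
    isBihomogeneous_productPoly, fun y _ => ?_⟩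
  · rw [Set.mem_singleton_iff.1 hF]
    exact isWeightedHomogeneous_one ℂ _
  · ext z
    simp [evalProd]
  · have h : (fun j => evalProd y (productPoly d r k j)) =
        mulCoeff y.1.rep y.2.rep := by
      funext j
      rw [evalProd, eval_productPoly]
    have hne : (fun j => evalProd y (productPoly d r k j)) ≠ 0 := by
      rw [h]
      exact mulCoeff_ne_zero y.1.rep_nonzero y.2.rep_nonzero
    refine ⟨hne, ?_⟩
    rw [mulMap, Projectivization.mk_eq_mk_iff']
    exact ⟨1, by rw [one_smul, h]⟩

theorem isIsomorphismOn_mulMap (hk : 1 ≤ k) (hkd : k ≤ d + 1) :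
    IsIsomorphismOn (mulMap d r k) (mulMap d r k ⁻¹' (stratum d r k \ stratum d r (k - 1)))
      (stratum d r k \ stratum d r (k - 1)) := by
  have hne : Nonempty (PSpace (Fin (r + 1) × Fin k) × PSpace (Fin (d + 2 - k))) := by
    have h1 : (fun _ : Fin (r + 1) × Fin k => (1 : ℂ)) ≠ 0 := fun h =>
      one_ne_zero (congrFun h (0, ⟨0, hk⟩))
    have h2 : (fun _ : Fin (d + 2 - k) => (1 : ℂ)) ≠ 0 := fun h =>
      one_ne_zero (congrFun h ⟨0, by omega⟩)
    exact ⟨Projectivization.mk ℂ _ h1, Projectivization.mk ℂ _ h2⟩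
  have hbij := mulMap_bijOn (d := d) (r := r) hk hkd
  have hinv := hbij.invOn_invFunOn
  refine ⟨hbij, isRegularOnProd_mulMap _, _, hinv, ?_, ?_⟩
  · refine isRegularOn_of_isLocalFormula fun x hx => ?_
    obtain ⟨H, G, -, h, -⟩ := exists_isLocalFormula hk hkd hinv.2 hx
    exact ⟨H, G, h⟩
  · refine isRegularOn_of_isLocalFormula fun x hx => ?_
    obtain ⟨H, -, P, -, h⟩ := exists_isLocalFormula hk hkd hinv.2 hx
    exact ⟨H, P, h⟩

end Isomorphism

/-! ### Tangent spaces and their semicontinuity -/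

section TangentSpaces

open MvPolynomial

variable {ι : Type} [Fintype ι]

/-- The differential of `F` at `v`, applied to `w`. -/
def differential (F : MvPolynomial ι ℂ) (v w : ι → ℂ) : ℂ :=
  ∑ j, eval v (pderiv j F) * w j

theorem differential_add (F G : MvPolynomial ι ℂ) (v w : ι → ℂ) :
    differential (F + G) v w = differential F v w + differential G v w := by
  simp only [differential, map_add, add_mul, Finset.sum_add_distrib]

theorem differential_sub (F G : MvPolynomial ι ℂ) (v w : ι → ℂ) :
    differential (F - G) v w = differential F v w - differential G v w := by
  simp only [differential, map_sub, sub_mul, Finset.sum_sub_distrib]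

theorem differential_zero (v w : ι → ℂ) : differential (0 : MvPolynomial ι ℂ) v w = 0 := by
  simp [differential]

theorem differential_C (a : ℂ) (v w : ι → ℂ) : differential (C a) v w = 0 := by
  simp [differential]

theorem differential_sum {τ : Type*} (s : Finset τ) (F : τ → MvPolynomial ι ℂ) (v w : ι → ℂ) :
    differential (∑ t ∈ s, F t) v w = ∑ t ∈ s, differential (F t) v w := by
  simp only [differential, map_sum, Finset.sum_mul]
  exact Finset.sum_comm

theorem differential_mul (F G : MvPolynomial ι ℂ) (v w : ι → ℂ) :
    differential (F * G) v w = eval v F * differential G v w + eval v G * differential F v w := by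
  simp only [differential, Derivation.leibniz, smul_eq_mul, map_add, map_mul, add_mul,
    Finset.sum_add_distrib, Finset.mul_sum, mul_assoc]

theorem differential_X (i : ι) (v w : ι → ℂ) : differential (X i) v w = w i := by
  classical
  rw [differential, Finset.sum_eq_single i]
  · simp
  · intro j _ hj
    rw [pderiv_X_of_ne hj.symm, map_zero, zero_mul]
  · simp

theorem hasDerivAt_eval (F : MvPolynomial ι ℂ) {γ : ℂ → ι → ℂ} {w : ι → ℂ} {t : ℂ}
    (h : ∀ j, HasDerivAt (fun s => γ s j) (w j) t) :
    HasDerivAt (fun s => eval (γ s) F) (differential F (γ t) w) t := by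
  induction F using MvPolynomial.induction_on with
  | C a =>
    simp only [eval_C, differential_C]
    exact hasDerivAt_const t a
  | add p q hp hq =>
    simp only [map_add, differential_add]
    exact hp.add hq
  | mul_X p i hp =>
    simp only [map_mul, eval_X, differential_mul, differential_X]
    exact (hp.fun_mul (h i)).congr_deriv (by ring)

/-- The tangent space at `v` of the affine scheme defined by `I`. -/
def tangentSpaceAt (I : Ideal (MvPolynomial ι ℂ)) (v : ι → ℂ) : Submodule ℂ (ι → ℂ) where
  carrier := {w | ∀ F ∈ I, differential F v w = 0}
  add_mem' := by
    intro a b ha hb F hF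
    have h1 := ha F hF
    have h2 := hb F hF
    simp only [differential, Pi.add_apply, mul_add, Finset.sum_add_distrib] at h1 h2 ⊢
    rw [h1, h2, add_zero]
  zero_mem' := by
    intro F _
    simp [differential]
  smul_mem' := by
    intro c w hw F hF
    have h : differential F v (c • w) = c * differential F v w := by
      simp only [differential, Finset.mul_sum, Pi.smul_apply, smul_eq_mul]
      exact Finset.sum_congr rfl fun _ _ => by ring
    rw [h, hw F hF, mul_zero]

theorem coneTangentSpace_eq (X : Set (PSpace ι)) (x : PSpace ι) :
    coneTangentSpace X x = tangentSpaceAt (vanishingIdeal X) x.rep :=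
  rfl

/-- Linear independence is an open condition: a maximal minor that does not vanish at `t₀` is a
nonzero polynomial in `t`. -/
theorem finite_setOf_not_linearIndependent {τ : Type} [Fintype τ] (u : τ → ι → Polynomial ℂ)
    {t₀ : ℂ} (h : LinearIndependent ℂ fun i j => (u i j).eval t₀) :
    {t : ℂ | ¬ LinearIndependent ℂ fun i j => (u i j).eval t}.Finite := by
  set M : Matrix τ ι (Polynomial ℂ) := Matrix.of u with hM
  have hMt : ∀ t, (M.map (Polynomial.evalRingHom t)) = Matrix.of fun i j => (u i j).eval t := by
    intro t
    rfl
  have hrank : Fintype.card τ ≤ (M.map (Polynomial.evalRingHom t₀)).rank := by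
    rw [hMt]
    exact (LinearIndependent.rank_matrix (M := Matrix.of fun i j => (u i j).eval t₀) h).ge
  obtain ⟨e, c, hdet⟩ := exists_submatrix_det_ne_zero _ hrank
  set D := (M.submatrix e c).det with hD
  have hDt : ∀ t, D.eval t = ((M.map (Polynomial.evalRingHom t)).submatrix e c).det := by
    intro t
    rw [← Polynomial.coe_evalRingHom, hD, RingHom.map_det]
    rfl
  have hD0 : D ≠ 0 := by
    intro h0
    rw [← hDt, h0, Polynomial.eval_zero] at hdet
    exact hdet rfl
  refine (D.roots.toFinset.finite_toSet).subset fun t ht => ?_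
  rw [Finset.mem_coe, Multiset.mem_toFinset, Polynomial.mem_roots hD0, Polynomial.IsRoot]
  by_contra hne
  apply ht
  rw [hDt, hMt] at hne
  have h1 := Matrix.linearIndependent_rows_iff_isUnit.2
    ((Matrix.isUnit_iff_isUnit_det _).2 (isUnit_iff_ne_zero.2 hne))
  have h2 : LinearIndependent ℂ ((fun i j => (u i j).eval t) ∘ e) := by
    apply LinearIndependent.of_comp (LinearMap.funLeft ℂ ℂ c)
    exact h1
  have hbij : Function.Bijective e :=
    (Fintype.bijective_iff_injective_and_card e).2 ⟨e.injective, Fintype.card_fin _⟩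
  exact (linearIndependent_equiv (Equiv.ofBijective e hbij)).1 h2

theorem eval_eval_polynomial {ι : Type} (Γ : ι → Polynomial ℂ) (F : MvPolynomial ι ℂ) (t : ℂ) :
    eval (fun j => (Γ j).eval t) F = (aeval Γ F).eval t := by
  induction F using MvPolynomial.induction_on with
  | C a => simp
  | add p q hp hq => simp only [map_add, hp, hq, Polynomial.eval_add]
  | mul_X p i hp => simp only [map_mul, hp, aeval_X, eval_X, Polynomial.eval_mul]

/-- Upper semicontinuity of the dimension of the tangent space along a polynomial curve: gradients
that are linearly independent at one point of the curve are so at all but finitely many points. -/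
theorem finite_setOf_finrank_tangentSpaceAt_lt (I : Ideal (MvPolynomial ι ℂ))
    (Γ : ι → Polynomial ℂ) (t₀ : ℂ) :
    {t : ℂ | Module.finrank ℂ (tangentSpaceAt I fun j => (Γ j).eval t₀) <
      Module.finrank ℂ (tangentSpaceAt I fun j => (Γ j).eval t)}.Finite := by
  set grad : ℂ → MvPolynomial ι ℂ → ι → ℂ := fun t F j =>
    eval (fun j => (Γ j).eval t) (pderiv j F) with hgrad
  obtain ⟨b, hbI, hspan, hli⟩ := exists_linearIndependent ℂ (grad t₀ '' I)
  have hbfin : Finite b := hli.finite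
  have : Fintype b := Fintype.ofFinite b
  have hb' : ∀ x : b, ∃ F, F ∈ I ∧ grad t₀ F = x := fun x => hbI x.2
  choose F hFI hF using hb'
  set u : b → ι → Polynomial ℂ := fun x j => aeval Γ (pderiv j (F x)) with hu
  have hut : ∀ t, (fun x j => (u x j).eval t) = fun x => grad t (F x) := by
    intro t
    funext x j
    rw [hu, hgrad]
    exact (eval_eval_polynomial _ _ _).symm
  have hker : ∀ t, LinearIndependent ℂ (fun x => grad t (F x)) →
      Module.finrank ℂ (LinearMap.ker (Matrix.of fun x => grad t (F x)).mulVecLin) +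
        Fintype.card b = Fintype.card ι := by
    intro t ht
    have h1 := LinearMap.finrank_range_add_finrank_ker
      (Matrix.of fun x => grad t (F x)).mulVecLin
    rw [Module.finrank_fintype_fun_eq_card] at h1
    have h2 : (Matrix.of fun x => grad t (F x)).rank = Fintype.card b :=
      LinearIndependent.rank_matrix (M := Matrix.of fun x => grad t (F x)) ht
    rw [Matrix.rank] at h2
    omega
  have hli₀ : LinearIndependent ℂ fun x => grad t₀ (F x) := by
    simp only [hF]
    exact hli
  have hle : ∀ t, tangentSpaceAt I (fun j => (Γ j).eval t) ≤
      LinearMap.ker (Matrix.of fun x => grad t (F x)).mulVecLin := by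
    intro t w hw
    rw [LinearMap.mem_ker]
    funext x
    exact hw (F x) (hFI x)
  have hge : LinearMap.ker (Matrix.of fun x => grad t₀ (F x)).mulVecLin ≤
      tangentSpaceAt I (fun j => (Γ j).eval t₀) := by
    intro w hw G hG
    have h1 : grad t₀ G ∈ Submodule.span ℂ b := by
      rw [hspan]
      exact Submodule.subset_span ⟨G, hG, rfl⟩
    have h2 : ∀ g ∈ Submodule.span ℂ b, ∑ j, g j * w j = 0 := by
      intro g hg
      induction hg using Submodule.span_induction with
      | mem g hg =>
        have h3 := congrFun hw (⟨g, hg⟩ : b)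
        change ∑ j, grad t₀ (F ⟨g, hg⟩) j * w j = 0 at h3
        rwa [hF ⟨g, hg⟩] at h3
      | zero => simp
      | add g g' _ _ h h' =>
        simp only [Pi.add_apply, add_mul, Finset.sum_add_distrib, h, h', add_zero]
      | smul a g _ h =>
        simp only [Pi.smul_apply, smul_eq_mul, mul_assoc, ← Finset.mul_sum, h, mul_zero]
    exact h2 _ h1
  refine (finite_setOf_not_linearIndependent u (t₀ := t₀) (by rw [hut]; exact hli₀)).subset
    fun t ht hlit => ?_
  rw [hut] at hlit
  have h1 := hker t hlit
  have h2 := hker t₀ hli₀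
  have h3 := Submodule.finrank_mono (hle t)
  have h4 := Submodule.finrank_mono hge
  rw [Set.mem_ofPred_eq] at ht
  omega

end TangentSpaces

/-! ### The differential of the multiplication map -/

section TangentSpacesOfStrata

open MvPolynomial

variable {d r k : ℕ}

/-- The differential of the multiplication of forms at `(μ, ν)`. -/
def mulDifferential (μ : Fin (r + 1) × Fin k → ℂ) (ν : Fin (d + 2 - k) → ℂ) :
    ((Fin (r + 1) × Fin k → ℂ) × (Fin (d + 2 - k) → ℂ)) →ₗ[ℂ] (Fin (r + 1) × Fin (d + 1) → ℂ) where
  toFun w := mulCoeff w.1 ν + mulCoeff μ w.2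
  map_add' w w' := by
    rw [Prod.fst_add, Prod.snd_add, mulCoeff_add_left, mulCoeff_add_right]
    abel
  map_smul' a w := by
    rw [Prod.smul_fst, Prod.smul_snd, mulCoeff_smul_left, mulCoeff_smul_right, RingHom.id_apply,
      smul_add]

theorem mulDifferential_apply (μ : Fin (r + 1) × Fin k → ℂ) (ν : Fin (d + 2 - k) → ℂ) (w) :
    mulDifferential (d := d) μ ν w = mulCoeff w.1 ν + mulCoeff μ w.2 :=
  rfl

/-- The kernel is spanned by `(μ, -ν)`, the direction of the rescalings `(c * μ, c⁻¹ * ν)`. -/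
theorem finrank_range_mulDifferential (hkd : k ≤ d + 1) {μ : Fin (r + 1) × Fin k → ℂ}
    {ν : Fin (d + 2 - k) → ℂ} (hμ : IsPrimitive μ) (hν : ν ≠ 0) :
    Module.finrank ℂ (LinearMap.range (mulDifferential (d := d) μ ν)) + 1 =
      (r + 1) * k + (d + 2 - k) := by
  have h1 := LinearMap.finrank_range_add_finrank_ker (mulDifferential (d := d) μ ν)
  have h2 : LinearMap.ker (mulDifferential (d := d) μ ν) = Submodule.span ℂ {(μ, -ν)} := by
    ext w
    rw [LinearMap.mem_ker, mulDifferential_apply, Submodule.mem_span_singleton]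
    constructor
    · intro hw
      have hp : ∀ i, tuplePoly w.1 i * Polynomial.ofFn _ ν +
          tuplePoly μ i * Polynomial.ofFn _ w.2 = 0 := by
        intro i
        rw [← tuplePoly_mulCoeff (by omega), ← tuplePoly_mulCoeff (by omega), ← tuplePoly_add, hw]
        exact map_zero (Polynomial.ofFn (d + 1))
      have hν' : Polynomial.ofFn _ ν ≠ 0 := fun h0 => hν (ofFn_eq_zero_iff.1 h0)
      obtain ⟨c, hc⟩ := hμ.exists_smul (w := w.1) fun i j => by
        apply mul_right_cancel₀ hν'
        linear_combination tuplePoly μ j * hp i - tuplePoly μ i * hp j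
      refine ⟨c, Prod.ext hc.symm ?_⟩
      rw [hc, mulCoeff_smul_left, ← mulCoeff_smul_right, ← mulCoeff_add_right] at hw
      have h3 := mulCoeff_eq_zero_right hμ.ne_zero hw
      rw [Prod.smul_snd, smul_neg]
      exact neg_eq_of_add_eq_zero_right h3
    · rintro ⟨c, rfl⟩
      rw [Prod.smul_fst, Prod.smul_snd, mulCoeff_smul_left, mulCoeff_smul_right]
      have : mulCoeff (d := d) μ (-ν) = -mulCoeff μ ν := by
        rw [← neg_one_smul ℂ ν, mulCoeff_smul_right, neg_one_smul]
      rw [this, smul_neg, add_neg_cancel]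
  have h3 : (μ, -ν) ≠ 0 := fun h0 => hμ.ne_zero (congrArg Prod.fst h0)
  rw [h2, finrank_span_singleton h3, Module.finrank_prod, Module.finrank_fintype_fun_eq_card,
    Module.finrank_fintype_fun_eq_card, Fintype.card_prod, Fintype.card_fin, Fintype.card_fin,
    Fintype.card_fin] at h1
  exact h1

theorem range_mulDifferential_le (hk : 1 ≤ k) (hkd : k ≤ d + 1) (μ : Fin (r + 1) × Fin k → ℂ)
    (ν : Fin (d + 2 - k) → ℂ) : LinearMap.range (mulDifferential μ ν) ≤
      tangentSpaceAt (vanishingIdeal (stratum d r k)) (mulCoeff μ ν) := by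
  rintro _ ⟨w, rfl⟩ F hF
  rw [vanishingIdeal_stratum hk hkd, RingHom.mem_ker] at hF
  -- `F` vanishes on the curve `s ↦ (μ + s * w.1) * (ν + s * w.2)`
  have hγ : ∀ s : ℂ, mulCoeff (d := d) (μ + s • w.1) (ν + s • w.2) =
      mulCoeff μ ν + s • mulDifferential μ ν w + (s * s) • mulCoeff w.1 w.2 := by
    intro s
    rw [mulDifferential_apply, mulCoeff_add_left, mulCoeff_add_right, mulCoeff_add_right,
      mulCoeff_smul_left, mulCoeff_smul_left, mulCoeff_smul_right, mulCoeff_smul_right, smul_smul,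
      smul_add]
    abel
  have h1 := hasDerivAt_eval F (γ := fun s => mulCoeff (d := d) (μ + s • w.1) (ν + s • w.2))
    (w := mulDifferential μ ν w) (t := 0) (fun j => by
      simp only [hγ, Pi.add_apply, Pi.smul_apply, smul_eq_mul]
      have h2 := ((hasDerivAt_id (0 : ℂ)).mul_const (mulDifferential (d := d) μ ν w j)).const_add
        (mulCoeff (d := d) μ ν j)
      have h3 := ((hasDerivAt_id (0 : ℂ)).mul (hasDerivAt_id (0 : ℂ))).mul_const
        (mulCoeff (d := d) w.1 w.2 j)
      exact (h2.fun_add h3).congr_deriv (by simp))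
  have h4 : (fun s : ℂ => eval (mulCoeff (d := d) (μ + s • w.1) (ν + s • w.2)) F) =
      fun _ => 0 := by
    funext s
    rw [← eval_mulPullback, hF, map_zero]
  rw [h4] at h1
  have h5 := h1.unique (hasDerivAt_const (0 : ℂ) (0 : ℂ))
  simpa using h5

end TangentSpacesOfStrata

/-! ### Tangent spaces outside `R_{k-1}` -/

section SmoothPoints

open MvPolynomial

variable {d r k : ℕ}

theorem eval_aeval_productPoly
    (G : Fin (r + 1) × Fin k → MvPolynomial (Fin (r + 1) × Fin (d + 1)) ℂ)
    (P : Fin (d + 2 - k) → MvPolynomial (Fin (r + 1) × Fin (d + 1)) ℂ)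
    (v : Fin (r + 1) × Fin (d + 1) → ℂ) (j : Fin (r + 1) × Fin (d + 1)) :
    eval v (aeval (Sum.elim G P) (productPoly d r k j)) =
      mulCoeff (fun a => eval v (G a)) (fun b => eval v (P b)) j := by
  rw [eval_aeval, ← eval_productPoly]
  congr 2
  funext i
  rcases i with a | b <;> rfl

theorem differential_aeval_productPoly
    (G : Fin (r + 1) × Fin k → MvPolynomial (Fin (r + 1) × Fin (d + 1)) ℂ)
    (P : Fin (d + 2 - k) → MvPolynomial (Fin (r + 1) × Fin (d + 1)) ℂ)
    (v w : Fin (r + 1) × Fin (d + 1) → ℂ) (j : Fin (r + 1) × Fin (d + 1)) :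
    differential (aeval (Sum.elim G P) (productPoly d r k j)) v w =
      mulDifferential (fun a => eval v (G a)) (fun b => eval v (P b))
        (fun a => differential (G a) v w, fun b => differential (P b) v w) j := by
  simp only [productPoly, map_sum, differential_sum, mulDifferential_apply, Pi.add_apply, mulCoeff,
    ← Finset.sum_add_distrib]
  refine Finset.sum_congr rfl fun a _ => Finset.sum_congr rfl fun b _ => ?_
  split_ifs
  · rw [map_mul, aeval_X, aeval_X, Sum.elim_inl, Sum.elim_inr, differential_mul]
    ring
  · rw [map_zero, differential_zero, add_zero]

theorem isHomogeneous_aeval_productPoly {m n : ℕ}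
    {G : Fin (r + 1) × Fin k → MvPolynomial (Fin (r + 1) × Fin (d + 1)) ℂ}
    {P : Fin (d + 2 - k) → MvPolynomial (Fin (r + 1) × Fin (d + 1)) ℂ}
    (hG : ∀ a, (G a).IsHomogeneous m) (hP : ∀ b, (P b).IsHomogeneous n)
    (j : Fin (r + 1) × Fin (d + 1)) :
    (aeval (Sum.elim G P) (productPoly d r k j)).IsHomogeneous (m + n) := by
  simp only [productPoly, map_sum]
  refine IsHomogeneous.sum _ _ _ fun a _ => IsHomogeneous.sum _ _ _ fun b _ => ?_
  split_ifs
  · rw [map_mul, aeval_X, aeval_X, Sum.elim_inl, Sum.elim_inr]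
    exact (hG _).mul (hP _)
  · rw [map_zero]
    exact isHomogeneous_zero _ _ _

/-- Near a point of `R_k \ R_{k-1}`, let `G` and `P` be polynomial formulas for the two factors of a
tuple `f`. Then `G f * P f` is proportional to `f` on `R_k`, and differentiating this relation at
the point shows that each tangent vector is in the image of the differential of the multiplication. -/
theorem tangentSpaceAt_le_range (hk : 1 ≤ k) (hkd : k ≤ d + 1) {x : TupleSpace d r}
    (hx : x ∈ stratum d r k \ stratum d r (k - 1)) :
    ∃ (c : ℂ) (μ : Fin (r + 1) × Fin k → ℂ) (ν : Fin (d + 2 - k) → ℂ), c ≠ 0 ∧ IsPrimitive μ ∧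
      ν ≠ 0 ∧ mulCoeff μ ν = c • x.rep ∧
      tangentSpaceAt (vanishingIdeal (stratum d r k)) x.rep ≤
        LinearMap.range (mulDifferential (d := d) μ ν) := by
  obtain ⟨-, -, ψ, hinv, -, -⟩ := isIsomorphismOn_mulMap (d := d) (r := r) hk hkd
  have hψ := hinv.2
  obtain ⟨H, G, P, hG, hP⟩ := exists_isLocalFormula hk hkd hψ hx
  obtain ⟨nH, hH⟩ := hG.isHomogeneous_denom
  obtain ⟨nG, hGn⟩ := hG.isHomogeneous
  obtain ⟨nP, hPn⟩ := hP.isHomogeneous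
  have hx1 : x.rep ∉ productCone d r (k - 1) := fun h =>
    hx.2 ((mem_stratum_iff (by omega) x).2 h)
  obtain ⟨nS, S, hS, hS0, hSx⟩ := exists_isHomogeneous_separating (by omega) hx1
  -- proportionality of the product to the tuple, at all points where the formulas are valid
  have hprop : ∀ y ∈ stratum d r k \ stratum d r (k - 1), eval y.rep H ≠ 0 →
      ∃ c : ℂ, c ≠ 0 ∧
        mulCoeff (fun a => eval y.rep (G a)) (fun b => eval y.rep (P b)) = c • y.rep := by
    intro y hy hyH
    obtain ⟨a, ha, hya⟩ := hG.eq_smul y hy hyH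
    obtain ⟨b, hb, hyb⟩ := hP.eq_smul y hy hyH
    obtain ⟨c, hc, hyc⟩ := exists_rep_eq_of_rightInvOn hψ hy
    refine ⟨a * b * c⁻¹, mul_ne_zero (mul_ne_zero ha hb) (inv_ne_zero hc), ?_⟩
    rw [hya, hyb, mulCoeff_smul_left, mulCoeff_smul_right, smul_smul]
    conv_rhs => rw [hyc, smul_smul, mul_assoc, inv_mul_cancel₀ hc, mul_one]
  set Pr : Fin (r + 1) × Fin (d + 1) → MvPolynomial (Fin (r + 1) × Fin (d + 1)) ℂ :=
    fun j => aeval (Sum.elim G P) (productPoly d r k j) with hPr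
  have hE : ∀ j l, H * S * (Pr j * X l - Pr l * X j) ∈ vanishingIdeal (stratum d r k) := by
    intro j l
    refine Ideal.subset_span ⟨⟨_, (hH.mul hS).mul (IsHomogeneous.sub
      ((isHomogeneous_aeval_productPoly hGn hPn j).mul (isHomogeneous_X _ _))
      ((isHomogeneous_aeval_productPoly hGn hPn l).mul (isHomogeneous_X _ _)))⟩, fun y hy => ?_⟩
    rw [VanishesAt, map_mul, map_mul]
    by_cases hy1 : y ∈ stratum d r (k - 1)
    · rw [hS0 _ ((mem_stratum_iff (by omega) y).1 hy1), mul_zero, zero_mul]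
    by_cases hyH : eval y.rep H = 0
    · rw [hyH, zero_mul, zero_mul]
    obtain ⟨c, -, hc⟩ := hprop y ⟨hy, hy1⟩ hyH
    simp only [map_sub, map_mul, eval_X, hPr, eval_aeval_productPoly, hc, Pi.smul_apply,
      smul_eq_mul]
    ring
  obtain ⟨c, hc, hxc⟩ := hprop x hx hG.denom_ne_zero
  obtain ⟨a, ha, hxa⟩ := hG.eq_smul x hx hG.denom_ne_zero
  obtain ⟨b, hb, hxb⟩ := hP.eq_smul x hx hG.denom_ne_zero
  refine ⟨c, fun a => eval x.rep (G a), fun b => eval x.rep (P b), hc, ?_, ?_, hxc, ?_⟩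
  · rw [hxa]
    exact isPrimitive_smul (isPrimitive_of_rightInvOn hk hkd hψ hx) ha
  · rw [hxb]
    exact smul_ne_zero hb (ψ x).2.rep_nonzero
  set μ : Fin (r + 1) × Fin k → ℂ := fun a => eval x.rep (G a) with hμ
  set ν : Fin (d + 2 - k) → ℂ := fun b => eval x.rep (P b) with hν
  intro w hw
  set D := mulDifferential (d := d) μ ν
    (fun a => differential (G a) x.rep w, fun b => differential (P b) x.rep w) with hD
  have hrel : ∀ j l, c * (x.rep j * w l) + x.rep l * D j - (c * (x.rep l * w j) + x.rep j * D l) =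
      0 := by
    intro j l
    have h1 := hw _ (hE j l)
    have h2 : ∀ j, eval x.rep (Pr j) = c * x.rep j := fun j => by
      rw [hPr, eval_aeval_productPoly, hxc, Pi.smul_apply, smul_eq_mul]
    have h3 : ∀ j, differential (Pr j) x.rep w = D j := fun j =>
      differential_aeval_productPoly G P x.rep w j
    have h4 : eval x.rep (Pr j * X l - Pr l * X j) = 0 := by
      rw [map_sub, map_mul, map_mul, h2, h2, eval_X, eval_X]
      ring
    rw [differential_mul, h4, zero_mul, add_zero, map_mul] at h1
    have h5 := (mul_eq_zero.1 h1).resolve_left (mul_ne_zero hG.denom_ne_zero hSx)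
    rw [differential_sub, differential_mul, differential_mul, h2, h2, h3, h3, eval_X, eval_X,
      differential_X, differential_X] at h5
    linear_combination h5
  obtain ⟨l, hl⟩ := Function.ne_iff.1 x.rep_nonzero
  simp only [Pi.zero_apply] at hl
  -- `w` is a combination of `D` and of the radial direction `x.rep`
  have hw' : w = c⁻¹ • D + (c⁻¹ * ((c * w l - D l) / x.rep l)) • x.rep := by
    funext j
    simp only [Pi.add_apply, Pi.smul_apply, smul_eq_mul]
    field_simp
    linear_combination hrel l j
  have hrad : x.rep = mulDifferential (d := d) μ ν (c⁻¹ • μ, 0) := by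
    rw [mulDifferential_apply, mulCoeff_smul_left, hxc, smul_smul, inv_mul_cancel₀ hc, one_smul]
    have := mulCoeff_smul_right (d := d) (0 : ℂ) μ (0 : Fin (d + 2 - k) → ℂ)
    rw [zero_smul, zero_smul] at this
    rw [this, add_zero]
  rw [hw']
  refine Submodule.add_mem _ (Submodule.smul_mem _ _ ⟨_, rfl⟩) (Submodule.smul_mem _ _ ?_)
  exact ⟨_, hrad.symm⟩

/-- At a point of `R_k \ R_{k-1}` the tangent space of the cone over `R_k` has the dimension of the
source of the multiplication map, `(r + 1) * k + (d + 2 - k)`, minus one. -/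
theorem finrank_tangentSpaceAt (hk : 1 ≤ k) (hkd : k ≤ d + 1) {x : TupleSpace d r}
    (hx : x ∈ stratum d r k \ stratum d r (k - 1)) :
    Module.finrank ℂ (tangentSpaceAt (vanishingIdeal (stratum d r k)) x.rep) + 1 =
      (r + 1) * k + (d + 2 - k) := by
  obtain ⟨c, μ, ν, hc, hμ, hν, hx', hle⟩ := tangentSpaceAt_le_range hk hkd hx
  have h1 := Submodule.finrank_mono hle
  have h2 := finrank_range_mulDifferential hkd hμ hν
  have h3 := finrank_range_mulDifferential hkd (isPrimitive_smul hμ (inv_ne_zero hc)) hν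
  have h4 := range_mulDifferential_le hk hkd (c⁻¹ • μ) ν
  rw [mulCoeff_smul_left, hx', smul_smul, inv_mul_cancel₀ hc, one_smul] at h4
  have h5 := Submodule.finrank_mono h4
  omega

end SmoothPoints

/-! ### Krull dimension and transcendence degree -/

section KrullDimension

open MvPolynomial

/-- Chains of primes lift by going up, and contract to strict chains by incomparability. -/
theorem ringKrullDim_eq_of_isIntegral {R S : Type} [CommRing R] [CommRing S] [IsDomain S]
    [Algebra R S] [Algebra.IsIntegral R S] (h : Function.Injective (algebraMap R S)) :
    ringKrullDim R = ringKrullDim S := by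
  refine le_antisymm ?_ ?_
  · rw [ringKrullDim, Order.krullDim]
    refine iSup_le fun l => ?_
    obtain ⟨P, hP, hPl⟩ := Ideal.exists_ideal_over_prime_of_isIntegral_of_isDomain
      (S := S) (l.head).asIdeal (by rw [(RingHom.injective_iff_ker_eq_bot _).1 h]; exact bot_le)
    have : P.LiesOver (RelSeries.head l).asIdeal := ⟨hPl.symm⟩
    obtain ⟨L, hL, -, -⟩ := Ideal.exists_ltSeries_of_hasGoingUp l P
    rw [← hL]
    exact le_iSup (fun p : LTSeries (PrimeSpectrum S) => ((p.length : ℕ∞) : WithBot ℕ∞)) L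
  · exact Order.krullDim_le_of_strictMono (PrimeSpectrum.comap (algebraMap R S)) fun I J hIJ =>
      Ideal.IsIntegral.comap_lt_comap hIJ

/-- By Noether normalization, the Krull dimension of an affine domain is its transcendence
degree. -/
theorem ringKrullDim_eq_of_trdeg {A : Type} [CommRing A] [IsDomain A] [Algebra ℂ A]
    [Algebra.FiniteType ℂ A] {n : ℕ} (h : Algebra.trdeg ℂ A = n) : ringKrullDim A = n := by
  obtain ⟨s, g, hg, hint⟩ := exists_integral_inj_algHom_of_fg ℂ A
  let _ := g.toRingHom.toAlgebra
  have htower : IsScalarTower ℂ (MvPolynomial (Fin s) ℂ) A :=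
    IsScalarTower.of_algebraMap_eq fun x => (g.commutes x).symm
  have : Algebra.IsIntegral (MvPolynomial (Fin s) ℂ) A := ⟨hint⟩
  have : FaithfulSMul (MvPolynomial (Fin s) ℂ) A :=
    (faithfulSMul_iff_algebraMap_injective _ _).2 hg
  have h1 := trdeg_add_eq ℂ (MvPolynomial (Fin s) ℂ) (A := A)
  rw [trdeg_eq_zero (R := MvPolynomial (Fin s) ℂ), MvPolynomial.trdeg_of_isDomain, h, add_zero,
    Cardinal.lift_id, Cardinal.mk_fin, Nat.cast_inj] at h1
  rw [← ringKrullDim_eq_of_isIntegral (R := MvPolynomial (Fin s) ℂ) (S := A) hg,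
    MvPolynomial.ringKrullDim_of_isNoetherianRing, ringKrullDim_eq_zero_of_field, zero_add,
    Nat.card_fin, h1]

/-- A polynomial map whose source coordinates are rational functions of the target coordinates is
birational onto its image, whence the dimension of the image. -/
theorem ringKrullDim_quotient_ker {σ τ : Type} [Finite σ] [Fintype τ]
    (ρ : MvPolynomial σ ℂ →ₐ[ℂ] MvPolynomial τ ℂ)
    (h : ∀ t, ∃ F₁ F₂, ρ F₁ ≠ 0 ∧ X t * ρ F₁ = ρ F₂) :
    ringKrullDim (MvPolynomial σ ℂ ⧸ RingHom.ker ρ) = Fintype.card τ := by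
  have hX : ∀ t, IsAlgebraic ρ.range (X t : MvPolynomial τ ℂ) := by
    intro t
    obtain ⟨F₁, F₂, hF₁, hF⟩ := h t
    refine ⟨Polynomial.C ⟨ρ F₁, F₁, rfl⟩ * Polynomial.X - Polynomial.C ⟨ρ F₂, F₂, rfl⟩, ?_, ?_⟩
    · intro h0
      have h1 := congrArg (fun p => Polynomial.coeff p 1) h0
      simp only [Polynomial.coeff_sub, Polynomial.coeff_C_mul, Polynomial.coeff_X_one, mul_one,
        Polynomial.coeff_C_succ, sub_zero, Polynomial.coeff_zero] at h1
      exact hF₁ (congrArg Subtype.val h1)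
    · simp only [map_sub, map_mul, Polynomial.aeval_C, Polynomial.aeval_X]
      change ρ F₁ * X t - ρ F₂ = 0
      rw [mul_comm, hF, sub_self]
  have halg : Algebra.IsAlgebraic ρ.range (MvPolynomial τ ℂ) := by
    refine ⟨fun F => ?_⟩
    induction F using MvPolynomial.induction_on with
    | C a => exact isAlgebraic_algebraMap (algebraMap ℂ ρ.range a)
    | add p q hp hq => exact hp.add hq
    | mul_X p i hp => exact hp.mul (hX i)
  have : FaithfulSMul ℂ ρ.range :=
    (faithfulSMul_iff_algebraMap_injective _ _).2 (algebraMap ℂ ρ.range).injective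
  have h1 := trdeg_add_eq ℂ ρ.range (A := MvPolynomial τ ℂ)
  rw [trdeg_eq_zero (R := ρ.range), MvPolynomial.trdeg_of_isDomain, add_zero, Cardinal.lift_id,
    Cardinal.mk_fintype] at h1
  have : Algebra.FiniteType ℂ ρ.range :=
    Algebra.FiniteType.of_surjective ρ.rangeRestrict ρ.rangeRestrict_surjective
  have h2 : ringKrullDim ρ.range = Fintype.card τ := ringKrullDim_eq_of_trdeg h1
  exact (ringKrullDim_eq_of_ringEquiv (RingHom.quotientKerEquivRange ρ.toRingHom)).trans h2

end KrullDimension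

/-! ### The dimension of the strata -/

section DimensionOfStrata

open MvPolynomial

variable {d r k : ℕ}

/-- Local formulas for the two factors recover, up to scalars, any factorization with primitive
first factor. -/
theorem exists_smul_of_isLocalFormula (hk : 1 ≤ k) (hkd : k ≤ d + 1)
    {ψ : TupleSpace d r → PSpace (Fin (r + 1) × Fin k) × PSpace (Fin (d + 2 - k))}
    (hψ : Set.RightInvOn ψ (mulMap d r k) (stratum d r k \ stratum d r (k - 1)))
    {x : TupleSpace d r} {H : MvPolynomial (Fin (r + 1) × Fin (d + 1)) ℂ}
    {G : Fin (r + 1) × Fin k → MvPolynomial (Fin (r + 1) × Fin (d + 1)) ℂ}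
    {P : Fin (d + 2 - k) → MvPolynomial (Fin (r + 1) × Fin (d + 1)) ℂ}
    (hG : IsLocalFormula (stratum d r k \ stratum d r (k - 1)) (fun y => (ψ y).1) x H G)
    (hP : IsLocalFormula (stratum d r k \ stratum d r (k - 1)) (fun y => (ψ y).2) x H P)
    {μ : Fin (r + 1) × Fin k → ℂ} {ν : Fin (d + 2 - k) → ℂ} (hμ : IsPrimitive μ) (hν : ν ≠ 0)
    (hH : eval (mulCoeff μ ν) H ≠ 0) :
    ∃ α β : ℂ, α ≠ 0 ∧ β ≠ 0 ∧ (fun a => eval (mulCoeff μ ν) (G a)) = α • μ ∧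
      (fun b => eval (mulCoeff μ ν) (P b)) = β • ν := by
  obtain ⟨nH, hHn⟩ := hG.isHomogeneous_denom
  obtain ⟨nG, hGn⟩ := hG.isHomogeneous
  obtain ⟨nP, hPn⟩ := hP.isHomogeneous
  have h0 := mulCoeff_ne_zero (d := d) hμ.ne_zero hν
  set y : TupleSpace d r := Projectivization.mk ℂ _ h0 with hy
  obtain ⟨t, ht, hyt⟩ := exists_rep_eq_smul h0
  have hyV : y ∈ stratum d r k \ stratum d r (k - 1) :=
    ⟨(mk_mem_stratum_iff hkd h0).2 ⟨μ, ν, rfl⟩, fun h =>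
      notMem_productCone_of_isPrimitive hkd hμ hν (by omega)
        ((mk_mem_stratum_iff (by omega) h0).1 h)⟩
  have hyH : eval y.rep H ≠ 0 := by
    rw [hyt, eval_smul_of_isHomogeneous hHn]
    exact mul_ne_zero (pow_ne_zero _ ht) hH
  obtain ⟨a, ha, hya⟩ := hG.eq_smul y hyV hyH
  obtain ⟨b, hb, hyb⟩ := hP.eq_smul y hyV hyH
  obtain ⟨c, hc, hyc⟩ := exists_rep_eq_of_rightInvOn hψ hyV
  have h1 : mulCoeff (d := d) (c • (ψ y).1.rep) (ψ y).2.rep = mulCoeff (t • μ) ν := by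
    rw [mulCoeff_smul_left, mulCoeff_smul_left, ← hyc, ← hyt]
  obtain ⟨e, he⟩ := IsPrimitive.eq_smul_of_mulCoeff_eq hkd (isPrimitive_smul hμ ht) hν h1
    (ψ y).2.rep_nonzero
  have he0 : e ≠ 0 := by
    rintro rfl
    rw [zero_smul] at he
    exact smul_ne_zero hc (ψ y).1.rep_nonzero he
  rw [he, mulCoeff_smul_left, ← mulCoeff_smul_right] at h1
  have h2 := mulCoeff_right_eq (isPrimitive_smul hμ ht).ne_zero h1
  have h3 : (ψ y).1.rep = (c⁻¹ * e * t) • μ := by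
    rw [mul_assoc, mul_smul, mul_smul, ← he, smul_smul, inv_mul_cancel₀ hc, one_smul]
  have h4 : (ψ y).2.rep = e⁻¹ • ν := by
    rw [← h2, smul_smul, inv_mul_cancel₀ he0, one_smul]
  refine ⟨(t ^ nG)⁻¹ * (a * (c⁻¹ * e * t)), (t ^ nP)⁻¹ * (b * e⁻¹), ?_, ?_, ?_, ?_⟩
  · exact mul_ne_zero (inv_ne_zero (pow_ne_zero _ ht)) (mul_ne_zero ha
      (mul_ne_zero (mul_ne_zero (inv_ne_zero hc) he0) ht))
  · exact mul_ne_zero (inv_ne_zero (pow_ne_zero _ ht)) (mul_ne_zero hb (inv_ne_zero he0))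
  · rw [mul_smul, mul_smul, ← h3, ← hya]
    funext i
    rw [Pi.smul_apply, smul_eq_mul, hyt, eval_smul_of_isHomogeneous (hGn i),
      inv_mul_cancel_left₀ (pow_ne_zero _ ht)]
  · rw [mul_smul, mul_smul, ← h4, ← hyb]
    funext i
    rw [Pi.smul_apply, smul_eq_mul, hyt, eval_smul_of_isHomogeneous (hPn i),
      inv_mul_cancel_left₀ (pow_ne_zero _ ht)]

/-- The coefficients of the second factor in the chart where its coefficient with index `b₀` is
`1`. -/
def extendOne {n : ℕ} (b₀ : Fin n) (z : {b // b ≠ b₀} → ℂ) (b : Fin n) : ℂ :=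
  if h : b = b₀ then 1 else z ⟨b, h⟩

/-- The pullback of polynomials along the multiplication map, in the chart where the coefficient
with index `b₀` of the second factor is `1`. -/
def chartPullback (d r k : ℕ) (b₀ : Fin (d + 2 - k)) :
    MvPolynomial (Fin (r + 1) × Fin (d + 1)) ℂ →ₐ[ℂ]
      MvPolynomial ((Fin (r + 1) × Fin k) ⊕ {b // b ≠ b₀}) ℂ :=
  (aeval (Sum.elim (fun a => X (Sum.inl a)) fun b =>
    if h : b = b₀ then 1 else X (Sum.inr ⟨b, h⟩))).comp (mulPullback d r k)

theorem eval_chartPullback (b₀ : Fin (d + 2 - k))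
    (F : MvPolynomial (Fin (r + 1) × Fin (d + 1)) ℂ)
    (z : (Fin (r + 1) × Fin k) ⊕ {b // b ≠ b₀} → ℂ) :
    eval z (chartPullback d r k b₀ F) =
      eval (mulCoeff (z ∘ Sum.inl) (extendOne b₀ (z ∘ Sum.inr))) F := by
  rw [chartPullback, AlgHom.comp_apply, eval_aeval, ← eval_mulPullback]
  congr 2
  funext i
  rcases i with a | b
  · simp
  · simp only [Sum.elim_inr, extendOne]
    split_ifs <;> simp

theorem ker_chartPullback (b₀ : Fin (d + 2 - k)) :
    RingHom.ker (chartPullback d r k b₀) = RingHom.ker (mulPullback d r k) := by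
  ext F
  rw [RingHom.mem_ker, RingHom.mem_ker]
  refine ⟨fun h => ?_, fun h => by rw [chartPullback, AlgHom.comp_apply, h, map_zero]⟩
  have h0 : mulPullback d r k F * X (Sum.inr b₀) = 0 := by
    apply MvPolynomial.funext
    intro z
    obtain ⟨μ, ν, rfl⟩ : ∃ μ ν, z = Sum.elim μ ν :=
      ⟨z ∘ Sum.inl, z ∘ Sum.inr, (Sum.elim_comp_inl_inr z).symm⟩
    rw [map_mul, eval_X, Sum.elim_inr, map_zero, eval_mulPullback]
    by_cases hν : ν b₀ = 0
    · rw [hν, mul_zero]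
    have h1 := eval_chartPullback b₀ F (Sum.elim (ν b₀ • μ) fun b => (ν b₀)⁻¹ * ν b)
    have h2 : extendOne b₀ (fun b => (ν b₀)⁻¹ * ν b) = (ν b₀)⁻¹ • ν := by
      funext b
      simp only [extendOne, Pi.smul_apply, smul_eq_mul]
      split_ifs with hb
      · rw [hb, inv_mul_cancel₀ hν]
      · rfl
    rw [h, map_zero, Sum.elim_comp_inl, Sum.elim_comp_inr, h2, mulCoeff_smul_left,
      mulCoeff_smul_right, smul_smul, mul_inv_cancel₀ hν, one_smul] at h1
    rw [← h1, zero_mul]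
  exact (mul_eq_zero.1 h0).resolve_right (X_ne_zero _)

/-- On a dense open subset, both factors of a tuple are rational functions of the tuple. -/
theorem exists_chartPullback_mul_eq (hr : 1 ≤ r) (hk : 1 ≤ k) (hkd : k ≤ d + 1)
    (b₀ : Fin (d + 2 - k)) (t : (Fin (r + 1) × Fin k) ⊕ {b // b ≠ b₀}) :
    ∃ F₁ F₂, chartPullback d r k b₀ F₁ ≠ 0 ∧
      X t * chartPullback d r k b₀ F₁ = chartPullback d r k b₀ F₂ := by
  obtain ⟨-, -, ψ, hinv, -, -⟩ := isIsomorphismOn_mulMap (d := d) (r := r) hk hkd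
  have hψ := hinv.2
  obtain ⟨μ₀, hμ₀⟩ := exists_isPrimitive hr hk
  set z₀ : (Fin (r + 1) × Fin k) ⊕ {b // b ≠ b₀} → ℂ := Sum.elim μ₀ 0 with hz₀
  have hext : ∀ z, extendOne b₀ z ≠ 0 := fun z h => by
    have := congrFun h b₀
    simp [extendOne] at this
  set ν₀ := extendOne b₀ (z₀ ∘ Sum.inr) with hν₀
  have hf₀ : mulCoeff (d := d) μ₀ ν₀ ∉ productCone d r (k - 1) :=
    notMem_productCone_of_isPrimitive hkd hμ₀ (hext _) (by omega)
  have h0 := mulCoeff_ne_zero (d := d) hμ₀.ne_zero (hext (z₀ ∘ Sum.inr))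
  have hx : Projectivization.mk ℂ _ h0 ∈ stratum d r k \ stratum d r (k - 1) :=
    ⟨(mk_mem_stratum_iff hkd h0).2 ⟨μ₀, ν₀, rfl⟩, fun h =>
      hf₀ ((mk_mem_stratum_iff (by omega) h0).1 h)⟩
  obtain ⟨H, G, P, hG, hP⟩ := exists_isLocalFormula hk hkd hψ hx
  obtain ⟨nS, S, -, hS, hS0⟩ := exists_isHomogeneous_separating (by omega) hf₀
  have hH0 : eval (mulCoeff μ₀ ν₀) H ≠ 0 := by
    obtain ⟨n, hHn⟩ := hG.isHomogeneous_denom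
    have h1 := hG.denom_ne_zero
    obtain ⟨c, -, hc⟩ := exists_rep_eq_smul h0
    rw [hc, eval_smul_of_isHomogeneous hHn] at h1
    exact right_ne_zero_of_mul h1
  -- to prove a relation between pullbacks, it suffices to do so where `H` and `S` do not vanish
  -- the pullback of their product is not zero because both are nonzero at the base point `z₀`
  have hident : ∀ Q : MvPolynomial ((Fin (r + 1) × Fin k) ⊕ {b // b ≠ b₀}) ℂ,
      (∀ (z : (Fin (r + 1) × Fin k) ⊕ {b // b ≠ b₀} → ℂ) (α β : ℂ),
        (fun a => eval (mulCoeff (z ∘ Sum.inl) (extendOne b₀ (z ∘ Sum.inr))) (G a)) =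
          α • (z ∘ Sum.inl) →
        (fun b => eval (mulCoeff (z ∘ Sum.inl) (extendOne b₀ (z ∘ Sum.inr))) (P b)) =
          β • extendOne b₀ (z ∘ Sum.inr) → eval z Q = 0) → Q = 0 := by
    intro Q hQ
    have h1 : chartPullback d r k b₀ (H * S) * Q = 0 := by
      apply MvPolynomial.funext
      intro z
      rw [map_mul, eval_chartPullback, map_mul, map_zero]
      set f := mulCoeff (d := d) (z ∘ Sum.inl) (extendOne b₀ (z ∘ Sum.inr)) with hf
      by_cases hfS : f ∈ productCone d r (k - 1)
      · rw [hS f hfS, mul_zero, zero_mul]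
      by_cases hfH : eval f H = 0
      · rw [hfH, zero_mul, zero_mul]
      obtain ⟨α, β, -, -, hα, hβ⟩ := exists_smul_of_isLocalFormula hk hkd hψ hG hP
        (isPrimitive_of_notMem hk hkd hfS) (hext _) hfH
      rw [hQ z α β hα hβ, mul_zero]
    refine (mul_eq_zero.1 h1).resolve_left fun h2 => ?_
    have h3 := eval_chartPullback b₀ (H * S) z₀
    rw [h2, map_zero, map_mul] at h3
    exact mul_ne_zero hH0 hS0 h3.symm
  obtain ⟨α₀, β₀, hα₀, hβ₀, hGα, hPβ⟩ := exists_smul_of_isLocalFormula hk hkd hψ hG hP hμ₀ (hext _)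
    hH0
  have hb₀ : ∀ z, extendOne b₀ z b₀ = 1 := fun z => dif_pos rfl
  rcases t with a | ⟨b, hb⟩
  · obtain ⟨j, hj⟩ := Function.ne_iff.1 h0
    refine ⟨aeval (Sum.elim G P) (productPoly d r k j), G a * P b₀ * X j, fun h1 => ?_,
      sub_eq_zero.1 (hident _ fun z α β hα hβ => ?_)⟩
    · have h2 := eval_chartPullback b₀ (aeval (Sum.elim G P) (productPoly d r k j)) z₀
      rw [h1, map_zero, eval_aeval_productPoly] at h2
      change 0 = mulCoeff (fun a => eval (mulCoeff μ₀ ν₀) (G a))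
        (fun b => eval (mulCoeff μ₀ ν₀) (P b)) j at h2
      rw [hGα, hPβ, mulCoeff_smul_left, mulCoeff_smul_right] at h2
      exact mul_ne_zero hα₀ (mul_ne_zero hβ₀ hj) h2.symm
    · rw [map_sub, map_mul, eval_chartPullback, eval_chartPullback, eval_X, eval_aeval_productPoly,
        hα, hβ, mulCoeff_smul_left, mulCoeff_smul_right, map_mul, map_mul, eval_X, congrFun hα a,
        congrFun hβ b₀]
      simp only [Pi.smul_apply, smul_eq_mul, hb₀, Function.comp_apply]
      ring
  · have hb' : ∀ z, extendOne b₀ z b = z ⟨b, hb⟩ := fun z => dif_neg hb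
    refine ⟨P b₀, P b, fun h1 => ?_, sub_eq_zero.1 (hident _ fun z α β hα hβ => ?_)⟩
    · have h2 := eval_chartPullback b₀ (P b₀) z₀
      rw [h1, map_zero] at h2
      change 0 = eval (mulCoeff μ₀ ν₀) (P b₀) at h2
      rw [congrFun hPβ b₀, Pi.smul_apply, hb₀, smul_eq_mul, mul_one] at h2
      exact hβ₀ h2.symm
    · rw [map_sub, map_mul, eval_chartPullback, eval_chartPullback, eval_X, congrFun hβ b₀,
        congrFun hβ b]
      simp only [Pi.smul_apply, smul_eq_mul, hb₀, hb', Function.comp_apply]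
      ring

theorem coneDim_stratum (hr : 1 ≤ r) (hk : 1 ≤ k) (hkd : k ≤ d + 1) :
    coneDim (stratum d r k) = (((r + 1) * k + (d + 1 - k) : ℕ) : WithBot ℕ∞) := by
  have hb : 0 < d + 2 - k := by omega
  rw [coneDim, vanishingIdeal_stratum hk hkd, ← ker_chartPullback ⟨0, hb⟩,
    ringKrullDim_quotient_ker _ (exists_chartPullback_mul_eq hr hk hkd ⟨0, hb⟩)]
  congr 2
  rw [Fintype.card_sum, Fintype.card_prod, Fintype.card_fin, Fintype.card_fin,
    Fintype.card_subtype_compl, Fintype.card_fin, Fintype.card_unique]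
  omega

theorem coneDim_mono {ι : Type} {X Y : Set (PSpace ι)} (h : X ⊆ Y) : coneDim X ≤ coneDim Y :=
  ringKrullDim_le_of_surjective (Ideal.Quotient.factor (vanishingIdeal_anti h))
    (Ideal.Quotient.factor_surjective _)

theorem localConeDim_le {ι : Type} (X : Set (PSpace ι)) (x : PSpace ι) :
    localConeDim X x ≤ coneDim X :=
  iSup₂_le fun _ hZ => coneDim_mono hZ.1

theorem localConeDim_eq {ι : Type} {X : Set (PSpace ι)} {x : PSpace ι} (hx : x ∈ X)
    (hX : (vanishingIdeal X).IsPrime) : localConeDim X x = coneDim X :=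
  (localConeDim_le X x).antisymm (le_iSup₂ (f := fun Z _ => coneDim Z) X ⟨subset_rfl, hx, hX⟩)

/-- `R_k` is smooth at all points outside `R_{k-1}`. -/
theorem isSmoothPoint_stratum (hr : 1 ≤ r) (hk : 1 ≤ k) (hkd : k ≤ d + 1) {x : TupleSpace d r}
    (hx : x ∈ stratum d r k \ stratum d r (k - 1)) : IsSmoothPoint (stratum d r k) x := by
  rw [IsSmoothPoint, localConeDim_eq hx.1 (vanishingIdeal_stratum_isPrime hk hkd),
    coneDim_stratum hr hk hkd, coneTangentSpace_eq]
  have h := finrank_tangentSpaceAt hk hkd hx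
  congr 2
  omega

theorem isSmoothPoint_stratum_diff (hr : 1 ≤ r) (hk : 1 ≤ k) (hkd : k ≤ d + 1)
    {x : TupleSpace d r} (hx : x ∈ stratum d r k \ stratum d r (k - 1)) :
    IsSmoothPoint (stratum d r k \ stratum d r (k - 1)) x := by
  have h := vanishingIdeal_stratum_diff (d := d) hr hk hkd
  have h1 := isSmoothPoint_stratum hr hk hkd hx
  rw [IsSmoothPoint, localConeDim_eq hx.1 (vanishingIdeal_stratum_isPrime hk hkd), coneDim,
    coneTangentSpace_eq] at h1
  rw [IsSmoothPoint, localConeDim_eq hx (h ▸ vanishingIdeal_stratum_isPrime hk hkd), coneDim,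
    coneTangentSpace_eq, h]
  exact h1

end DimensionOfStrata

/-! ### Tangent spaces along `R_{k-1}` -/

section SingularPoints

open Polynomial

variable {d r k m : ℕ}

/-- Splitting off a linear form; if the degree drops, the form splits off the root at infinity. -/
theorem exists_eq_linear_mul {n : ℕ} (hn : 1 ≤ n) {p : ℂ[X]} (hp : p.degree < (n + 1 : ℕ)) :
    ∃ l q : ℂ[X], l.degree < (2 : ℕ) ∧ q.degree < n ∧ p = l * q := by
  rcases lt_or_ge p.degree n with hlt | hle
  · refine ⟨1, p, ?_, hlt, (one_mul p).symm⟩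
    rw [degree_one]
    exact_mod_cast two_pos
  · have hp0 : p.degree ≠ 0 := fun h => by
      rw [h] at hle
      exact absurd (by exact_mod_cast hle : n ≤ 0) (by omega)
    obtain ⟨τ, hτ⟩ := IsAlgClosed.exists_root p hp0
    obtain ⟨q, rfl⟩ := dvd_iff_isRoot.2 hτ
    refine ⟨X - C τ, q, ?_, ?_, rfl⟩
    · rw [degree_X_sub_C]
      exact_mod_cast one_lt_two
    · rw [degree_mul, degree_X_sub_C] at hp
      rcases eq_or_ne q 0 with h0 | h0
      · rw [h0, degree_zero]
        exact WithBot.bot_lt_coe _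
      · rw [degree_eq_natDegree h0] at hp ⊢
        norm_cast at hp ⊢
        omega

/-- The vector of coefficients of a tuple of polynomials. -/
def coeffVector (n r : ℕ) : (Fin (r + 1) → ℂ[X]) →ₗ[ℂ] (Fin (r + 1) × Fin n → ℂ) where
  toFun G ij := (G ij.1).coeff ij.2
  map_add' _ _ := by
    funext ij
    simp
  map_smul' _ _ := by
    funext ij
    simp

theorem coeffVector_apply {n : ℕ} (G : Fin (r + 1) → ℂ[X]) (ij : Fin (r + 1) × Fin n) :
    coeffVector n r G ij = (G ij.1).coeff ij.2 :=
  rfl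

theorem coeffVector_tuplePoly {n : ℕ} (v : Fin (r + 1) × Fin n → ℂ) :
    coeffVector n r (tuplePoly v) = v := by
  funext ij
  change (ofFn n fun j => v (ij.1, j)).coeff ij.2 = v ij
  rw [coeff_ofFn, dif_pos ij.2.2]

theorem coeffVector_injOn {n : ℕ} {G G' : Fin (r + 1) → ℂ[X]} (hG : ∀ i, (G i).degree < n)
    (hG' : ∀ i, (G' i).degree < n) (h : coeffVector n r G = coeffVector n r G') : G = G' := by
  obtain ⟨v, hv⟩ := exists_tuplePoly_eq hG
  obtain ⟨v', hv'⟩ := exists_tuplePoly_eq hG'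
  obtain rfl : tuplePoly v = G := funext hv
  obtain rfl : tuplePoly v' = G' := funext hv'
  rw [coeffVector_tuplePoly, coeffVector_tuplePoly] at h
  rw [h]

theorem coeffVector_mul (hk : k ≤ d + 2) (μ : Fin (r + 1) × Fin k → ℂ)
    (ν : Fin (d + 2 - k) → ℂ) :
    coeffVector (d + 1) r (fun i => tuplePoly μ i * ofFn _ ν) = mulCoeff μ ν := by
  rw [← coeffVector_tuplePoly (mulCoeff μ ν)]
  congr 1
  funext i
  exact (tuplePoly_mulCoeff hk μ ν i).symm

theorem coeffVector_mem_tangentSpaceAt (hk : 1 ≤ k) (hkd : k ≤ d + 1)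
    {g G : Fin (r + 1) → ℂ[X]} {p P : ℂ[X]} (hg : ∀ i, (g i).degree < k)
    (hG : ∀ i, (G i).degree < k) (hp : p.degree < (d + 2 - k : ℕ))
    (hP : P.degree < (d + 2 - k : ℕ)) :
    coeffVector (d + 1) r (fun i => G i * p + g i * P) ∈
      tangentSpaceAt (vanishingIdeal (stratum d r k))
        (coeffVector (d + 1) r fun i => g i * p) := by
  obtain ⟨μ, hμ⟩ := exists_tuplePoly_eq hg
  obtain ⟨M, hM⟩ := exists_tuplePoly_eq hG
  obtain ⟨ν, hν⟩ := exists_ofFn_eq hp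
  obtain ⟨N, hN⟩ := exists_ofFn_eq hP
  simp only [← hμ, ← hM, ← hν, ← hN]
  rw [coeffVector_mul (by omega)]
  refine range_mulDifferential_le hk hkd μ ν ⟨(M, N), ?_⟩
  rw [mulDifferential_apply, ← coeffVector_mul (by omega), ← coeffVector_mul (by omega), ← map_add]
  rfl

theorem degree_mul_lt {a b n : ℕ} {p q : ℂ[X]} (hp : p.degree < a) (hq : q.degree < b)
    (h : a + b ≤ n + 1) : (p * q).degree < n := by
  rw [degree_mul]
  rcases eq_or_ne p 0 with h0 | h0
  · rw [h0, degree_zero, WithBot.bot_add]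
    exact WithBot.bot_lt_coe _
  rcases eq_or_ne q 0 with h1 | h1
  · rw [h1, degree_zero, WithBot.add_bot]
    exact WithBot.bot_lt_coe _
  rw [degree_eq_natDegree h0] at hp ⊢
  rw [degree_eq_natDegree h1] at hq ⊢
  norm_cast at hp hq ⊢
  omega

theorem degree_add_C_mul_lt {n : ℕ} {p q : ℂ[X]} (a b : ℂ) (hp : p.degree < n)
    (hq : q.degree < n) : (C a * p + C b * q).degree < n := by
  rw [← smul_eq_C_mul, ← smul_eq_C_mul]
  exact (degree_add_le _ _).trans_lt (max_lt ((degree_smul_le a p).trans_lt hp)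
    ((degree_smul_le b q).trans_lt hq))

theorem exists_eq_add_X_mul {n : ℕ} {p : ℂ[X]} (hn : 1 ≤ n) (hp : p.degree < (n + 1 : ℕ)) :
    ∃ p₀ p₁ : ℂ[X], p₀.degree < n ∧ p₁.degree < n ∧ p = p₀ + X * p₁ := by
  refine ⟨C (p.coeff 0), divX p, degree_C_le.trans_lt (by exact_mod_cast hn), ?_, ?_⟩
  · rw [degree_lt_iff_coeff_zero]
    intro j hj
    rw [coeff_divX]
    exact coeff_eq_zero_of_degree_lt (hp.trans_le (by exact_mod_cast (by omega)))
  · rw [add_comm, X_mul_divX_add]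

/-- If `f = h * l₁ * l₂ * q` with independent linear forms `l₁` and `l₂`, then each of the two
factorizations `(h * l₁) * (l₂ * q)` and `(h * l₂) * (l₁ * q)` contributes tangent vectors at `f`.
Together they give all `G * q + h * P`. -/
theorem coeffVector_mem_tangentSpaceAt_of_linear (hkd : m + 2 ≤ d)
    {h : Fin (r + 1) → ℂ[X]} {l₁ l₂ q : ℂ[X]} (hh : ∀ i, (h i).degree < (m + 1 : ℕ))
    (hl₁ : l₁.degree < (2 : ℕ)) (hl₂ : l₂.degree < (2 : ℕ)) (hq : q.degree < (d - (m + 1) : ℕ))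
    {a₁ a₂ b₁ b₂ : ℂ} (ha : C a₁ * l₁ + C a₂ * l₂ = 1) (hb : C b₁ * l₁ + C b₂ * l₂ = X)
    {G : Fin (r + 1) → ℂ[X]} {P : ℂ[X]} (hG : ∀ i, (G i).degree < (m + 3 : ℕ))
    (hP : P.degree < (d - m + 1 : ℕ)) :
    coeffVector (d + 1) r (fun i => G i * q + h i * P) ∈
      tangentSpaceAt (vanishingIdeal (stratum d r (m + 2)))
        (coeffVector (d + 1) r fun i => h i * l₁ * l₂ * q) := by
  have hlin : ∀ {n : ℕ} {l p : ℂ[X]}, l.degree < (2 : ℕ) → p.degree < n →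
      (p * l).degree < (n + 1 : ℕ) := fun hl hp => degree_mul_lt hp hl le_rfl
  have hd : d + 2 - (m + 2) = d - (m + 1) + 1 := by omega
  have hd' : d - m = d + 2 - (m + 2) := by omega
  choose G₀ G₁ hG₀ hG₁ hG₀₁ using fun i => exists_eq_add_X_mul (by omega) (hG i)
  obtain ⟨P₀, P₁, hP₀, hP₁, rfl⟩ := exists_eq_add_X_mul (by omega) hP
  rw [hd'] at hP₀ hP₁
  have h1 := coeffVector_mem_tangentSpaceAt (d := d) (k := m + 2) (by omega) (by omega)
    (g := fun i => h i * l₁) (G := fun i => C a₂ * G₀ i + C b₂ * G₁ i) (p := q * l₂)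
    (P := C a₁ * P₀ + C b₁ * P₁) (fun i => hlin hl₁ (hh i))
    (fun i => degree_add_C_mul_lt _ _ (hG₀ i) (hG₁ i))
    (by rw [hd]; exact hlin hl₂ hq) (degree_add_C_mul_lt _ _ hP₀ hP₁)
  have h2 := coeffVector_mem_tangentSpaceAt (d := d) (k := m + 2) (by omega) (by omega)
    (g := fun i => h i * l₂) (G := fun i => C a₁ * G₀ i + C b₁ * G₁ i) (p := q * l₁)
    (P := C a₂ * P₀ + C b₂ * P₁) (fun i => hlin hl₂ (hh i))
    (fun i => degree_add_C_mul_lt _ _ (hG₀ i) (hG₁ i))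
    (by rw [hd]; exact hlin hl₁ hq) (degree_add_C_mul_lt _ _ hP₀ hP₁)
  have e1 : (fun i => h i * l₁ * (q * l₂)) = fun i => h i * l₁ * l₂ * q := by
    funext i
    ring
  have e2 : (fun i => h i * l₂ * (q * l₁)) = fun i => h i * l₁ * l₂ * q := by
    funext i
    ring
  rw [e1] at h1
  rw [e2] at h2
  have h3 := Submodule.add_mem _ h1 h2
  rw [← map_add] at h3
  convert h3 using 2
  funext i
  simp only [Pi.add_apply, hG₀₁ i]
  linear_combination (-G₀ i * q - h i * P₀) * ha + (-G₁ i * q - h i * P₁) * hb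

/-- The map `(G, P) ↦ G * q + h * P`. -/
def syzygyMap (d : ℕ) (h : Fin (r + 1) × Fin (m + 1) → ℂ) (q : ℂ[X]) :
    ((Fin (r + 1) × Fin (m + 3) → ℂ) × (Fin (d - m + 1) → ℂ)) →ₗ[ℂ]
      (Fin (r + 1) × Fin (d + 1) → ℂ) :=
  coeffVector (d + 1) r ∘ₗ
    LinearMap.pi fun i =>
      LinearMap.mulRight ℂ q ∘ₗ ofFn (m + 3) ∘ₗ LinearMap.funLeft ℂ ℂ (Prod.mk i) ∘ₗ
          LinearMap.fst ℂ _ _ +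
        LinearMap.mulLeft ℂ (tuplePoly h i) ∘ₗ ofFn (d - m + 1) ∘ₗ LinearMap.snd ℂ _ _

theorem syzygyMap_apply (h : Fin (r + 1) × Fin (m + 1) → ℂ) (q : ℂ[X]) (w) :
    syzygyMap d h q w =
      coeffVector (d + 1) r fun i => tuplePoly w.1 i * q + tuplePoly h i * ofFn _ w.2 :=
  rfl

/-- The kernel of `(G, P) ↦ G * q + h * P` consists of the pairs `(s * h, -s * q)` with `s` of
degree at most `2`. -/
theorem finrank_range_syzygyMap (hkd : m + 2 ≤ d) {h : Fin (r + 1) × Fin (m + 1) → ℂ} {q : ℂ[X]}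
    (hh : IsPrimitive h) (hq : q.degree < (d - (m + 1) : ℕ)) (hq0 : q ≠ 0) :
    (r + 1) * (m + 3) + (d - m + 1) ≤
      Module.finrank ℂ (LinearMap.range (syzygyMap d h q)) + 3 := by
  have h1 := LinearMap.finrank_range_add_finrank_ker (syzygyMap d h q)
  rw [Module.finrank_prod, Module.finrank_fintype_fun_eq_card, Module.finrank_fintype_fun_eq_card,
    Fintype.card_prod, Fintype.card_fin, Fintype.card_fin, Fintype.card_fin] at h1
  set σ : (Fin 3 → ℂ) →ₗ[ℂ] (Fin (r + 1) × Fin (m + 3) → ℂ) × (Fin (d - m + 1) → ℂ) :=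
    LinearMap.prod
      (coeffVector (m + 3) r ∘ₗ LinearMap.pi fun i =>
        LinearMap.mulRight ℂ (tuplePoly h i) ∘ₗ ofFn 3)
      (-(toFn (d - m + 1) ∘ₗ LinearMap.mulRight ℂ q ∘ₗ ofFn 3)) with hσ
  have h2 : LinearMap.ker (syzygyMap d h q) ≤ LinearMap.range σ := by
    rintro ⟨v, w⟩ hvw
    rw [LinearMap.mem_ker, syzygyMap_apply, ← map_zero (coeffVector (d + 1) r)] at hvw
    have h3 := coeffVector_injOn (fun i => (degree_add_le _ _).trans_lt (max_lt
      (degree_mul_lt (tuplePoly_degree_lt v i) hq (by omega))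
      (degree_mul_lt (tuplePoly_degree_lt h i) (ofFn_degree_lt w) (by omega))))
      (fun i => by
        rw [Pi.zero_apply, degree_zero]
        exact WithBot.bot_lt_coe _) hvw
    have h4 : ∀ i, tuplePoly v i * q + tuplePoly h i * ofFn _ w = 0 := fun i => congrFun h3 i
    obtain ⟨s, hs, hvs⟩ := hh.exists_eq_mul (m := 2) (G := tuplePoly v) (tuplePoly_degree_lt v)
      fun i j => by
        apply mul_right_cancel₀ hq0
        linear_combination tuplePoly h j * h4 i - tuplePoly h i * h4 j
    obtain ⟨c, rfl⟩ := exists_ofFn_eq hs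
    obtain ⟨i, hi⟩ := exists_tuplePoly_ne_zero hh.ne_zero
    have h5 : ofFn _ w = -(ofFn _ c * q) := by
      apply mul_left_cancel₀ hi
      have := h4 i
      rw [hvs] at this
      linear_combination this
    refine ⟨c, Prod.ext ?_ ?_⟩
    · rw [← coeffVector_tuplePoly v]
      change coeffVector (m + 3) r (fun i => ofFn 3 c * tuplePoly h i) = _
      congr 1
      funext i
      exact (hvs i).symm
    · change -toFn (d - m + 1) (ofFn 3 c * q) = w
      rw [← map_neg, ← h5]
      funext j
      change (ofFn _ w).coeff j = w j
      rw [coeff_ofFn, dif_pos j.2]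
  have h3 := (Submodule.finrank_mono h2).trans (LinearMap.finrank_range_le σ)
  rw [Module.finrank_fintype_fun_eq_card, Fintype.card_fin] at h3
  omega

theorem le_finrank_tangentSpaceAt_of_linear (hkd : m + 2 ≤ d)
    {h : Fin (r + 1) × Fin (m + 1) → ℂ} {l₁ l₂ q : ℂ[X]} (hh : IsPrimitive h)
    (hl₁ : l₁.degree < (2 : ℕ)) (hl₂ : l₂.degree < (2 : ℕ)) (hq : q.degree < (d - (m + 1) : ℕ))
    (hq0 : q ≠ 0)
    {a₁ a₂ b₁ b₂ : ℂ} (ha : C a₁ * l₁ + C a₂ * l₂ = 1) (hb : C b₁ * l₁ + C b₂ * l₂ = X) :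
    (r + 1) * (m + 3) + (d - m + 1) ≤
      Module.finrank ℂ (tangentSpaceAt (vanishingIdeal (stratum d r (m + 2)))
        (coeffVector (d + 1) r fun i => tuplePoly h i * l₁ * l₂ * q)) + 3 := by
  refine (finrank_range_syzygyMap hkd hh hq hq0).trans
    (Nat.add_le_add_right (Submodule.finrank_mono ?_) 3)
  rintro _ ⟨w, rfl⟩
  rw [syzygyMap_apply]
  exact coeffVector_mem_tangentSpaceAt_of_linear hkd (tuplePoly_degree_lt h) hl₁ hl₂ hq ha hb
    (tuplePoly_degree_lt w.1) (ofFn_degree_lt w.2)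

theorem mulCoeff_one (μ : Fin (r + 1) × Fin (m + 1) → ℂ) :
    mulCoeff (d := m) μ (fun _ => 1) = μ := by
  have h1 : ofFn (m + 2 - (m + 1)) (fun _ => (1 : ℂ)) = 1 := by
    ext j
    rw [coeff_ofFn, coeff_one]
    split_ifs <;> first | rfl | omega
  refine tuplePoly_injective fun i => ?_
  rw [tuplePoly_mulCoeff (by omega), h1, mul_one]

theorem finite_setOf_not_isPrimitive (μ : Fin (r + 1) × Fin (m + 1) → ℂ)
    {μ₀ : Fin (r + 1) × Fin (m + 1) → ℂ} (hμ₀ : IsPrimitive μ₀) :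
    {t : ℂ | ¬ IsPrimitive ((1 - t) • μ + t • μ₀)}.Finite := by
  have h0 : μ₀ ∉ productCone m r m := by
    rw [← mulCoeff_one μ₀]
    refine notMem_productCone_of_isPrimitive (by omega) hμ₀ (fun h => ?_) (by omega)
    exact one_ne_zero (congrFun h ⟨0, by omega⟩)
  obtain ⟨n, F, -, hF, hF0⟩ := exists_isHomogeneous_separating (by omega) h0
  set Γ : Fin (r + 1) × Fin (m + 1) → ℂ[X] := fun j => (1 - X) * C (μ j) + X * C (μ₀ j) with hΓ
  have hΓt : ∀ t, (fun j => (Γ j).eval t) = (1 - t) • μ + t • μ₀ := by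
    intro t
    funext j
    simp [hΓ, mul_comm t]
  set p : ℂ[X] := MvPolynomial.aeval Γ F with hp
  have hpt : ∀ t, p.eval t = MvPolynomial.eval ((1 - t) • μ + t • μ₀) F := fun t => by
    rw [← hΓt, eval_eval_polynomial]
  have hp0 : p ≠ 0 := fun h => by
    have := hpt 1
    rw [h, eval_zero, sub_self, zero_smul, zero_add, one_smul] at this
    exact hF0 this.symm
  refine p.roots.toFinset.finite_toSet.subset fun t ht => ?_
  rw [Finset.mem_coe, Multiset.mem_toFinset, mem_roots hp0, IsRoot, hpt]
  by_contra hne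
  refine ht (isPrimitive_of_notMem (d := m) (ν := fun _ => 1) (by omega) (by omega) fun h => ?_)
  rw [mulCoeff_one] at h
  exact hne (hF _ h)

/-- For all but finitely many parameters `t` on the lines through `l₁, l₂` and `1, X`, the two linear
forms are independent. -/
theorem finite_setOf_not_span {l₁ l₂ : ℂ[X]} (hl₁ : l₁.degree < (2 : ℕ))
    (hl₂ : l₂.degree < (2 : ℕ)) :
    {t : ℂ | ¬ ∃ a₁ a₂ b₁ b₂ : ℂ,
      C a₁ * (C (1 - t) * l₁ + C t) + C a₂ * (C (1 - t) * l₂ + C t * X) = 1 ∧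
      C b₁ * (C (1 - t) * l₁ + C t) + C b₂ * (C (1 - t) * l₂ + C t * X) = X}.Finite := by
  obtain ⟨α, β, rfl⟩ := exists_eq_X_add_C_of_natDegree_le_one
    (natDegree_le_of_degree_le (Order.le_of_lt_succ hl₁))
  obtain ⟨γ, δ, rfl⟩ := exists_eq_X_add_C_of_natDegree_le_one
    (natDegree_le_of_degree_le (Order.le_of_lt_succ hl₂))
  set D : ℂ[X] := ((1 - X) * C β + X) * ((1 - X) * C γ + X) - (1 - X) * C α * ((1 - X) * C δ)
    with hD
  have hDt : ∀ t, D.eval t =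
      ((1 - t) * β + t) * ((1 - t) * γ + t) - (1 - t) * α * ((1 - t) * δ) := by
    intro t
    simp [hD]
  have hD0 : D ≠ 0 := fun h => by
    have := hDt 1
    rw [h, eval_zero] at this
    simp at this
  refine D.roots.toFinset.finite_toSet.subset fun t ht => ?_
  rw [Finset.mem_coe, Multiset.mem_toFinset, mem_roots hD0, IsRoot]
  by_contra hne
  rw [hDt] at hne
  set E := ((1 - t) * β + t) * ((1 - t) * γ + t) - (1 - t) * α * ((1 - t) * δ) with hE
  have hEC : C E⁻¹ * C E = 1 := by rw [← C_mul, inv_mul_cancel₀ hne, C_1]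
  refine ht ⟨E⁻¹ * ((1 - t) * γ + t), -(E⁻¹ * ((1 - t) * α)), -(E⁻¹ * ((1 - t) * δ)),
    E⁻¹ * ((1 - t) * β + t), ?_, ?_⟩
  · rw [← hEC, hE]
    simp only [C_mul, C_add, C_sub, C_neg, C_1]
    ring
  · conv_rhs => rw [← one_mul X, ← hEC, hE]
    simp only [C_mul, C_add, C_sub, C_neg, C_1]
    ring

/-- A tuple with `d - k + 2` common roots is a limit, along a polynomial curve, of tuples
`h * l₁ * l₂ * q` with `h` primitive and `l₁`, `l₂` independent. There the tangent space is too
large, hence by semicontinuity also at the given tuple. With `k = m + 2`, the bound exceeds the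
dimension of the cone over `R_k` by `r`. -/
theorem le_finrank_tangentSpaceAt (hr : 1 ≤ r) (hkd : m + 2 ≤ d) {v : Fin (r + 1) × Fin (d + 1) → ℂ}
    (hv0 : v ≠ 0) (hv : v ∈ productCone d r (m + 1)) :
    (r + 1) * (m + 3) + (d - m + 1) ≤
      Module.finrank ℂ (tangentSpaceAt (vanishingIdeal (stratum d r (m + 2))) v) + 3 := by
  obtain ⟨μ, ν, rfl⟩ := hv
  obtain ⟨l₁, p, hl₁, hp, hνp⟩ := exists_eq_linear_mul (n := d - m) (by omega)
    (p := ofFn _ ν) ((ofFn_degree_lt ν).trans_le (by exact_mod_cast (by omega)))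
  obtain ⟨l₂, q, hl₂, hq, rfl⟩ := exists_eq_linear_mul (n := d - (m + 1)) (by omega) (p := p)
    (hp.trans_le (by exact_mod_cast (by omega)))
  have hq0 : q ≠ 0 := by
    rintro rfl
    rw [mul_zero, mul_zero, ofFn_eq_zero_iff] at hνp
    apply hv0
    have := mulCoeff_smul_right (d := d) (0 : ℂ) μ ν
    rwa [zero_smul, zero_smul, ← hνp] at this
  obtain ⟨μ₀, hμ₀⟩ := exists_isPrimitive (k := m + 1) hr (by omega)
  -- the curve, with `X : ℂ[X][X]` the variable of the forms and `C X` the parameter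
  set Λ : Fin (r + 1) → ℂ[X][X] := fun i =>
    (C (1 - X) * (tuplePoly μ i).map C + C X * (tuplePoly μ₀ i).map C) *
      (C (1 - X) * l₁.map C + C X) * (C (1 - X) * l₂.map C + C X * X) * q.map C with hΛ
  set Γ : Fin (r + 1) × Fin (d + 1) → ℂ[X] := fun j => (Λ j.1).coeff j.2 with hΓ
  have hmap : ∀ (t : ℂ) (f : ℂ[X]), (f.map C).map (evalRingHom t) = f := by
    intro t f
    rw [map_map]
    have : (evalRingHom t).comp C = RingHom.id ℂ := RingHom.ext fun a => by simp
    rw [this, map_id]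
  have hΓt : ∀ t, (fun j => (Γ j).eval t) = coeffVector (d + 1) r fun i =>
      tuplePoly ((1 - t) • μ + t • μ₀) i * (C (1 - t) * l₁ + C t) * (C (1 - t) * l₂ + C t * X) *
        q := by
    intro t
    funext j
    have h1 : (Λ j.1).map (evalRingHom t) = tuplePoly ((1 - t) • μ + t • μ₀) j.1 *
        (C (1 - t) * l₁ + C t) * (C (1 - t) * l₂ + C t * X) * q := by
      simp only [hΛ, Polynomial.map_mul, Polynomial.map_add, hmap, map_C, map_X, coe_evalRingHom,
        eval_sub, eval_one, eval_X, tuplePoly_add, tuplePoly_smul]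
    rw [coeffVector_apply, ← h1, coeff_map]
    rfl
  have hΓ0 : (fun j => (Γ j).eval 0) = mulCoeff μ ν := by
    rw [hΓt, ← coeffVector_mul (by omega), hνp]
    congr 1
    funext i
    simp only [sub_zero, one_smul, zero_smul, add_zero, C_1, one_mul, C_0, zero_mul, mul_assoc]
  obtain ⟨t, ht⟩ := (((finite_setOf_finrank_tangentSpaceAt_lt
    (vanishingIdeal (stratum d r (m + 2))) Γ 0).union
      (finite_setOf_not_isPrimitive μ hμ₀)).union (finite_setOf_not_span hl₁ hl₂)).exists_notMem
  simp only [Set.mem_union, Set.mem_ofPred_eq, not_or, not_not, not_lt] at ht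
  obtain ⟨⟨h1, h2⟩, a₁, a₂, b₁, b₂, ha, hb⟩ := ht
  rw [hΓ0, hΓt] at h1
  refine (le_finrank_tangentSpaceAt_of_linear hkd h2 ?_ ?_ hq hq0 ha hb).trans
    (Nat.add_le_add_right h1 3)
  · have := degree_add_C_mul_lt (1 - t) t hl₁ (q := 1) (by rw [degree_one]; exact_mod_cast two_pos)
    rwa [mul_one] at this
  · exact degree_add_C_mul_lt _ _ hl₂ (by rw [degree_X]; exact_mod_cast one_lt_two)

theorem not_isSmoothPoint_stratum (hr : 1 ≤ r) (hk : 1 ≤ k) (hkd : k ≤ d) {x : TupleSpace d r}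
    (hx : x ∈ stratum d r (k - 1)) : ¬ IsSmoothPoint (stratum d r k) x := by
  have hx1 := (mem_stratum_iff (by omega) x).1 hx
  obtain rfl | ⟨m, rfl⟩ : k = 1 ∨ ∃ m, k = m + 2 := by
    rcases k with _ | _ | m
    · omega
    · exact Or.inl rfl
    · exact Or.inr ⟨m, rfl⟩
  -- `R_0` is empty
  · obtain ⟨μ, ν, h⟩ := hx1
    exact absurd (h.trans (funext fun j => by simp [mulCoeff])) x.rep_nonzero
  intro h
  have h1 := le_finrank_tangentSpaceAt hr hkd x.rep_nonzero hx1
  have h2 := localConeDim_le (stratum d r (m + 2)) x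
  rw [← h, coneDim_stratum hr hk (by omega), coneTangentSpace_eq] at h2
  have h3 : Module.finrank ℂ (tangentSpaceAt (vanishingIdeal (stratum d r (m + 2))) x.rep) ≤
      (r + 1) * (m + 2) + (d + 1 - (m + 2)) := by exact_mod_cast h2
  have h4 : (r + 1) * (m + 3) = (r + 1) * (m + 2) + (r + 1) := by ring
  omega

theorem singularLocus_stratum (hr : 1 ≤ r) (hk : 1 ≤ k) (hkd : k ≤ d) :
    singularLocus (stratum d r k) = stratum d r (k - 1) := by
  ext x
  refine ⟨fun hx => ?_, fun hx => ⟨?_, not_isSmoothPoint_stratum hr hk hkd hx⟩⟩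
  · by_contra hx'
    exact hx.2 (isSmoothPoint_stratum hr hk (by omega) ⟨hx.1, hx'⟩)
  · exact (mem_stratum_iff (by omega) x).2 (productCone_mono (by omega) (by omega)
      ((mem_stratum_iff (by omega) x).1 hx))

theorem singularLocus_stratum_diff (hr : 1 ≤ r) (hk : 1 ≤ k) (hkd : k ≤ d + 1) :
    singularLocus (stratum d r k \ stratum d r (k - 1)) = ∅ :=
  Set.eq_empty_iff_forall_notMem.2 fun _ hx => hx.2 (isSmoothPoint_stratum_diff hr hk hkd hx.1)

end SingularPoints

end CommonRootStrata

end

theorem theorem2p3 (d r k : ℕ) (hr : 1 ≤ r) (hk : 1 ≤ k) (hkd : k ≤ d) :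
    -- the singular locus of `R_k` is exactly `R_{k-1}`
    CommonRootStrata.singularLocus (CommonRootStrata.stratum d r k) =
      CommonRootStrata.stratum d r (k - 1) ∧
    -- `R_k` is the common zero locus of the `2k × 2k` minors of the matrix `A`
    CommonRootStrata.stratum d r k =
      {s | ∀ (e : Fin (2 * k) ↪ Fin k × Fin (r + 1)) (c : Fin (2 * k) ↪ Fin (d + k)),
        ((CommonRootStrata.sylvesterMatrix k s.rep).submatrix e c).det = 0} ∧
    -- `R_k \ R_{k-1}` is smooth
    CommonRootStrata.singularLocus
      (CommonRootStrata.stratum d r k \ CommonRootStrata.stratum d r (k - 1)) = ∅ ∧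
    -- the preimage of `R_k \ R_{k-1}` under the multiplication map is open, and the
    -- multiplication map restricts to an isomorphism of this preimage onto `R_k \ R_{k-1}`
    CommonRootStrata.IsZariskiOpenProd (CommonRootStrata.mulMap d r k ⁻¹'
      (CommonRootStrata.stratum d r k \ CommonRootStrata.stratum d r (k - 1))) ∧
    CommonRootStrata.IsIsomorphismOn (CommonRootStrata.mulMap d r k)
      (CommonRootStrata.mulMap d r k ⁻¹'
        (CommonRootStrata.stratum d r k \ CommonRootStrata.stratum d r (k - 1)))
      (CommonRootStrata.stratum d r k \ CommonRootStrata.stratum d r (k - 1)) := by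
  have hkd' : k ≤ d + 1 := by omega
  exact ⟨CommonRootStrata.singularLocus_stratum hr hk hkd,
    CommonRootStrata.stratum_eq_minors hk hkd',
    CommonRootStrata.singularLocus_stratum_diff hr hk hkd',
    CommonRootStrata.isZariskiOpenProd_preimage hk hkd',
    CommonRootStrata.isIsomorphismOn_mulMap hk hkd'⟩
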